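/- Let $(M,g)$ be a connected smooth Riemannian manifold (without boundary) of dimension $n$, and let $k\ge 1$ be an integer with $2k<n$ and $n\neq 4k$. Conventions. On each tangent space $V=T_xM$ let $\mathcal D=\Lambda V^*\otimes\Lambda V^*$ be the algebra of double forms, with product $(\alpha\otimes\beta)(\gamma\otimes\delta)=(\alpha\wedge\gamma)\otimes(\beta\wedge\delta)$ and inner product $\langle\alpha\otimes\beta,\gamma\otimes\delta\rangle=\langle\alpha,\gamma\rangle\langle\beta,\delta\rangle$, where $\Lambda V^*$ carries the inner product induced by $g$ for which the forms $e^{i_1}\wedge\dots\wedge e^{i_p}$ with $i_1<\dots<i_p$ are orthonormal whenever $(e_i)$ is an orthonormal basis of $V$. The metric $g=\sum_i e^i\otimes e^i$ is a $(1,1)$ double form; the contraction $\mathbf c$ is the adjoint of the multiplication by $g$; and $\circ$ is the composition product obtained by identifying $\mathcal D$ with $\mathrm{End}(\Lambda V)$ through the inner product. The Riemann curvature tensor $R$ is regarded as a $(2,2)$ double form, and $R^k$ is its $k$-th power in $\mathcal D$. Suppose that $(M,g)$ is hyper $(2k)$-Einstein, i.e. there is a function $\lambda:M\to\mathbb R$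 with $$\mathbf c R^k=\lambda\, g^{2k-1}\quad\text{on } M,$$ and weakly $(2k)$-Einstein, i.e. $$\frac{1}{(2k-1)!}\,\mathbf c^{2k-1}(R^k\circ R^k)=\frac{2k}{n}\,\|R^k\|^2\,g\quad\text{on } M.$$ Then $\|R^k\|$ is constant on $M$. -/

import Mathlib

open scoped TensorProduct Bundle Manifold ContDiff InnerProductSpace

noncomputable section

/-! ### Double forms on a Euclidean vector space -/

namespace DoubleForms

/-- The exterior algebra `Λ V*` of the dual space of `V`. -/
abbrev Forms (V : Type*) [NormedAddCommGroup V] [InnerProductSpace ℝ V] : Type _ :=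
  ExteriorAlgebra ℝ (Module.Dual ℝ V)

/-- The double exterior algebra `Λ V* ⊗ Λ V*`. Its ring structure is the one of
`Mathlib.RingTheory.TensorProduct`, namely `(α ⊗ β) * (γ ⊗ δ) = (α ∧ γ) ⊗ (β ∧ δ)`, so `*` and `^`
are the exterior product and the exterior powers of double forms. -/
abbrev DoubleForm (V : Type*) [NormedAddCommGroup V] [InnerProductSpace ℝ V] : Type _ :=
  Forms V ⊗[ℝ] Forms V

variable (V : Type*) [NormedAddCommGroup V] [InnerProductSpace ℝ V] [FiniteDimensional ℝ V]

/-- The musical isomorphism `V* → V`, `⟪sharp f, v⟫ = f v`. -/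
def sharp : Module.Dual ℝ V →ₗ[ℝ] V :=
  have : CompleteSpace V := FiniteDimensional.complete ℝ V
  (InnerProductSpace.toDual ℝ V).symm.toLinearEquiv.toLinearMap ∘ₗ
    (LinearMap.toContinuousLinearMap (𝕜 := ℝ) (E := V) (F' := ℝ)).toLinearMap

theorem inner_sharp (f : Module.Dual ℝ V) (v : V) : ⟪sharp V f, v⟫_ℝ = f v := by
  have : CompleteSpace V := FiniteDimensional.complete ℝ V
  exact InnerProductSpace.toDual_symm_apply

/-- The interior product by the vector `sharp f` on `Λ V*`, i.e. the antiderivation of degree `-1`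
with `e ↦ e (sharp f)` on 1-forms `e`. -/
def contractCovector : Module.Dual ℝ V →ₗ[ℝ] Module.End ℝ (Forms V) :=
  (CliffordAlgebra.contractLeft (Q := (0 : QuadraticForm ℝ (Module.Dual ℝ V)))) ∘ₗ
    Module.Dual.eval ℝ V ∘ₗ sharp V

theorem contractCovector_sq (f : Module.Dual ℝ V) :
    contractCovector V f * contractCovector V f = 0 :=
  LinearMap.ext fun x => CliffordAlgebra.contractLeft_contractLeft _ x

/-- The interior product `ι_α` on `Λ V*`, the adjoint of `β ↦ α ∧ β`. It is the extension of the
interior product by covectors with `ι_{α ∧ β} = ι_β ∘ ι_α`. -/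
def interiorForm : Forms V →ₐ[ℝ] (Module.End ℝ (Forms V))ᵐᵒᵖ :=
  ExteriorAlgebra.lift ℝ
    ⟨(MulOpposite.opLinearEquiv ℝ).toLinearMap ∘ₗ contractCovector V, fun f => by
      change MulOpposite.op _ * MulOpposite.op _ = 0
      rw [← MulOpposite.op_mul, contractCovector_sq, MulOpposite.op_zero]⟩

/-- The inner product on `Λ V*` induced by the one of `V`: the degree zero part of `ι_α β`, that is
`⟨α₁ ∧ ⋯ ∧ αₚ, β₁ ∧ ⋯ ∧ βₚ⟩ = det ⟨αᵢ, βⱼ⟩`, with different degrees orthogonal. -/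
def innerForm : LinearMap.BilinForm ℝ (Forms V) :=
  (LinearMap.compRight ℝ (ExteriorAlgebra.algebraMapInv (R := ℝ) (M := Module.Dual ℝ V)).toLinearMap)
    ∘ₗ (MulOpposite.opLinearEquiv ℝ).symm.toLinearMap ∘ₗ (interiorForm V).toLinearMap

/-- The inner product on double forms, `⟨α ⊗ β, γ ⊗ δ⟩ = ⟨α, γ⟩ ⟨β, δ⟩`. -/
def innerD : LinearMap.BilinForm ℝ (DoubleForm V) :=
  LinearMap.BilinForm.tmul (innerForm V) (innerForm V)

/-- The norm of a double form. -/
def normD (w : DoubleForm V) : ℝ := √(innerD V w w)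

/-- The interior product `ι_w` of double forms, `ι_{α ⊗ β} = ι_α ⊗ ι_β`. -/
def interiorD : DoubleForm V →ₗ[ℝ] Module.End ℝ (DoubleForm V) :=
  TensorProduct.homTensorHomMap (RingHom.id ℝ) (Forms V) (Forms V) (Forms V) (Forms V) ∘ₗ
    TensorProduct.map
      ((MulOpposite.opLinearEquiv ℝ).symm.toLinearMap ∘ₗ (interiorForm V).toLinearMap)
      ((MulOpposite.opLinearEquiv ℝ).symm.toLinearMap ∘ₗ (interiorForm V).toLinearMap)

/-- `ι_w` is the adjoint of the exterior multiplication by `w`. -/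
theorem innerD_mul_left (w β α : DoubleForm V) :
    innerD V (w * β) α = innerD V β (interiorD V w α) := by
  have key : ∀ a b c : Forms V, innerForm V (a * b) c =
      innerForm V b (MulOpposite.unop (interiorForm V a) c) := by
    intro a b c
    simp [innerForm, LinearMap.compRight]
  induction w using TensorProduct.induction_on with
  | zero => simp
  | add x y hx hy => simp [add_mul, hx, hy]
  | tmul a a' =>
    induction β using TensorProduct.induction_on with
    | zero => simp
    | add x y hx hy => simp [mul_add, hx, hy]
    | tmul b b' =>
      induction α using TensorProduct.induction_on with
      | zero => simp
      | add x y hx hy => rw [map_add, map_add, map_add, hx, hy]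
      | tmul c c' =>
        simp [innerD, interiorD, Algebra.TensorProduct.tmul_mul_tmul, key]

/-- The metric, viewed as a `(1,1)` double form `g = ∑ eⁱ ⊗ eⁱ` for an orthonormal basis `(eᵢ)`. -/
def metricD : DoubleForm V :=
  ∑ i, ExteriorAlgebra.ι ℝ (innerₗ V (stdOrthonormalBasis ℝ V i)) ⊗ₜ[ℝ]
    ExteriorAlgebra.ι ℝ (innerₗ V (stdOrthonormalBasis ℝ V i))

/-- The contraction `c = ι_g`. -/
def contraction : Module.End ℝ (DoubleForm V) := interiorD V (metricD V)

/-- The canonical map `Λ V* ⊗ Λ V* → End (Λ V*)`, `α ⊗ β ↦ (γ ↦ ⟨α, γ⟩ β)`; here `Λ V*` is identified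
with `Λ V` through the inner product. -/
def toEnd : DoubleForm V →ₗ[ℝ] Module.End ℝ (Forms V) :=
  dualTensorHom ℝ (Forms V) (Forms V) ∘ₗ LinearMap.rTensor (Forms V) (innerForm V)

/-- The composition product of double forms,
`(α ⊗ β) ∘ (γ ⊗ δ) = ⟨α, δ⟩ γ ⊗ β`. -/
def comp (w η : DoubleForm V) : DoubleForm V :=
  LinearMap.lTensor (Forms V) (toEnd V w) η

/-- The composition product is the composition of endomorphisms of `Λ V*`. -/
theorem toEnd_comp (w η : DoubleForm V) :
    toEnd V (comp V w η) = toEnd V w * toEnd V η := by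
  induction η using TensorProduct.induction_on with
  | zero => simp [comp]
  | add x y hx hy =>
    have h : comp V w (x + y) = comp V w x + comp V w y := by simp [comp]
    rw [h, map_add, hx, hy, map_add, mul_add]
  | tmul a b =>
    ext c
    simp [comp, toEnd]

end DoubleForms

/-! ### The Riemann curvature tensor -/

namespace Curvature

open DoubleForms

/-- The partial derivative `∂ᵢ f` of a function of `n` real variables. -/
def partialDeriv {n : ℕ} (i : Fin n) (f : EuclideanSpace ℝ (Fin n) → ℝ)
    (y : EuclideanSpace ℝ (Fin n)) : ℝ :=
  fderiv ℝ f y (EuclideanSpace.single i 1)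

/-- The Christoffel symbol `Γᵐᵢⱼ` of a metric given by its matrix of coefficients. -/
def christoffel {n : ℕ} (G : EuclideanSpace ℝ (Fin n) → Matrix (Fin n) (Fin n) ℝ)
    (m i j : Fin n) (y : EuclideanSpace ℝ (Fin n)) : ℝ :=
  1 / 2 * ∑ l, (G y)⁻¹ m l *
    (partialDeriv i (fun z => G z j l) y + partialDeriv j (fun z => G z i l) y
      - partialDeriv l (fun z => G z i j) y)

/-- The coefficient of `∂ₘ` in `R(∂ᵢ, ∂ⱼ)∂ₗ = ∇ᵢ∇ⱼ∂ₗ - ∇ⱼ∇ᵢ∂ₗ`. -/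
def riemannUp {n : ℕ} (G : EuclideanSpace ℝ (Fin n) → Matrix (Fin n) (Fin n) ℝ)
    (m i j l : Fin n) (y : EuclideanSpace ℝ (Fin n)) : ℝ :=
  partialDeriv i (christoffel G m j l) y - partialDeriv j (christoffel G m i l) y
    + ∑ s, (christoffel G m i s y * christoffel G s j l y
      - christoffel G m j s y * christoffel G s i l y)

/-- The covariant curvature coefficient `R(∂ᵢ, ∂ⱼ, ∂ₖ, ∂ₗ) = g(R(∂ᵢ, ∂ⱼ)∂ₗ, ∂ₖ)`; with this sign
`R(u, v, u, v)` is the sectional curvature of an orthonormal pair `u`, `v`. -/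
def riemannDown {n : ℕ} (G : EuclideanSpace ℝ (Fin n) → Matrix (Fin n) (Fin n) ℝ)
    (i j k l : Fin n) (y : EuclideanSpace ℝ (Fin n)) : ℝ :=
  ∑ m, G y m k * riemannUp G m i j l y

variable (n : ℕ) {M : Type*} [TopologicalSpace M] [ChartedSpace (EuclideanSpace ℝ (Fin n)) M]

/-- The coordinate vector field `∂ᵢ` of the preferred chart at `x`, at the point with
coordinates `y`. -/
def coordVector (x : M) (y : EuclideanSpace ℝ (Fin n)) (i : Fin n) :
    TangentSpace (𝓡 n) ((extChartAt (𝓡 n) x).symm y) :=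
  mfderiv 𝓘(ℝ, EuclideanSpace ℝ (Fin n)) (𝓡 n) (extChartAt (𝓡 n) x).symm y
    (EuclideanSpace.single i (1 : ℝ) : EuclideanSpace ℝ (Fin n))

/-- The differential at `x` of the `i`-th coordinate function of the preferred chart at `x`. -/
def coordCovector (x : M) (i : Fin n) : TangentSpace (𝓡 n) x →L[ℝ] ℝ :=
  (EuclideanSpace.proj i : EuclideanSpace ℝ (Fin n) →L[ℝ] ℝ) ∘L
    (mfderiv (𝓡 n) 𝓘(ℝ, EuclideanSpace ℝ (Fin n)) (extChartAt (𝓡 n) x) x :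
      TangentSpace (𝓡 n) x →L[ℝ] EuclideanSpace ℝ (Fin n))

variable [Bundle.RiemannianBundle (fun x : M => TangentSpace (𝓡 n) x)]

/-- The coefficients `gᵢⱼ` of the Riemannian metric in the preferred chart at `x`. -/
def metricCoeff (x : M) (y : EuclideanSpace ℝ (Fin n)) : Matrix (Fin n) (Fin n) ℝ :=
  fun i j => ⟪coordVector n x y i, coordVector n x y j⟫_ℝ

instance finiteDimensional_tangentSpace (x : M) : FiniteDimensional ℝ (TangentSpace (𝓡 n) x) :=
  inferInstanceAs (FiniteDimensional ℝ (EuclideanSpace ℝ (Fin n)))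

/-- The Riemann curvature tensor at `x`, as the `(2,2)` double form
`R = ∑_{i<j, k<l} Rᵢⱼₖₗ (dxⁱ ∧ dxʲ) ⊗ (dxᵏ ∧ dxˡ)`. -/
def riemann (x : M) : DoubleForm (TangentSpace (𝓡 n) x) :=
  let dx (i : Fin n) : Forms (TangentSpace (𝓡 n) x) :=
    ExteriorAlgebra.ι ℝ (coordCovector n x i).toLinearMap
  ∑ i, ∑ j ∈ Finset.Ioi i, ∑ k, ∑ l ∈ Finset.Ioi k,
    riemannDown (metricCoeff n x) i j k l (extChartAt (𝓡 n) x x) •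
      ((dx i * dx j) ⊗ₜ[ℝ] (dx k * dx l))

variable (M)

/-- `M` is hyper `(2k)`-Einstein: `c R^k = λ g^(2k-1)` for some function `λ`. -/
def IsHyperEinstein (k : ℕ) : Prop :=
  ∃ lam : M → ℝ, ∀ x : M,
    contraction (TangentSpace (𝓡 n) x) (riemann n x ^ k) =
      lam x • metricD (TangentSpace (𝓡 n) x) ^ (2 * k - 1)

/-- `M` is weakly `(2k)`-Einstein:
`c^(2k-1) (R^k ∘ R^k) / (2k-1)! = (2k/n) ‖R^k‖² g`. -/
def IsWeaklyEinstein (k : ℕ) : Prop :=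
  ∀ x : M,
    (1 / ((2 * k - 1).factorial : ℝ)) •
      (contraction (TangentSpace (𝓡 n) x) ^ (2 * k - 1))
        (comp (TangentSpace (𝓡 n) x) (riemann n x ^ k) (riemann n x ^ k)) =
      ((2 * k : ℝ) / n * normD (TangentSpace (𝓡 n) x) (riemann n x ^ k) ^ 2) •
        metricD (TangentSpace (𝓡 n) x)

end Curvature

end

/-!
Write `p = 2k`. The proof computes the divergence of the `(1,1)` double form `c^(p-1) (R^k ∘ R^k)
/ (p-1)!` in two ways. Its components are the inner products `⟨ι_{eᵢ} R^k, ι_{eⱼ} R^k⟩` of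
interior products in one factor (`innerD_one_lcontr_rcontr_comp`), so the divergence has two
parts. The part where the derivative falls on the first factor contains the divergence of `R^k`.
The hyper-Einstein condition kills it by Schur's lemma (`sum_lcontr_eq_zero`): contracting the
second Bianchi identity expresses the divergence of `R^k` by `dλ`, contracting once more gives `dλ
= 0` because `p < n`. The other part is `½ d‖R^k‖²` by the second Bianchi identity. The weak
condition, however, makes the divergence equal to `(p / n) d‖R^k‖²`. As `n ≠ 2p`, the differential
of `‖R^k‖²` vanishes (`innerD_derivative_eq_zero`).

This algebra takes place at one point and needs no connection: quadratic normal coordinates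
(`exists_normal_coordinates`), in which the Christoffel symbols vanish at the origin, and an
orthonormal frame which is constant to first order (`exists_orthonormal_frame`) turn covariant
derivatives at the origin into partial derivatives, and the second Bianchi identity into the
symmetry of second derivatives (`MetricAt.bianchi`). To use such coordinates, the coordinate
definition of the curvature is related to a coordinate-free expression `curv` for metrics on a
vector space, which is a tensor (`riemannDown_eq_curv`, `curv_pullback`). In particular the
curvature of the manifold, defined at each point through the preferred chart of that point, is
computed near `x` in the single chart at `x` (`isoPull_riemann`). All ingredients of the two
Einstein conditions are natural under isometries, so that the conditions may be read in
orthonormal frames of Euclidean space (`hasFDerivAt_normD_sq`). Thus `‖R^k‖` is locally constant,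
hence constant on a connected manifold.

Double forms live in an algebraic tensor product without a topology; `HasDer` is the calculus of
derivatives used for them.
-/

noncomputable section

set_option linter.unusedSectionVars false
set_option maxSynthPendingDepth 3

namespace DoubleForms

variable {V : Type*} [NormedAddCommGroup V] [InnerProductSpace ℝ V] [FiniteDimensional ℝ V]

/-! ### Interior products and the inner product of forms -/

theorem contractCovector_ι_mul (f h : Module.Dual ℝ V) (x : Forms V) :
    contractCovector V f (ExteriorAlgebra.ι ℝ h * x) =
      ⟪sharp V f, sharp V h⟫_ℝ • x - ExteriorAlgebra.ι ℝ h * contractCovector V f x := by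
  rw [real_inner_comm, inner_sharp]
  exact CliffordAlgebra.contractLeft_ι_mul (Q := (0 : QuadraticForm ℝ (Module.Dual ℝ V)))
    (d := Module.Dual.eval ℝ V (sharp V f)) _ _

theorem contractCovector_one (f : Module.Dual ℝ V) : contractCovector V f 1 = 0 :=
  CliffordAlgebra.contractLeft_one (Q := (0 : QuadraticForm ℝ (Module.Dual ℝ V)))
    (Module.Dual.eval ℝ V (sharp V f))

theorem contractCovector_anticomm (f h : Module.Dual ℝ V) (x : Forms V) :
    contractCovector V f (contractCovector V h x) =
      -contractCovector V h (contractCovector V f x) :=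
  CliffordAlgebra.contractLeft_comm _ _ (Q := (0 : QuadraticForm ℝ (Module.Dual ℝ V))) _

theorem interiorForm_ι (f : Module.Dual ℝ V) :
    (interiorForm V (ExteriorAlgebra.ι ℝ f)).unop = contractCovector V f := by
  simp [interiorForm]

theorem innerForm_apply (a c : Forms V) :
    innerForm V a c = ExteriorAlgebra.algebraMapInv ((interiorForm V a).unop c) := rfl

theorem innerForm_mul_left (a b c : Forms V) :
    innerForm V (a * b) c = innerForm V b ((interiorForm V a).unop c) := by
  simp [innerForm_apply]

theorem innerForm_ι_mul (f : Module.Dual ℝ V) (a c : Forms V) :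
    innerForm V (ExteriorAlgebra.ι ℝ f * a) c = innerForm V a (contractCovector V f c) := by
  rw [innerForm_mul_left, interiorForm_ι]

theorem innerForm_one_left (c : Forms V) :
    innerForm V 1 c = ExteriorAlgebra.algebraMapInv c := by
  simp [innerForm_apply]

/-- Left induction on the exterior algebra: it is enough to treat `1` and products with a
1-form on the left. -/
theorem forms_induction {P : Forms V → Prop} (one : P 1)
    (add : ∀ x y, P x → P y → P (x + y)) (smul : ∀ (r : ℝ) x, P x → P (r • x))
    (ι_mul : ∀ f x, P x → P (ExteriorAlgebra.ι ℝ f * x)) (x : Forms V) : P x := by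
  revert x
  refine CliffordAlgebra.left_induction (Q := (0 : QuadraticForm ℝ (Module.Dual ℝ V))) (P := P) ?_
    (fun x y => add x y) (fun x f hx => ι_mul f x hx)
  intro r
  rw [Algebra.algebraMap_eq_smul_one]
  exact smul r _ one

theorem innerForm_ι_mul_right (f : Module.Dual ℝ V) (c a : Forms V) :
    innerForm V c (ExteriorAlgebra.ι ℝ f * a) = innerForm V (contractCovector V f c) a := by
  induction c using forms_induction generalizing a with
  | one => simp [innerForm_one_left, contractCovector_one, ExteriorAlgebra.algebraMapInv]
  | add x y hx hy => simp [hx, hy]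
  | smul r x hx => simp [hx]
  | ι_mul h x hx =>
    rw [innerForm_ι_mul, contractCovector_ι_mul, contractCovector_ι_mul, map_sub, hx, map_sub,
      map_smul, map_smul, LinearMap.sub_apply, LinearMap.smul_apply, innerForm_ι_mul,
      real_inner_comm]

theorem innerForm_comm (a c : Forms V) : innerForm V a c = innerForm V c a := by
  induction a using forms_induction generalizing c with
  | one =>
    induction c using forms_induction with
    | one => rfl
    | add x y hx hy => simp [hx, hy]
    | smul r x hx => simp [hx]
    | ι_mul h x hx =>
      rw [innerForm_ι_mul, contractCovector_one, innerForm_ι_mul_right, contractCovector_one]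
      simp
  | add x y hx hy => simp [hx, hy]
  | smul r x hx => simp [hx]
  | ι_mul h x hx => rw [innerForm_ι_mul, innerForm_ι_mul_right, hx]

/-! ### Degrees -/

variable (V) in
/-- The homogeneous double forms of bidegree `(p, q)`, i.e. the span of `Λᵖ V* ⊗ Λ𐞥 V*`. -/
def bidegree (p q : ℕ) : Submodule ℝ (DoubleForm V) :=
  Submodule.map₂ (TensorProduct.mk ℝ (Forms V) (Forms V))
    (⋀[ℝ]^p (Module.Dual ℝ V)) (⋀[ℝ]^q (Module.Dual ℝ V))

theorem tmul_mem_bidegree {p q : ℕ} {α β : Forms V} (hα : α ∈ ⋀[ℝ]^p (Module.Dual ℝ V))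
    (hβ : β ∈ ⋀[ℝ]^q (Module.Dual ℝ V)) : α ⊗ₜ[ℝ] β ∈ bidegree V p q :=
  Submodule.apply_mem_map₂ _ hα hβ

theorem bidegree_induction {p q : ℕ} {P : DoubleForm V → Prop} (zero : P 0)
    (tmul : ∀ α ∈ ⋀[ℝ]^p (Module.Dual ℝ V), ∀ β ∈ ⋀[ℝ]^q (Module.Dual ℝ V), P (α ⊗ₜ β))
    (add : ∀ x y, P x → P y → P (x + y))
    {w : DoubleForm V} (hw : w ∈ bidegree V p q) : P w := by
  rw [bidegree, Submodule.map₂_eq_span_image2] at hw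
  have hs : ∀ (r : ℝ) (x : DoubleForm V),
      x ∈ Set.image2 (fun m n => TensorProduct.mk ℝ (Forms V) (Forms V) m n)
      (⋀[ℝ]^p (Module.Dual ℝ V)) (⋀[ℝ]^q (Module.Dual ℝ V)) → P (r • x) := by
    rintro r x ⟨α, hα, β, hβ, rfl⟩
    simpa [TensorProduct.smul_tmul'] using
      tmul (r • α) (Submodule.smul_mem _ r hα) β hβ
  refine Submodule.closure_induction (p := fun x _ => P x) zero (fun x y _ _ => add x y) hs hw

theorem mul_mem_bidegree {p q p' q' : ℕ} {w η : DoubleForm V} (hw : w ∈ bidegree V p q)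
    (hη : η ∈ bidegree V p' q') : w * η ∈ bidegree V (p + p') (q + q') := by
  refine bidegree_induction (P := fun w => w * η ∈ bidegree V (p + p') (q + q')) ?_ ?_ ?_ hw
  · simp
  · intro α hα β hβ
    refine bidegree_induction (P := fun η => α ⊗ₜ β * η ∈ bidegree V (p + p') (q + q'))
      ?_ ?_ ?_ hη
    · simp
    · intro γ hγ δ hδ
      rw [Algebra.TensorProduct.tmul_mul_tmul]
      exact tmul_mem_bidegree
        (by rw [ExteriorAlgebra.exteriorPower, pow_add]; exact Submodule.mul_mem_mul hα hγ)
        (by rw [ExteriorAlgebra.exteriorPower, pow_add]; exact Submodule.mul_mem_mul hβ hδ)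
    · intro x y hx hy
      rw [mul_add]; exact add_mem hx hy
  · intro x y hx hy
    rw [add_mul]; exact add_mem hx hy

theorem pow_mem_bidegree {p q : ℕ} {w : DoubleForm V} (hw : w ∈ bidegree V p q) (k : ℕ) :
    w ^ k ∈ bidegree V (p * k) (q * k) := by
  induction k with
  | zero =>
    rw [pow_zero, Algebra.TensorProduct.one_def]
    exact tmul_mem_bidegree (by simp [ExteriorAlgebra.exteriorPower])
      (by simp [ExteriorAlgebra.exteriorPower])
  | succ k ih => rw [pow_succ, mul_add, mul_add, mul_one, mul_one]; exact mul_mem_bidegree ih hw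

theorem contractCovector_mem (f : Module.Dual ℝ V) {p : ℕ} {α : Forms V}
    (hα : α ∈ ⋀[ℝ]^(p + 1) (Module.Dual ℝ V)) :
    contractCovector V f α ∈ ⋀[ℝ]^p (Module.Dual ℝ V) := by
  induction p generalizing α with
  | zero =>
    rw [zero_add, ExteriorAlgebra.exteriorPower, pow_one] at hα
    obtain ⟨h, rfl⟩ := hα
    rw [← mul_one (ExteriorAlgebra.ι ℝ h), contractCovector_ι_mul, contractCovector_one, mul_zero,
      sub_zero]
    exact Submodule.smul_mem _ _ (by simp [ExteriorAlgebra.exteriorPower])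
  | succ p ih =>
    rw [ExteriorAlgebra.exteriorPower, pow_succ'] at hα
    refine Submodule.mul_induction_on hα ?_ ?_
    · rintro _ ⟨h, rfl⟩ x hx
      rw [contractCovector_ι_mul]
      refine sub_mem (Submodule.smul_mem _ _ hx) ?_
      rw [ExteriorAlgebra.exteriorPower, pow_succ']
      exact Submodule.mul_mem_mul (LinearMap.mem_range_self _ h) (ih hx)
    · intro x y hx hy
      rw [map_add]; exact add_mem hx hy

/-! ### Orthonormal frames -/

variable {n : ℕ} (b : OrthonormalBasis (Fin n) ℝ V)

/-- The 1-form dual to the `i`-th vector of an orthonormal basis. -/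
def coframe (i : Fin n) : Module.Dual ℝ V := innerₗ V (b i)

theorem sharp_innerₗ (v : V) : sharp V (innerₗ V v) = v := by
  refine ext_inner_right ℝ fun w => ?_
  rw [inner_sharp]; simp

theorem inner_sharp_coframe (i j : Fin n) :
    ⟪sharp V (coframe b i), sharp V (coframe b j)⟫_ℝ = if i = j then 1 else 0 := by
  rw [coframe, coframe, sharp_innerₗ, sharp_innerₗ, b.inner_eq_ite]

theorem sum_coframe_smul (f : Module.Dual ℝ V) : ∑ i, f (b i) • coframe b i = f := by
  refine LinearMap.ext fun v => ?_
  conv_rhs => rw [← b.sum_repr v, map_sum]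
  simp [LinearMap.sum_apply, coframe, b.repr_apply_apply, mul_comm]

theorem ι_eq_sum_coframe (f : Module.Dual ℝ V) :
    ExteriorAlgebra.ι ℝ f = ∑ i, f (b i) • ExteriorAlgebra.ι ℝ (coframe b i) := by
  conv_lhs => rw [← sum_coframe_smul b f, map_sum]
  simp only [map_smul]

/-- The metric double form does not depend on the orthonormal basis. -/
theorem metricD_eq_sum : metricD V =
    ∑ i, ExteriorAlgebra.ι ℝ (coframe b i) ⊗ₜ[ℝ] ExteriorAlgebra.ι ℝ (coframe b i) := by
  set b' := stdOrthonormalBasis ℝ V with hb'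
  have h1 : metricD V = ∑ i, ∑ j, ⟪b' i, b j⟫_ℝ •
      (ExteriorAlgebra.ι ℝ (coframe b j) ⊗ₜ[ℝ] ExteriorAlgebra.ι ℝ (coframe b' i)) := by
    rw [metricD, ← hb']
    refine Finset.sum_congr rfl fun i _ => ?_
    change ExteriorAlgebra.ι ℝ (coframe b' i) ⊗ₜ[ℝ] ExteriorAlgebra.ι ℝ (coframe b' i) = _
    conv_lhs => enter [2]; rw [ι_eq_sum_coframe b (coframe b' i)]
    rw [TensorProduct.sum_tmul]
    exact Finset.sum_congr rfl fun j _ => (TensorProduct.smul_tmul' _ _ _).symm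
  rw [h1, Finset.sum_comm]
  refine Finset.sum_congr rfl fun j _ => ?_
  conv_rhs => enter [3]; rw [ι_eq_sum_coframe b' (coframe b j)]
  rw [TensorProduct.tmul_sum]
  refine Finset.sum_congr rfl fun i _ => ?_
  rw [TensorProduct.tmul_smul, real_inner_comm]
  rfl

/-! ### Left and right multiplications and contractions -/

/-- The double form `eⁱ ⊗ 1`. -/
def lform (i : Fin n) : DoubleForm V := ExteriorAlgebra.ι ℝ (coframe b i) ⊗ₜ 1

/-- The double form `1 ⊗ eⁱ`. -/
def rform (i : Fin n) : DoubleForm V := 1 ⊗ₜ ExteriorAlgebra.ι ℝ (coframe b i)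

/-- The interior product by the `i`-th frame vector in the left factor. -/
def lcontr (i : Fin n) : Module.End ℝ (DoubleForm V) :=
  TensorProduct.map (contractCovector V (coframe b i)) LinearMap.id

/-- The interior product by the `i`-th frame vector in the right factor. -/
def rcontr (i : Fin n) : Module.End ℝ (DoubleForm V) :=
  TensorProduct.map LinearMap.id (contractCovector V (coframe b i))

theorem lform_mul_tmul (i : Fin n) (α β : Forms V) :
    lform b i * α ⊗ₜ β = (ExteriorAlgebra.ι ℝ (coframe b i) * α) ⊗ₜ β := by
  rw [lform, Algebra.TensorProduct.tmul_mul_tmul, one_mul]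

theorem rform_mul_tmul (i : Fin n) (α β : Forms V) :
    rform b i * α ⊗ₜ β = α ⊗ₜ (ExteriorAlgebra.ι ℝ (coframe b i) * β) := by
  rw [rform, Algebra.TensorProduct.tmul_mul_tmul, one_mul]

theorem lcontr_tmul (i : Fin n) (α β : Forms V) :
    lcontr b i (α ⊗ₜ β) = contractCovector V (coframe b i) α ⊗ₜ β := rfl

theorem rcontr_tmul (i : Fin n) (α β : Forms V) :
    rcontr b i (α ⊗ₜ β) = α ⊗ₜ contractCovector V (coframe b i) β := rfl

theorem lcontr_lform_mul (i j : Fin n) (w : DoubleForm V) :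
    lcontr b i (lform b j * w) = (if i = j then (1 : ℝ) else 0) • w - lform b j * lcontr b i w := by
  induction w using TensorProduct.induction_on with
  | zero => simp
  | add x y hx hy => rw [mul_add, map_add, hx, hy, map_add, smul_add, mul_add]; abel
  | tmul α β =>
    rw [lform_mul_tmul, lcontr_tmul, lcontr_tmul, lform_mul_tmul, contractCovector_ι_mul,
      inner_sharp_coframe, TensorProduct.sub_tmul, TensorProduct.smul_tmul']

theorem rcontr_rform_mul (i j : Fin n) (w : DoubleForm V) :
    rcontr b i (rform b j * w) = (if i = j then (1 : ℝ) else 0) • w - rform b j * rcontr b i w := by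
  induction w using TensorProduct.induction_on with
  | zero => simp
  | add x y hx hy => rw [mul_add, map_add, hx, hy, map_add, smul_add, mul_add]; abel
  | tmul α β =>
    rw [rform_mul_tmul, rcontr_tmul, rcontr_tmul, rform_mul_tmul, contractCovector_ι_mul,
      inner_sharp_coframe, TensorProduct.tmul_sub, TensorProduct.tmul_smul]

theorem lcontr_rform_mul (i j : Fin n) (w : DoubleForm V) :
    lcontr b i (rform b j * w) = rform b j * lcontr b i w := by
  induction w using TensorProduct.induction_on with
  | zero => simp
  | add x y hx hy => rw [mul_add, map_add, hx, hy, map_add, mul_add]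
  | tmul α β => rw [rform_mul_tmul, lcontr_tmul, lcontr_tmul, rform_mul_tmul]

theorem rcontr_lform_mul (i j : Fin n) (w : DoubleForm V) :
    rcontr b i (lform b j * w) = lform b j * rcontr b i w := by
  induction w using TensorProduct.induction_on with
  | zero => simp
  | add x y hx hy => rw [mul_add, map_add, hx, hy, map_add, mul_add]
  | tmul α β => rw [lform_mul_tmul, rcontr_tmul, rcontr_tmul, lform_mul_tmul]

theorem lcontr_rcontr_comm (i j : Fin n) (w : DoubleForm V) :
    lcontr b i (rcontr b j w) = rcontr b j (lcontr b i w) := by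
  induction w using TensorProduct.induction_on with
  | zero => simp
  | add x y hx hy => simp only [map_add, hx, hy]
  | tmul α β => rfl

theorem lcontr_anticomm (i j : Fin n) (w : DoubleForm V) :
    lcontr b i (lcontr b j w) = -lcontr b j (lcontr b i w) := by
  induction w using TensorProduct.induction_on with
  | zero => simp
  | add x y hx hy => simp only [map_add, hx, hy]; abel
  | tmul α β =>
    simp only [lcontr_tmul]
    rw [contractCovector_anticomm, TensorProduct.neg_tmul]

theorem rcontr_anticomm (i j : Fin n) (w : DoubleForm V) :
    rcontr b i (rcontr b j w) = -rcontr b j (rcontr b i w) := by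
  induction w using TensorProduct.induction_on with
  | zero => simp
  | add x y hx hy => simp only [map_add, hx, hy]; abel
  | tmul α β =>
    simp only [rcontr_tmul]
    rw [contractCovector_anticomm, TensorProduct.tmul_neg]

theorem lform_mul_rform_mul (i j : Fin n) (w : DoubleForm V) :
    lform b i * (rform b j * w) = rform b j * (lform b i * w) := by
  rw [← mul_assoc, ← mul_assoc]
  simp [lform, rform, Algebra.TensorProduct.tmul_mul_tmul]

theorem rform_mul_rform_mul (i j : Fin n) (w : DoubleForm V) :
    rform b i * (rform b j * w) = -(rform b j * (rform b i * w)) := by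
  rw [← mul_assoc, ← mul_assoc, ← neg_mul]
  congr 1
  simp only [rform, Algebra.TensorProduct.tmul_mul_tmul, one_mul, ← TensorProduct.tmul_neg]
  rw [eq_neg_of_add_eq_zero_left
    (ExteriorAlgebra.ι_add_mul_swap (R := ℝ) (coframe b i) (coframe b j))]

theorem metricD_mul (w : DoubleForm V) :
    metricD V * w = ∑ i, lform b i * (rform b i * w) := by
  rw [metricD_eq_sum b, Finset.sum_mul]
  refine Finset.sum_congr rfl fun i _ => ?_
  rw [← mul_assoc]
  simp [lform, rform, Algebra.TensorProduct.tmul_mul_tmul]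

theorem contraction_eq_sum (w : DoubleForm V) :
    contraction V w = ∑ i, lcontr b i (rcontr b i w) := by
  rw [contraction, metricD_eq_sum b, map_sum, LinearMap.sum_apply]
  refine Finset.sum_congr rfl fun i _ => ?_
  induction w using TensorProduct.induction_on with
  | zero => simp
  | add x y hx hy => simp only [map_add, hx, hy]
  | tmul α β =>
    rw [rcontr_tmul, lcontr_tmul]
    simp [interiorD, interiorForm_ι]

theorem lcontr_metricD_mul (j : Fin n) (w : DoubleForm V) :
    lcontr b j (metricD V * w) = rform b j * w - metricD V * lcontr b j w := by
  simp only [metricD_mul b, map_sum, lcontr_lform_mul, lcontr_rform_mul, Finset.sum_sub_distrib,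
    ite_smul, one_smul, zero_smul, Finset.sum_ite_eq, Finset.mem_univ, if_true]

theorem rcontr_metricD_mul (j : Fin n) (w : DoubleForm V) :
    rcontr b j (metricD V * w) = lform b j * w - metricD V * rcontr b j w := by
  simp only [metricD_mul b, map_sum, lform_mul_rform_mul, rcontr_lform_mul, rcontr_rform_mul,
    Finset.sum_sub_distrib,
    ite_smul, one_smul, zero_smul, Finset.sum_ite_eq, Finset.mem_univ, if_true]

theorem rform_mul_metricD_mul (j : Fin n) (w : DoubleForm V) :
    rform b j * (metricD V * w) = -(metricD V * (rform b j * w)) := by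
  simp only [metricD_mul b, Finset.mul_sum, ← Finset.sum_neg_distrib]
  refine Finset.sum_congr rfl fun i _ => ?_
  rw [← lform_mul_rform_mul, rform_mul_rform_mul, mul_neg]

theorem lform_mul_lform_mul (i j : Fin n) (w : DoubleForm V) :
    lform b i * (lform b j * w) = -(lform b j * (lform b i * w)) := by
  rw [← mul_assoc, ← mul_assoc, ← neg_mul]
  congr 1
  simp only [lform, Algebra.TensorProduct.tmul_mul_tmul, one_mul, ← TensorProduct.neg_tmul]
  rw [eq_neg_of_add_eq_zero_left
    (ExteriorAlgebra.ι_add_mul_swap (R := ℝ) (coframe b i) (coframe b j))]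

theorem lform_mul_metricD_mul (j : Fin n) (w : DoubleForm V) :
    lform b j * (metricD V * w) = -(metricD V * (lform b j * w)) := by
  simp only [metricD_mul b, Finset.mul_sum, ← Finset.sum_neg_distrib]
  refine Finset.sum_congr rfl fun i _ => ?_
  rw [lform_mul_lform_mul, lform_mul_rform_mul]

theorem lcontr_one (j : Fin n) : lcontr b j 1 = 0 := by
  rw [Algebra.TensorProduct.one_def, lcontr_tmul, contractCovector_one, TensorProduct.zero_tmul]

theorem rcontr_one (j : Fin n) : rcontr b j 1 = 0 := by
  rw [Algebra.TensorProduct.one_def, rcontr_tmul, contractCovector_one, TensorProduct.tmul_zero]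

theorem lcontr_metricD_pow (j : Fin n) (m : ℕ) :
    lcontr b j (metricD V ^ (m + 1)) = ((m : ℝ) + 1) • (rform b j * metricD V ^ m) := by
  induction m with
  | zero =>
    have h := lcontr_metricD_mul b j 1
    rw [mul_one, lcontr_one, mul_zero, sub_zero] at h
    simpa using h
  | succ m ih =>
    rw [pow_succ' _ (m + 1), lcontr_metricD_mul, ih, mul_smul_comm, pow_succ' _ m,
      rform_mul_metricD_mul]
    push_cast
    module

theorem rcontr_metricD_pow (j : Fin n) (m : ℕ) :
    rcontr b j (metricD V ^ (m + 1)) = ((m : ℝ) + 1) • (lform b j * metricD V ^ m) := by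
  induction m with
  | zero =>
    have h := rcontr_metricD_mul b j 1
    rw [mul_one, rcontr_one, mul_zero, sub_zero] at h
    simpa using h
  | succ m ih =>
    rw [pow_succ' _ (m + 1), rcontr_metricD_mul, ih, mul_smul_comm, pow_succ' _ m,
      lform_mul_metricD_mul]
    push_cast
    module

include b in
theorem contraction_metricD_pow (m : ℕ) : contraction V (metricD V ^ (m + 1)) =
    (((m : ℝ) + 1) * (n - m)) • metricD V ^ m := by
  simp only [contraction_eq_sum b, rcontr_metricD_pow, map_smul, lcontr_lform_mul, if_true,
    one_smul, ← Finset.smul_sum, Finset.sum_sub_distrib, Finset.sum_const, Finset.card_univ,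
    Fintype.card_fin]
  rw [mul_smul]
  congr 1
  cases m with
  | zero => simp [lcontr_one, Nat.cast_smul_eq_nsmul]
  | succ m =>
    simp only [lcontr_metricD_pow, mul_smul_comm, ← Finset.smul_sum, ← metricD_mul b]
    rw [← pow_succ']
    push_cast
    module

/-- The contraction and the multiplication by `1 ⊗ eʲ` anticommute up to an interior product. -/
theorem contraction_rform_mul (j : Fin n) (w : DoubleForm V) :
    contraction V (rform b j * w) = lcontr b j w - rform b j * contraction V w := by
  simp only [contraction_eq_sum b, rcontr_rform_mul, map_sub, map_smul, lcontr_rform_mul,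
    Finset.sum_sub_distrib, Finset.mul_sum]
  simp

theorem contraction_rform_mul_metricD_pow (j : Fin n) (m : ℕ) :
    contraction V (rform b j * metricD V ^ (m + 1)) =
      (-(((m : ℝ) + 1) * (n - m - 1))) • (rform b j * metricD V ^ m) := by
  rw [contraction_rform_mul, contraction_metricD_pow b, lcontr_metricD_pow, mul_smul_comm]
  module

theorem contraction_lcontr (j : Fin n) (w : DoubleForm V) :
    contraction V (lcontr b j w) = -lcontr b j (contraction V w) := by
  simp only [contraction_eq_sum b, map_sum, ← Finset.sum_neg_distrib]
  refine Finset.sum_congr rfl fun i _ => ?_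
  rw [← lcontr_rcontr_comm, lcontr_anticomm]

theorem contraction_rcontr (j : Fin n) (w : DoubleForm V) :
    contraction V (rcontr b j w) = -rcontr b j (contraction V w) := by
  simp only [contraction_eq_sum b, map_sum, ← Finset.sum_neg_distrib]
  refine Finset.sum_congr rfl fun i _ => ?_
  rw [rcontr_anticomm, map_neg, lcontr_rcontr_comm]

/-! ### Adjointness -/

theorem innerD_tmul (α β γ δ : Forms V) :
    innerD V (α ⊗ₜ β) (γ ⊗ₜ δ) = innerForm V α γ * innerForm V β δ := by
  simp [innerD, mul_comm]

theorem innerD_lform_mul (i : Fin n) (w η : DoubleForm V) :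
    innerD V (lform b i * w) η = innerD V w (lcontr b i η) := by
  induction w using TensorProduct.induction_on with
  | zero => simp
  | add x y hx hy => simp only [mul_add, map_add, LinearMap.add_apply, hx, hy]
  | tmul α β =>
    induction η using TensorProduct.induction_on with
    | zero => simp
    | add x y hx hy => simp only [map_add, hx, hy]
    | tmul γ δ => rw [lform_mul_tmul, lcontr_tmul, innerD_tmul, innerD_tmul, innerForm_ι_mul]

theorem innerD_metricD_mul (w η : DoubleForm V) :
    innerD V (metricD V * w) η = innerD V w (contraction V η) :=
  innerD_mul_left V _ _ _

theorem innerD_comm (w η : DoubleForm V) : innerD V w η = innerD V η w := by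
  induction w using TensorProduct.induction_on with
  | zero => simp
  | add x y hx hy => simp only [map_add, LinearMap.add_apply, hx, hy]
  | tmul α β =>
    induction η using TensorProduct.induction_on with
    | zero => simp
    | add x y hx hy => simp only [map_add, LinearMap.add_apply, hx, hy]
    | tmul γ δ => rw [innerD_tmul, innerD_tmul, innerForm_comm α, innerForm_comm β]

/-- Euler's identity: `∑ eⁱ ∧ ι_{eᵢ}` is the degree operator. -/
theorem sum_ι_mul_contractCovector {p : ℕ} {α : Forms V}
    (hα : α ∈ ⋀[ℝ]^p (Module.Dual ℝ V)) :
    ∑ i, ExteriorAlgebra.ι ℝ (coframe b i) * contractCovector V (coframe b i) α = (p : ℝ) • α := by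
  induction p generalizing α with
  | zero =>
    rw [ExteriorAlgebra.exteriorPower, pow_zero, Submodule.mem_one] at hα
    obtain ⟨r, rfl⟩ := hα
    simp [Algebra.algebraMap_eq_smul_one, contractCovector_one]
  | succ p ih =>
    rw [ExteriorAlgebra.exteriorPower, pow_succ'] at hα
    refine Submodule.mul_induction_on hα ?_ ?_
    · rintro _ ⟨h, rfl⟩ x hx
      simp only [contractCovector_ι_mul, mul_sub, Finset.sum_sub_distrib]
      have h1 : ∑ i, ExteriorAlgebra.ι ℝ (coframe b i) * (⟪sharp V (coframe b i), sharp V h⟫_ℝ • x)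
          = ExteriorAlgebra.ι ℝ h * x := by
        rw [ι_eq_sum_coframe b h, Finset.sum_mul]
        refine Finset.sum_congr rfl fun i _ => ?_
        rw [real_inner_comm, inner_sharp, coframe, sharp_innerₗ]
        simp
      have h2 : ∑ i, ExteriorAlgebra.ι ℝ (coframe b i) * (ExteriorAlgebra.ι ℝ h *
          contractCovector V (coframe b i) x) = -(ExteriorAlgebra.ι ℝ h * ((p : ℝ) • x)) := by
        rw [← ih hx, Finset.mul_sum, ← Finset.sum_neg_distrib]
        refine Finset.sum_congr rfl fun i _ => ?_
        rw [← mul_assoc, eq_neg_of_add_eq_zero_left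
          (ExteriorAlgebra.ι_add_mul_swap (R := ℝ) (coframe b i) h), neg_mul, mul_assoc]
      rw [h1, h2, mul_smul_comm]
      push_cast
      module
    · intro x y hx hy
      simp only [map_add, mul_add, Finset.sum_add_distrib, hx, hy, smul_add]

include b in
/-- The powers of the metric are the reproducing kernels of the inner product: `gᵐ / m!` is
`∑ e^I ⊗ e^I`. -/
theorem innerD_metricD_pow {m : ℕ} {γ β : Forms V} (hγ : γ ∈ ⋀[ℝ]^m (Module.Dual ℝ V))
    (hβ : β ∈ ⋀[ℝ]^m (Module.Dual ℝ V)) :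
    innerD V (metricD V ^ m) (γ ⊗ₜ β) = (m.factorial : ℝ) * innerForm V γ β := by
  induction m generalizing γ β with
  | zero =>
    rw [ExteriorAlgebra.exteriorPower, pow_zero, Submodule.mem_one] at hγ hβ
    obtain ⟨r, rfl⟩ := hγ
    obtain ⟨s, rfl⟩ := hβ
    rw [pow_zero, Algebra.TensorProduct.one_def, innerD_tmul]
    simp [Algebra.algebraMap_eq_smul_one, innerForm_one_left, mul_comm]
  | succ m ih =>
    rw [pow_succ', innerD_metricD_mul, contraction_eq_sum b, map_sum]
    have : ∀ i, innerD V (metricD V ^ m) (lcontr b i (rcontr b i (γ ⊗ₜ β))) =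
        (m.factorial : ℝ) * innerForm V γ
          (ExteriorAlgebra.ι ℝ (coframe b i) * contractCovector V (coframe b i) β) := by
      intro i
      rw [rcontr_tmul, lcontr_tmul, ih (contractCovector_mem _ hγ) (contractCovector_mem _ hβ),
        innerForm_ι_mul_right]
    rw [Finset.sum_congr rfl fun i _ => this i, ← Finset.mul_sum, ← map_sum,
      sum_ι_mul_contractCovector b hβ, map_smul, smul_eq_mul, Nat.factorial_succ]
    push_cast
    ring

/-! ### The transposition of double forms -/

variable (V) in
/-- The transposition `α ⊗ β ↦ β ⊗ α` of double forms, an involution of algebras. -/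
def transpose : DoubleForm V →ₐ[ℝ] DoubleForm V :=
  (Algebra.TensorProduct.comm ℝ (Forms V) (Forms V)).toAlgHom

theorem transpose_tmul (α β : Forms V) : transpose V (α ⊗ₜ β) = β ⊗ₜ α := rfl

theorem transpose_lform (i : Fin n) : transpose V (lform b i) = rform b i := rfl

/-! ### Contracted composition products -/

theorem comp_tmul (α β γ δ : Forms V) :
    comp V (α ⊗ₜ β) (γ ⊗ₜ δ) = innerForm V α δ • (γ ⊗ₜ β) := by
  simp [comp, toEnd]

theorem comp_add_left (w w' η : DoubleForm V) : comp V (w + w') η = comp V w η + comp V w' η := by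
  simp [comp, LinearMap.lTensor_add]

theorem comp_add_right (w η η' : DoubleForm V) : comp V w (η + η') = comp V w η + comp V w η' := by
  simp [comp]

theorem comp_zero_left (η : DoubleForm V) : comp V 0 η = 0 := by simp [comp]

theorem comp_zero_right (w : DoubleForm V) : comp V w 0 = 0 := by simp [comp]

theorem innerD_one_contraction_pow (m : ℕ) (w : DoubleForm V) :
    innerD V 1 ((contraction V ^ m) w) = innerD V (metricD V ^ m) w := by
  induction m generalizing w with
  | zero => rfl
  | succ m ih => rw [pow_succ, Module.End.mul_apply, ih, ← innerD_metricD_mul, ← pow_succ']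

theorem lcontr_rcontr_contraction_pow (i j : Fin n) (m : ℕ) (w : DoubleForm V) :
    lcontr b i (rcontr b j ((contraction V ^ m) w)) =
      (contraction V ^ m) (lcontr b i (rcontr b j w)) := by
  induction m generalizing w with
  | zero => rfl
  | succ m ih =>
    rw [pow_succ, Module.End.mul_apply, ih, Module.End.mul_apply, contraction_lcontr,
      contraction_rcontr, map_neg, map_neg, map_neg, neg_neg]

/-- The components of the `(1,1)` double form `c^m (w ∘ η) / m!` are the inner products of the
interior products of `η` and of the transpose of `w`. -/
theorem innerD_one_lcontr_rcontr_comp (i j : Fin n) {m : ℕ} {w η : DoubleForm V}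
    (hw : w ∈ bidegree V (m + 1) (m + 1)) (hη : η ∈ bidegree V (m + 1) (m + 1)) :
    innerD V 1 (lcontr b i (rcontr b j ((contraction V ^ m) (comp V w η)))) =
      (m.factorial : ℝ) * innerD V (lcontr b i η) (lcontr b j (transpose V w)) := by
  rw [lcontr_rcontr_contraction_pow, innerD_one_contraction_pow]
  refine bidegree_induction (P := fun w => innerD V (metricD V ^ m)
    (lcontr b i (rcontr b j (comp V w η))) =
      (m.factorial : ℝ) * innerD V (lcontr b i η) (lcontr b j (transpose V w))) ?_ ?_ ?_ hw
  · simp [comp_zero_left]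
  · intro α hα β hβ
    refine bidegree_induction (P := fun η => innerD V (metricD V ^ m)
      (lcontr b i (rcontr b j (comp V (α ⊗ₜ β) η))) =
      (m.factorial : ℝ) * innerD V (lcontr b i η) (lcontr b j (transpose V (α ⊗ₜ β)))) ?_ ?_ ?_ hη
    · simp [comp_zero_right]
    · intro γ hγ δ hδ
      rw [comp_tmul, map_smul, map_smul, map_smul, rcontr_tmul, lcontr_tmul, lcontr_tmul,
        transpose_tmul, lcontr_tmul, innerD_metricD_pow b (contractCovector_mem _ hγ)
        (contractCovector_mem _ hβ), innerD_tmul, innerForm_comm δ, smul_eq_mul]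
      ring
    · intro x y hx hy
      simp only [comp_add_right, map_add, hx, hy, LinearMap.add_apply, mul_add]
  · intro x y hx hy
    simp only [comp_add_left, map_add, hx, hy, mul_add]

include b in
/-- The full contraction of a composition product: `c^p (w ∘ η) / p! = ⟨w, ηᵗ⟩`. -/
theorem innerD_metricD_pow_comp {p : ℕ} {w η : DoubleForm V}
    (hw : w ∈ bidegree V p p) (hη : η ∈ bidegree V p p) :
    innerD V (metricD V ^ p) (comp V w η) =
      (p.factorial : ℝ) * innerD V η (transpose V w) := by
  refine bidegree_induction (P := fun w => innerD V (metricD V ^ p) (comp V w η) =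
      (p.factorial : ℝ) * innerD V η (transpose V w)) ?_ ?_ ?_ hw
  · simp [comp_zero_left]
  · intro α hα β hβ
    refine bidegree_induction (P := fun η => innerD V (metricD V ^ p) (comp V (α ⊗ₜ β) η) =
      (p.factorial : ℝ) * innerD V η (transpose V (α ⊗ₜ β))) ?_ ?_ ?_ hη
    · simp [comp_zero_right]
    · intro γ hγ δ hδ
      rw [comp_tmul, map_smul, transpose_tmul, innerD_metricD_pow b hγ hβ, innerD_tmul,
        innerForm_comm δ, smul_eq_mul]
      ring
    · intro x y hx hy
      simp only [comp_add_right, map_add, hx, hy, LinearMap.add_apply, mul_add]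
  · intro x y hx hy
    simp only [comp_add_left, map_add, hx, hy, mul_add]

theorem innerD_one_one : innerD V (1 : DoubleForm V) 1 = 1 := by
  rw [Algebra.TensorProduct.one_def, innerD_tmul, innerForm_one_left, map_one, mul_one]

include b in
/-- The trace of the weakly Einstein condition: the scalar in the condition is the square norm. -/
theorem eq_innerD_of_contraction_pow_comp {m : ℕ} (hn : n ≠ 0) {T : DoubleForm V}
    (hT : T ∈ bidegree V (m + 1) (m + 1)) (hs : transpose V T = T) {s : ℝ}
    (h : (1 / (m.factorial : ℝ)) • (contraction V ^ m) (comp V T T) =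
      (((m + 1 : ℕ) : ℝ) / n * s) • metricD V) : s = innerD V T T := by
  have h1 := congrArg (fun w => innerD V (metricD V) w) h
  have hn' : (n : ℝ) ≠ 0 := by exact_mod_cast hn
  have hm : (m.factorial : ℝ) ≠ 0 := by exact_mod_cast m.factorial_ne_zero
  have h2 : innerD V (metricD V) ((contraction V ^ m) (comp V T T)) =
      ((m + 1).factorial : ℝ) * innerD V T T := by
    rw [← mul_one (metricD V), innerD_metricD_mul, ← Module.End.mul_apply, ← pow_succ',
      innerD_one_contraction_pow, innerD_metricD_pow_comp b hT hT, hs]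
  have h3 : innerD V (metricD V) (metricD V) = n := by
    conv_lhs => rw [← mul_one (metricD V)]
    rw [innerD_metricD_mul, mul_one]
    have := contraction_metricD_pow b 0
    simp only [zero_add, pow_one, pow_zero] at this
    rw [this, map_smul, innerD_one_one]
    simp
  simp only [map_smul, h2, h3, smul_eq_mul, Nat.factorial_succ] at h1
  push_cast at h1
  have hm1 : ((m : ℝ) + 1) ≠ 0 := by positivity
  field_simp at h1
  linarith

/-! ### Schur's lemma and the derivative of the norm -/

/-- The map `θ ↦ (1 ⊗ θ) g^s` is injective on 1-forms for `s < n`: repeated contraction recovers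
a nonzero multiple of `1 ⊗ θ`. -/
theorem sum_smul_rform_eq_zero {a : Fin n → ℝ} {s : ℕ} (hs : s < n)
    (h : ∑ i, a i • (rform b i * metricD V ^ s) = 0) : ∑ i, a i • rform b i = 0 := by
  induction s with
  | zero => simpa using h
  | succ s ih =>
    refine ih (by omega) ?_
    have h1 := congrArg (contraction V) h
    simp only [map_sum, map_smul, contraction_rform_mul_metricD_pow, map_zero] at h1
    rw [Finset.sum_congr rfl fun i _ => smul_comm (a i) _ _, ← Finset.smul_sum] at h1
    refine (smul_eq_zero.mp h1).resolve_left ?_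
    have : (s : ℝ) + 1 < n := by exact_mod_cast hs
    refine neg_ne_zero.mpr (mul_ne_zero (by positivity) ?_)
    linarith

/-- Schur's lemma: if `∑ (eⁱ ⊗ 1) Tᵢ = 0` (second Bianchi identity) and the contractions of the
derivatives `Tᵢ` are multiples of `g^(p-1)`, then the divergence of `T` vanishes. -/
theorem sum_lcontr_eq_zero {s : ℕ} (hs : s + 2 < n) {T' : Fin n → DoubleForm V}
    (hT' : ∀ i, transpose V (T' i) = T' i) (bianchi : ∑ i, lform b i * T' i = 0)
    {a : Fin n → ℝ} (ha : ∀ i, contraction V (T' i) = a i • metricD V ^ (s + 1)) :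
    ∑ i, lcontr b i (T' i) = 0 := by
  -- Contracting the transposed identity expresses the divergence by the differential of the factor;
  -- a further contraction shows that this differential vanishes.
  have bianchi' : ∑ i, rform b i * T' i = 0 := by
    have := congrArg (transpose V) bianchi
    simpa only [map_sum, map_mul, hT', transpose_lform, map_zero] using this
  have div : ∑ i, lcontr b i (T' i) = ∑ i, a i • (rform b i * metricD V ^ (s + 1)) := by
    have := congrArg (contraction V) bianchi'
    simp only [map_sum, contraction_rform_mul, ha, Finset.sum_sub_distrib, map_zero,
      mul_smul_comm] at this
    exact sub_eq_zero.mp this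
  have h1 := congrArg (contraction V) div
  simp only [map_sum, map_smul, contraction_lcontr, ha, lcontr_metricD_pow,
    contraction_rform_mul_metricD_pow] at h1
  have h2 : (((s : ℝ) + 1) * (n - s - 2)) • ∑ i, a i • (rform b i * metricD V ^ s) = 0 := by
    rw [← sub_eq_zero, ← Finset.sum_sub_distrib] at h1
    rw [← h1, Finset.smul_sum]
    refine Finset.sum_congr rfl fun i _ => ?_
    module
  have hsn : (s : ℝ) + 2 < n := by exact_mod_cast hs
  have h3 := (smul_eq_zero.mp h2).resolve_left
    (mul_ne_zero (by positivity) (by linarith))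
  have h4 := sum_smul_rform_eq_zero b (by omega) h3
  rw [div]
  simp only [← smul_mul_assoc, ← Finset.sum_mul, h4, zero_mul]

/-- The pointwise core of the theorem: if `T` and its derivatives `Tᵢ` satisfy the second Bianchi
identity and the derivatives of the hyper and the weak Einstein conditions, then `‖T‖²` is
stationary. The divergence of the `(1,1)` double form `c^(p-1) (T ∘ T) / (p-1)!` is
half the differential of `‖T‖²`, whereas the weak condition makes it `p/n` times this
differential. -/
theorem innerD_derivative_eq_zero {s : ℕ} (hs : s + 2 < n) (hn : n ≠ 2 * (s + 2))
    {T : DoubleForm V} {T' : Fin n → DoubleForm V}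
    (hT : T ∈ bidegree V (s + 2) (s + 2)) (hT' : ∀ i, T' i ∈ bidegree V (s + 2) (s + 2))
    (hσ : transpose V T = T) (hσ' : ∀ i, transpose V (T' i) = T' i)
    (bianchi : ∑ i, lform b i * T' i = 0)
    {a : Fin n → ℝ} (ha : ∀ i, contraction V (T' i) = a i • metricD V ^ (s + 1))
    (weak : ∀ i, (1 / ((s + 1).factorial : ℝ)) •
      (contraction V ^ (s + 1)) (comp V T (T' i) + comp V (T' i) T) =
        (((s + 2 : ℕ) : ℝ) / n * (2 * innerD V T (T' i))) • metricD V) (j : Fin n) :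
    innerD V T (T' j) = 0 := by
  have div := sum_lcontr_eq_zero b hs hσ' bianchi ha
  have hm : ((s + 1).factorial : ℝ) ≠ 0 := by exact_mod_cast (s + 1).factorial_ne_zero
  have comps : ∀ i, innerD V (lcontr b i (T' i)) (lcontr b j T) +
      innerD V (lcontr b i T) (lcontr b j (T' i)) =
      if i = j then ((s + 2 : ℕ) : ℝ) / n * (2 * innerD V T (T' i)) else 0 := by
    intro i
    have h1 := congrArg (fun w => innerD V 1 (lcontr b i (rcontr b j w))) (weak i)
    have h2 : lcontr b i (rcontr b j (metricD V)) = (if i = j then (1 : ℝ) else 0) • 1 := by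
      have := rcontr_metricD_pow b j 0
      simp only [zero_add, pow_one, pow_zero, Nat.cast_zero, one_smul] at this
      rw [this, lcontr_lform_mul, lcontr_one, mul_zero, sub_zero]
    simp only [map_add, map_smul, innerD_one_lcontr_rcontr_comp b i j hT (hT' i),
      innerD_one_lcontr_rcontr_comp b i j (hT' i) hT, hσ, hσ', h2, innerD_one_one, smul_eq_mul,
      mul_one] at h1
    rw [← mul_add, ← mul_assoc, one_div_mul_cancel hm, one_mul] at h1
    rw [h1, mul_ite, mul_one, mul_zero]
  have h1 := Finset.sum_congr rfl fun i (_ : i ∈ Finset.univ) => comps i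
  rw [Finset.sum_add_distrib, Finset.sum_ite_eq' Finset.univ j, if_pos (Finset.mem_univ j)] at h1
  have h2 : ∑ i, innerD V (lcontr b i (T' i)) (lcontr b j T) = 0 := by
    rw [← LinearMap.sum_apply, ← map_sum, div, map_zero, LinearMap.zero_apply]
  have h3 : ∑ i, innerD V (lcontr b i T) (lcontr b j (T' i)) = innerD V T (T' j) := by
    have : ∀ i, innerD V (lcontr b i T) (lcontr b j (T' i)) =
        innerD V T ((if j = i then (1 : ℝ) else 0) • T' i - lcontr b j (lform b i * T' i)) := by
      intro i
      rw [lcontr_lform_mul, sub_sub_cancel, innerD_comm, ← innerD_lform_mul, innerD_comm]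
    rw [Finset.sum_congr rfl fun i _ => this i, ← map_sum, Finset.sum_sub_distrib, ← map_sum,
      bianchi, map_zero, sub_zero]
    simp
  rw [h2, h3, zero_add] at h1
  have hn0 : (n : ℝ) ≠ 0 := by
    have : n ≠ 0 := by omega
    exact_mod_cast this
  -- The two expressions for the divergence differ by the factor `n - 2p`, which is not zero.
  have hn2 : (n : ℝ) ≠ 2 * (s + 2) := by exact_mod_cast hn
  push_cast at h1
  field_simp at h1
  have : innerD V T (T' j) * (n - 2 * (s + 2)) = 0 := by linarith
  exact (mul_eq_zero.mp this).resolve_right (sub_ne_zero.mpr hn2)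

end DoubleForms

namespace DoubleForms

/-! ### Pullback of double forms -/

section Pullback

variable {V : Type*} [NormedAddCommGroup V] [InnerProductSpace ℝ V] [FiniteDimensional ℝ V]
  {W : Type*} [NormedAddCommGroup W] [InnerProductSpace ℝ W] [FiniteDimensional ℝ W]

/-- The pullback of forms along a linear map. -/
def pullForm (A : V →ₗ[ℝ] W) : Forms W →ₐ[ℝ] Forms V := ExteriorAlgebra.map A.dualMap

/-- The pullback of double forms along a linear map. -/
def pullD (A : V →ₗ[ℝ] W) : DoubleForm W →ₐ[ℝ] DoubleForm V :=
  Algebra.TensorProduct.map (pullForm A) (pullForm A)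

theorem pullForm_ι (A : V →ₗ[ℝ] W) (f : Module.Dual ℝ W) :
    pullForm A (ExteriorAlgebra.ι ℝ f) = ExteriorAlgebra.ι ℝ (f ∘ₗ A) :=
  ExteriorAlgebra.map_apply_ι _ _

theorem pullD_tmul (A : V →ₗ[ℝ] W) (α β : Forms W) :
    pullD A (α ⊗ₜ β) = pullForm A α ⊗ₜ pullForm A β := rfl

/-! ### Naturality under isometries -/

variable (L : V ≃ₗᵢ[ℝ] W)

/-- The pullback of double forms along an isometry. -/
abbrev isoPull : DoubleForm W →ₐ[ℝ] DoubleForm V := pullD L.toLinearEquiv.toLinearMap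

theorem sharp_comp_isometry (f : Module.Dual ℝ W) :
    sharp V (f ∘ₗ L.toLinearEquiv.toLinearMap) = L.symm (sharp W f) := by
  refine ext_inner_right ℝ fun v => ?_
  rw [inner_sharp, L.symm.inner_map_eq_flip, inner_sharp]
  rfl

theorem pullForm_contractCovector (f : Module.Dual ℝ W) (α : Forms W) :
    pullForm L.toLinearEquiv.toLinearMap (contractCovector W f α) =
      contractCovector V (f ∘ₗ L.toLinearEquiv.toLinearMap)
        (pullForm L.toLinearEquiv.toLinearMap α) := by
  induction α using forms_induction with
  | one => simp only [map_one, contractCovector_one, map_zero]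
  | add x y hx hy => simp only [map_add, hx, hy]
  | smul r x hx => simp only [map_smul, hx]
  | ι_mul h x hx =>
    rw [map_mul (pullForm _), pullForm_ι, contractCovector_ι_mul, contractCovector_ι_mul, map_sub,
      map_mul (pullForm _), map_smul, hx, pullForm_ι, sharp_comp_isometry,
      sharp_comp_isometry, L.symm.inner_map_map]

theorem algebraMapInv_pullForm (A : V →ₗ[ℝ] W) (α : Forms W) :
    ExteriorAlgebra.algebraMapInv (pullForm A α) = ExteriorAlgebra.algebraMapInv α := by
  have : ExteriorAlgebra.algebraMapInv.comp (pullForm A) =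
      (ExteriorAlgebra.algebraMapInv : Forms W →ₐ[ℝ] ℝ) := by
    refine ExteriorAlgebra.hom_ext (LinearMap.ext fun f => ?_)
    simp only [LinearMap.comp_apply, AlgHom.toLinearMap_apply, AlgHom.comp_apply, pullForm_ι]
    simp [ExteriorAlgebra.algebraMapInv]
  exact DFunLike.congr_fun this α

theorem innerForm_pullForm (α β : Forms W) :
    innerForm V (pullForm L.toLinearEquiv.toLinearMap α)
      (pullForm L.toLinearEquiv.toLinearMap β) = innerForm W α β := by
  induction α using forms_induction generalizing β with
  | one => rw [map_one, innerForm_one_left, innerForm_one_left, algebraMapInv_pullForm]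
  | add x y hx hy => simp only [map_add, LinearMap.add_apply, hx, hy]
  | smul r x hx => simp only [map_smul, LinearMap.smul_apply, hx]
  | ι_mul h x hx =>
    rw [map_mul, pullForm_ι, innerForm_ι_mul, innerForm_ι_mul, ← pullForm_contractCovector, hx]

theorem coframe_comp_isometry {n : ℕ} (b : OrthonormalBasis (Fin n) ℝ W) (i : Fin n) :
    coframe b i ∘ₗ L.toLinearEquiv.toLinearMap = coframe (b.map L.symm) i := by
  refine LinearMap.ext fun v => ?_
  change ⟪b i, L v⟫_ℝ = ⟪b.map L.symm i, v⟫_ℝ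
  rw [OrthonormalBasis.map_apply, L.symm.inner_map_eq_flip]
  rfl

theorem isoPull_metricD : isoPull L (metricD W) = metricD V := by
  rw [metricD_eq_sum (stdOrthonormalBasis ℝ W),
    metricD_eq_sum ((stdOrthonormalBasis ℝ W).map L.symm), map_sum]
  refine Finset.sum_congr rfl fun i _ => ?_
  rw [pullD_tmul, pullForm_ι, coframe_comp_isometry]

theorem isoPull_contraction (w : DoubleForm W) :
    isoPull L (contraction W w) = contraction V (isoPull L w) := by
  induction w using TensorProduct.induction_on with
  | zero => simp
  | add x y hx hy => simp only [map_add, hx, hy]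
  | tmul α β =>
    rw [contraction_eq_sum (stdOrthonormalBasis ℝ W),
      contraction_eq_sum ((stdOrthonormalBasis ℝ W).map L.symm), map_sum]
    refine Finset.sum_congr rfl fun i _ => ?_
    simp only [rcontr_tmul, lcontr_tmul, pullD_tmul, pullForm_contractCovector,
      coframe_comp_isometry]

theorem isoPull_contraction_pow (m : ℕ) (w : DoubleForm W) :
    isoPull L ((contraction W ^ m) w) = (contraction V ^ m) (isoPull L w) := by
  induction m generalizing w with
  | zero => rfl
  | succ m ih => simp only [pow_succ, Module.End.mul_apply, ih, isoPull_contraction]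

theorem isoPull_comp (w η : DoubleForm W) :
    isoPull L (comp W w η) = comp V (isoPull L w) (isoPull L η) := by
  induction w using TensorProduct.induction_on with
  | zero => simp [comp_zero_left]
  | add x y hx hy => simp only [comp_add_left, map_add, hx, hy]
  | tmul α β =>
    induction η using TensorProduct.induction_on with
    | zero => simp [comp_zero_right]
    | add x y hx hy => simp only [comp_add_right, map_add, hx, hy]
    | tmul γ δ => simp only [comp_tmul, map_smul, pullD_tmul, innerForm_pullForm]

end Pullback

end DoubleForms

/-! ### Algebraic derivatives of maps with values in a vector space -/

section HasDer

variable {E : Type*} [NormedAddCommGroup E] [NormedSpace ℝ E]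
  {W W' W'' : Type*} [AddCommGroup W] [Module ℝ W] [AddCommGroup W'] [Module ℝ W']
  [AddCommGroup W''] [Module ℝ W'']

/-- `HasDer F F' x`: the map `F`, with values in a real vector space without topology, is a finite
combination `∑ fₐ wₐ` of constant vectors whose coefficients are differentiable at `x`, and
`F' = ∑ dfₐ(x) wₐ` is its differential. -/
def HasDer (F : E → W) (F' : E → W) (x : E) : Prop :=
  ∃ (m : ℕ) (f : Fin m → E → ℝ) (f' : Fin m → E →L[ℝ] ℝ) (w : Fin m → W),
    (∀ a, HasFDerivAt (f a) (f' a) x) ∧ (∀ y, F y = ∑ a, f a y • w a) ∧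
      ∀ v, F' v = ∑ a, f' a v • w a

namespace HasDer

variable {F G : E → W} {F' G' : E → W} {x : E}

theorem const (w : W) : HasDer (fun _ : E => w) (fun _ => 0) x :=
  ⟨1, fun _ _ => 1, fun _ => 0, fun _ => w, fun _ => hasFDerivAt_const _ _, by simp, by simp⟩

theorem smul_const {f : E → ℝ} {f' : E →L[ℝ] ℝ} (hf : HasFDerivAt f f' x) (w : W) :
    HasDer (fun y => f y • w) (fun v => f' v • w) x :=
  ⟨1, fun _ => f, fun _ => f', fun _ => w, fun _ => hf, by simp, by simp⟩

theorem add (hF : HasDer F F' x) (hG : HasDer G G' x) :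
    HasDer (fun y => F y + G y) (fun v => F' v + G' v) x := by
  obtain ⟨m, f, f', w, hf, hF, hF'⟩ := hF
  obtain ⟨l, g, g', u, hg, hG, hG'⟩ := hG
  refine ⟨m + l, Fin.append f g, Fin.append f' g', Fin.append w u, fun a => ?_, fun y => ?_,
    fun v => ?_⟩
  · refine Fin.addCases (fun i => ?_) (fun i => ?_) a
    · simpa using hf i
    · simpa using hg i
  · simp [Fin.sum_univ_add, hF, hG]
  · simp [Fin.sum_univ_add, hF', hG']

theorem sum {ι : Type*} (s : Finset ι) {F : ι → E → W} {F' : ι → E → W}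
    (h : ∀ i ∈ s, HasDer (F i) (F' i) x) :
    HasDer (fun y => ∑ i ∈ s, F i y) (fun v => ∑ i ∈ s, F' i v) x := by
  classical
  induction s using Finset.induction_on with
  | empty => simpa using const (x := x) (0 : W)
  | insert a s ha ih =>
    simp only [Finset.sum_insert ha]
    exact (h a (Finset.mem_insert_self _ _)).add
      (ih fun i hi => h i (Finset.mem_insert_of_mem hi))

/-- The Leibniz rule for a bilinear map. -/
theorem bilin (B : W →ₗ[ℝ] W' →ₗ[ℝ] W'') {G : E → W'} {G' : E → W'} (hF : HasDer F F' x)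
    (hG : HasDer G G' x) :
    HasDer (fun y => B (F y) (G y)) (fun v => B (F' v) (G x) + B (F x) (G' v)) x := by
  obtain ⟨m, f, f', w, hf, hF, hF'⟩ := hF
  obtain ⟨l, g, g', u, hg, hG, hG'⟩ := hG
  have := sum (x := x) (Finset.univ : Finset (Fin m × Fin l))
    fun c _ => smul_const ((hf c.1).mul (hg c.2)) (B (w c.1) (u c.2))
  convert this using 1
  · funext y
    simp only [hF, hG, map_sum, LinearMap.sum_apply, map_smul, LinearMap.smul_apply,
      Fintype.sum_prod_type, Finset.smul_sum]
    rw [Finset.sum_comm]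
    refine Finset.sum_congr rfl fun i _ => Finset.sum_congr rfl fun j _ => ?_
    rw [smul_smul, mul_comm]
    rfl
  · funext v
    simp only [hF, hG, hF', hG', map_sum, LinearMap.sum_apply, map_smul, LinearMap.smul_apply,
      Fintype.sum_prod_type, Finset.smul_sum]
    rw [Finset.sum_comm]
    nth_rewrite 2 [Finset.sum_comm]
    rw [← Finset.sum_add_distrib]
    refine Finset.sum_congr rfl fun i _ => ?_
    rw [← Finset.sum_add_distrib]
    refine Finset.sum_congr rfl fun j _ => ?_
    simp only [_root_.add_apply, _root_.smul_apply, smul_eq_mul]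
    module

theorem linear (A : W →ₗ[ℝ] W') (hF : HasDer F F' x) :
    HasDer (fun y => A (F y)) (fun v => A (F' v)) x := by
  obtain ⟨m, f, f', w, hf, hF, hF'⟩ := hF
  exact ⟨m, f, f', fun a => A (w a), hf, fun y => by simp [hF], fun v => by simp [hF']⟩

theorem smul {f : E → ℝ} {f' : E →L[ℝ] ℝ} (hf : HasFDerivAt f f' x) (hF : HasDer F F' x) :
    HasDer (fun y => f y • F y) (fun v => f' v • F x + f x • F' v) x := by
  have h : HasDer f f' x := by simpa using smul_const hf (1 : ℝ)
  exact bilin (LinearMap.lsmul ℝ W) h hF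

theorem mul {A : Type*} [Ring A] [Algebra ℝ A] {F G F' G' : E → A} (hF : HasDer F F' x)
    (hG : HasDer G G' x) :
    HasDer (fun y => F y * G y) (fun v => F' v * G x + F x * G' v) x :=
  bilin (LinearMap.mul ℝ A) hF hG

/-- The power rule at a point where the value of the map is central. -/
theorem pow {A : Type*} [Ring A] [Algebra ℝ A] {F F' : E → A} (hF : HasDer F F' x)
    (hc : ∀ z, F x * z = z * F x) (k : ℕ) :
    HasDer (fun y => F y ^ (k + 1)) (fun v => ((k : ℝ) + 1) • (F x ^ k * F' v)) x := by
  induction k with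
  | zero => simpa using hF
  | succ k ih =>
    have := hF.mul ih
    convert this using 1
    · funext y; rw [← pow_succ']
    · funext v
      have h1 : F' v * F x ^ (k + 1) = F x ^ (k + 1) * F' v :=
        ((show Commute (F x) (F' v) from hc _).pow_left (k + 1)).eq.symm
      rw [h1, mul_smul_comm, ← mul_assoc, ← pow_succ']
      push_cast
      module

/-- Linear functionals of the map are differentiable in the usual sense. -/
theorem hasFDerivAt {F : E → ℝ} {F' : E → ℝ} (hF : HasDer F F' x) :
    ∃ φ : E →L[ℝ] ℝ, HasFDerivAt F φ x ∧ ∀ v, φ v = F' v := by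
  obtain ⟨m, f, f', w, hf, hF, hF'⟩ := hF
  obtain rfl : F = fun y => ∑ a, f a y * w a := funext hF
  refine ⟨∑ a, w a • f' a, ?_, fun v => ?_⟩
  · exact HasFDerivAt.fun_sum (u := Finset.univ) fun a _ => (hf a).mul_const (w a)
  · simp [hF', mul_comm]

/-- Differentials are unique, and depend only on the germ of the map. -/
theorem eq_of_eventuallyEq (hF : HasDer F F' x) (hG : HasDer G G' x)
    (h : F =ᶠ[nhds x] G) (v : E) : F' v = G' v := by
  rw [← sub_eq_zero, ← Module.forall_dual_apply_eq_zero_iff ℝ]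
  intro ℓ
  obtain ⟨φ, hφ, hφ'⟩ := (hF.linear ℓ).hasFDerivAt
  obtain ⟨ψ, hψ, hψ'⟩ := (hG.linear ℓ).hasFDerivAt
  have : φ = ψ := hφ.unique (hψ.congr_of_eventuallyEq (h.fun_comp ℓ))
  rw [map_sub, ← hφ', ← hψ', this, sub_self]

/-- The differential of a map with values in a subspace takes values in this subspace. -/
theorem mem_of_eventually_mem (hF : HasDer F F' x) (S : Submodule ℝ W)
    (h : ∀ᶠ y in nhds x, F y ∈ S) (v : E) : F' v ∈ S := by
  rw [← Submodule.Quotient.mk_eq_zero]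
  have h1 := hF.linear S.mkQ
  refine eq_of_eventuallyEq h1 (const (0 : W ⧸ S)) ?_ v
  filter_upwards [h] with y hy
  simpa using hy

theorem congr_deriv (hF : HasDer F F' x) {F₁' : E → W} (h : ∀ v, F₁' v = F' v) :
    HasDer F F₁' x := by
  rwa [funext h]

end HasDer

end HasDer

namespace LocalGeometry

open Filter Topology

/-- The order of smoothness which makes second derivatives symmetric. -/
theorem two_le_infty : minSmoothness ℝ 2 ≤ (∞ : WithTop ℕ∞) := by
  rw [minSmoothness_of_isRCLikeNormedField]
  exact ENat.LEInfty.out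

variable {E : Type*} [NormedAddCommGroup E] [NormedSpace ℝ E] [FiniteDimensional ℝ E]

/-! ### Christoffel symbols and curvature of a metric on a vector space -/

variable (E) in
/-- The linear map `D ↦ (D u v w + D v u w - D w u v) / 2`, which sends the differential of a metric
to its Christoffel symbols of the first kind. -/
def koszul : (E →L[ℝ] E →L[ℝ] E →L[ℝ] ℝ) →L[ℝ] (E →L[ℝ] E →L[ℝ] E →L[ℝ] ℝ) :=
  (1 / 2 : ℝ) • (ContinuousLinearMap.id ℝ _ +
    ((ContinuousLinearMap.flipₗᵢ ℝ E E (E →L[ℝ] ℝ)).toContinuousLinearEquiv :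
      (E →L[ℝ] E →L[ℝ] E →L[ℝ] ℝ) →L[ℝ] (E →L[ℝ] E →L[ℝ] E →L[ℝ] ℝ)) -
    (ContinuousLinearMap.compL ℝ E (E →L[ℝ] E →L[ℝ] ℝ) (E →L[ℝ] E →L[ℝ] ℝ)
      ((ContinuousLinearMap.flipₗᵢ ℝ E E ℝ).toContinuousLinearEquiv :
        (E →L[ℝ] E →L[ℝ] ℝ) →L[ℝ] (E →L[ℝ] E →L[ℝ] ℝ))) ∘L
    ((ContinuousLinearMap.flipₗᵢ ℝ E E (E →L[ℝ] ℝ)).toContinuousLinearEquiv :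
      (E →L[ℝ] E →L[ℝ] E →L[ℝ] ℝ) →L[ℝ] (E →L[ℝ] E →L[ℝ] E →L[ℝ] ℝ)))

theorem koszul_apply (D : E →L[ℝ] E →L[ℝ] E →L[ℝ] ℝ) (u v w : E) :
    koszul E D u v w = 1 / 2 * (D u v w + D v u w - D w u v) := rfl

/-- The Christoffel symbols of the first kind `⟨∇ᵤ v, w⟩` of the metric `g`, for constant vector
fields. -/
def chr (g : E → E →L[ℝ] E →L[ℝ] ℝ) (y : E) : E →L[ℝ] E →L[ℝ] E →L[ℝ] ℝ :=
  koszul E (fderiv ℝ g y)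

/-- The differential of the Christoffel symbols of the first kind. -/
def dchr (g : E → E →L[ℝ] E →L[ℝ] ℝ) (y : E) : E →L[ℝ] E →L[ℝ] E →L[ℝ] E →L[ℝ] ℝ :=
  koszul E ∘L fderiv ℝ (fderiv ℝ g) y

/-- The Christoffel symbols of the second kind `∇ᵤ v`, for constant vector fields. -/
def chr2 (g : E → E →L[ℝ] E →L[ℝ] ℝ) (y u v : E) : E := (g y).inverse (chr g y u v)

/-- The covariant curvature tensor `⟨R(u, v) l, k⟩`, expressed by the Christoffel symbols of the
first kind. -/
def curv (g : E → E →L[ℝ] E →L[ℝ] ℝ) (y u v k l : E) : ℝ :=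
  dchr g y u v l k - dchr g y v u l k - chr g y u k (chr2 g y v l) + chr g y v k (chr2 g y u l)

/-- The germ of `g` at `y` is a smooth nondegenerate symmetric bilinear form. -/
structure MetricAt (g : E → E →L[ℝ] E →L[ℝ] ℝ) (y : E) : Prop where
  eventually_smooth : ∀ᶠ z in 𝓝 y, ContDiffAt ℝ ∞ g z
  symm : ∀ᶠ z in 𝓝 y, ∀ u v, g z u v = g z v u
  inv : (g y).IsInvertible

variable {g : E → E →L[ℝ] E →L[ℝ] ℝ} {y : E}

namespace MetricAt

theorem smooth (h : MetricAt g y) : ContDiffAt ℝ ∞ g y := h.eventually_smooth.self_of_nhds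

theorem symm_apply (h : MetricAt g y) (u v : E) : g y u v = g y v u := h.symm.self_of_nhds u v

theorem smooth_fderiv (h : MetricAt g y) : ContDiffAt ℝ ∞ (fderiv ℝ g) y :=
  h.smooth.fderiv_right (by simp)

theorem hasFDerivAt (h : MetricAt g y) : HasFDerivAt g (fderiv ℝ g y) y :=
  (h.smooth.differentiableAt (by simp)).hasFDerivAt

theorem hasFDerivAt_chr (h : MetricAt g y) : HasFDerivAt (chr g) (dchr g y) y :=
  (koszul E).hasFDerivAt.comp y (h.smooth_fderiv.differentiableAt (by simp)).hasFDerivAt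

theorem fderiv_symm (h : MetricAt g y) (w u v : E) :
    fderiv ℝ g y w u v = fderiv ℝ g y w v u := by
  have h1 : ∀ a b : E, HasFDerivAt (fun z => g z a b)
      (((fderiv ℝ g y).flip a).flip b) y := fun a b =>
    (h.hasFDerivAt.clm_apply (hasFDerivAt_const a y)).clm_apply (hasFDerivAt_const b y)
      |>.congr_fderiv (by ext; simp)
  have h2 := (h1 u v).unique
    ((h1 v u).congr_of_eventuallyEq (h.symm.mono fun z hz => hz u v))
  exact DFunLike.congr_fun h2 w

theorem snd_symm (h : MetricAt g y) (u v a b : E) :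
    fderiv ℝ (fderiv ℝ g) y u v a b = fderiv ℝ (fderiv ℝ g) y v u a b := by
  rw [(h.smooth.isSymmSndFDerivAt two_le_infty) u v]

theorem eventually (h : MetricAt g y) : ∀ᶠ z in 𝓝 y, MetricAt g z := by
  have h1 := h.eventually_smooth.eventually_nhds
  have h2 : ∀ᶠ z in 𝓝 y, (g z).IsInvertible := by
    obtain ⟨e, he⟩ := h.inv
    have := (ContinuousLinearEquiv.nhds e)
    rw [he] at this
    have h3 := h.smooth.continuousAt this
    filter_upwards [h3] with z hz
    exact hz
  filter_upwards [h1, h.symm.eventually_nhds, h2] with z a b c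
  exact ⟨a, b, c⟩

theorem snd_symm' (h : MetricAt g y) (u v a b : E) :
    fderiv ℝ (fderiv ℝ g) y u v a b = fderiv ℝ (fderiv ℝ g) y u v b a := by
  have hd := (h.smooth_fderiv.differentiableAt (by simp)).hasFDerivAt
  have h1 : ∀ a b : E, HasFDerivAt (fun z => fderiv ℝ g z v a b)
      ((((fderiv ℝ (fderiv ℝ g) y).flip v).flip a).flip b) y := fun a b =>
    ((hd.clm_apply (hasFDerivAt_const v y)).clm_apply (hasFDerivAt_const a y)).clm_apply
      (hasFDerivAt_const b y) |>.congr_fderiv (by ext; simp)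
  have h2 := (h1 a b).unique
    ((h1 b a).congr_of_eventuallyEq (h.eventually.mono fun z hz => hz.fderiv_symm v a b))
  exact DFunLike.congr_fun h2 u

theorem chr_symm (h : MetricAt g y) (u v w : E) : chr g y u v w = chr g y v u w := by
  rw [chr, koszul_apply, koszul_apply, h.fderiv_symm w u v]; ring

/-- The metric is parallel. -/
theorem fderiv_eq (h : MetricAt g y) (w u v : E) :
    fderiv ℝ g y w u v = chr g y w u v + chr g y w v u := by
  rw [chr, koszul_apply, koszul_apply, h.fderiv_symm w u v, h.fderiv_symm u w v,
    h.fderiv_symm v w u]; ring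

theorem apply_chr2 (h : MetricAt g y) (u v w : E) : g y (chr2 g y u v) w = chr g y u v w := by
  obtain ⟨e, he⟩ := h.inv
  rw [chr2, ← he, ContinuousLinearMap.inverse_equiv]
  simp

theorem eq_of_apply_eq (h : MetricAt g y) {a b : E} (hab : ∀ w, g y a w = g y b w) : a = b := by
  obtain ⟨e, he⟩ := h.inv
  apply e.injective
  ext w
  have := hab w
  rwa [← he] at this

theorem chr_chr2 (h : MetricAt g y) (u k v l : E) :
    chr g y u k (chr2 g y v l) = chr g y v l (chr2 g y u k) := by
  rw [← h.apply_chr2, ← h.apply_chr2, h.symm_apply]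

theorem dchr_apply (u v l k : E) : dchr g y u v l k = 1 / 2 *
    (fderiv ℝ (fderiv ℝ g) y u v l k + fderiv ℝ (fderiv ℝ g) y u l v k -
      fderiv ℝ (fderiv ℝ g) y u k v l) := rfl

/-- The pair symmetry of the curvature. The first Bianchi identity is not needed: the symmetry of
the second derivatives of the metric suffices. -/
theorem curv_pair_symm (h : MetricAt g y) (u v k l : E) :
    curv g y u v k l = curv g y k l u v := by
  have s := h.snd_symm
  have s' := h.snd_symm'
  simp only [curv, dchr_apply]
  rw [h.chr_symm k u, h.chr_symm l u, h.chr_chr2 v k u l,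
    show chr2 g y l v = chr2 g y v l by simp only [chr2]; congr 1; ext w; exact h.chr_symm _ _ _,
    show chr2 g y k v = chr2 g y v k by simp only [chr2]; congr 1; ext w; exact h.chr_symm _ _ _]
  rw [s u v l k, s u l v k, s u k v l, s v l u k, s v k u l, s l k v u]
  rw [s' l u v k, s' k u v l, s' l v u k, s' k v u l, s' v u l k, s' k l v u]
  ring

end MetricAt

theorem curv_antisymm (g : E → E →L[ℝ] E →L[ℝ] ℝ) (y u v k l : E) :
    curv g y u v k l = -curv g y v u k l := by
  simp only [curv]; ring

theorem MetricAt.curv_antisymm' (h : MetricAt g y) (u v k l : E) :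
    curv g y u v k l = -curv g y u v l k := by
  rw [h.curv_pair_symm, curv_antisymm, h.curv_pair_symm]

/-! ### The curvature is a tensor -/

section Tensoriality

variable {φ : E → E} {H : E → E →L[ℝ] E →L[ℝ] ℝ}

/-- The transformation rule of the Christoffel symbols of the first kind. -/
theorem chr_pullback (hg : MetricAt g (φ y)) (hH : MetricAt H y)
    (hφs : ∀ᶠ z in 𝓝 y, ContDiffAt ℝ ∞ φ z)
    (hpull : ∀ᶠ z in 𝓝 y, ∀ u v, H z u v = g (φ z) (fderiv ℝ φ z u) (fderiv ℝ φ z v))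
    (u v w : E) :
    chr H y u v w = chr g (φ y) (fderiv ℝ φ y u) (fderiv ℝ φ y v) (fderiv ℝ φ y w) +
      g (φ y) (fderiv ℝ (fderiv ℝ φ) y u v) (fderiv ℝ φ y w) := by
  have hφ := hφs.self_of_nhds
  have hJ : HasFDerivAt (fderiv ℝ φ) (fderiv ℝ (fderiv ℝ φ) y) y :=
    ((hφ.fderiv_right (m := ∞) (by simp)).differentiableAt (by simp)).hasFDerivAt
  have hφ' : HasFDerivAt φ (fderiv ℝ φ y) y := (hφ.differentiableAt (by simp)).hasFDerivAt
  have key : ∀ a b c, fderiv ℝ H y a b c =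
      fderiv ℝ g (φ y) (fderiv ℝ φ y a) (fderiv ℝ φ y b) (fderiv ℝ φ y c) +
      g (φ y) (fderiv ℝ (fderiv ℝ φ) y a b) (fderiv ℝ φ y c) +
      g (φ y) (fderiv ℝ φ y b) (fderiv ℝ (fderiv ℝ φ) y a c) := by
    intro a b c
    have h1 := (hH.hasFDerivAt.clm_apply (hasFDerivAt_const b y)).clm_apply (hasFDerivAt_const c y)
    have h2 := ((hg.hasFDerivAt.comp y hφ').clm_apply
      (hJ.clm_apply (hasFDerivAt_const b y))).clm_apply (hJ.clm_apply (hasFDerivAt_const c y))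
    have h3 := DFunLike.congr_fun
      (h1.unique (h2.congr_of_eventuallyEq (hpull.mono fun z hz => hz b c))) a
    simp at h3
    rw [h3]; ring
  have hS := hφ.isSymmSndFDerivAt two_le_infty
  have e := hg.symm_apply
  simp only [chr, koszul_apply, key]
  rw [hS v u, hS w u, hS w v, e (fderiv ℝ φ y v) (fderiv ℝ (fderiv ℝ φ) y u w),
    e (fderiv ℝ φ y u) (fderiv ℝ (fderiv ℝ φ) y v w)]
  ring

/-- The transformation rule of the Christoffel symbols of the second kind. -/
theorem chr2_pullback (hg : MetricAt g (φ y)) (hH : MetricAt H y)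
    (hφ : ∀ᶠ z in 𝓝 y, ContDiffAt ℝ ∞ φ z)
    (hpull : ∀ᶠ z in 𝓝 y, ∀ u v, H z u v = g (φ z) (fderiv ℝ φ z u) (fderiv ℝ φ z v))
    (hsurj : Function.Surjective (fderiv ℝ φ y)) (u v : E) :
    fderiv ℝ φ y (chr2 H y u v) = chr2 g (φ y) (fderiv ℝ φ y u) (fderiv ℝ φ y v) +
      fderiv ℝ (fderiv ℝ φ) y u v := by
  refine hg.eq_of_apply_eq fun w => ?_
  obtain ⟨w, rfl⟩ := hsurj w
  rw [← hpull.self_of_nhds, hH.apply_chr2, chr_pullback hg hH hφ hpull, map_add,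
    _root_.add_apply, hg.apply_chr2]

/-- The curvature of a pulled back metric is the pullback of the curvature. The third derivatives of
`φ` cancel by their symmetry, the second ones through the transformation rules of the Christoffel
symbols. -/
theorem curv_pullback (hg : MetricAt g (φ y)) (hH : MetricAt H y)
    (hφs : ∀ᶠ z in 𝓝 y, ContDiffAt ℝ ∞ φ z)
    (hpull : ∀ᶠ z in 𝓝 y, ∀ u v, H z u v = g (φ z) (fderiv ℝ φ z u) (fderiv ℝ φ z v))
    (hsurj : Function.Surjective (fderiv ℝ φ y)) (u v k l : E) :
    curv H y u v k l =
      curv g (φ y) (fderiv ℝ φ y u) (fderiv ℝ φ y v) (fderiv ℝ φ y k) (fderiv ℝ φ y l) := by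
  have hφ := hφs.self_of_nhds
  have hJs := hφ.fderiv_right (m := ∞) (by simp)
  have hJ : HasFDerivAt (fderiv ℝ φ) (fderiv ℝ (fderiv ℝ φ) y) y :=
    (hJs.differentiableAt (by simp)).hasFDerivAt
  have hSd : HasFDerivAt (fderiv ℝ (fderiv ℝ φ)) (fderiv ℝ (fderiv ℝ (fderiv ℝ φ)) y) y :=
    ((hJs.fderiv_right (m := ∞) (by simp)).differentiableAt (by simp)).hasFDerivAt
  have hφ' : HasFDerivAt φ (fderiv ℝ φ y) y := (hφ.differentiableAt (by simp)).hasFDerivAt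
  have hC : ∀ v l k, ∀ᶠ z in 𝓝 y, chr H z v l k =
      chr g (φ z) (fderiv ℝ φ z v) (fderiv ℝ φ z l) (fderiv ℝ φ z k) +
      g (φ z) (fderiv ℝ (fderiv ℝ φ) z v l) (fderiv ℝ φ z k) := by
    intro v l k
    filter_upwards [hφ.continuousAt.eventually hg.eventually, hH.eventually,
      hφs.eventually_nhds, hpull.eventually_nhds] with z h1 h2 h3 h4
    exact chr_pullback h1 h2 h3 h4 v l k
  set J := fderiv ℝ φ y with hJdef
  set S := fderiv ℝ (fderiv ℝ φ) y with hSdef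
  set T := fderiv ℝ (fderiv ℝ (fderiv ℝ φ)) y with hTdef
  have key : ∀ u v l k, dchr H y u v l k = dchr g (φ y) (J u) (J v) (J l) (J k) +
      chr g (φ y) (S u v) (J l) (J k) + chr g (φ y) (J v) (S u l) (J k) +
      chr g (φ y) (J v) (J l) (S u k) + fderiv ℝ g (φ y) (J u) (S v l) (J k) +
      g (φ y) (T u v l) (J k) + g (φ y) (S v l) (S u k) := by
    intro u v l k
    have h1 := ((hH.hasFDerivAt_chr.clm_apply (hasFDerivAt_const v y)).clm_apply
      (hasFDerivAt_const l y)).clm_apply (hasFDerivAt_const k y)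
    have hJc := fun a : E => hJ.clm_apply (hasFDerivAt_const a y)
    have h2 := (((hg.hasFDerivAt_chr.comp y hφ').clm_apply (hJc v)).clm_apply (hJc l)).clm_apply
      (hJc k)
    have h3 := ((hg.hasFDerivAt.comp y hφ').clm_apply ((hSd.clm_apply
      (hasFDerivAt_const v y)).clm_apply (hasFDerivAt_const l y))).clm_apply (hJc k)
    have h4 := DFunLike.congr_fun
      (h1.unique ((h2.add h3).congr_of_eventuallyEq (hC v l k))) u
    simp at h4
    rw [h4]
    simp only [← hJdef, ← hSdef]
    ring
  have hS : ∀ a b, S a b = S b a := hφ.isSymmSndFDerivAt two_le_infty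
  have hT : ∀ a b c, T a b c = T b a c := fun a b c => by
    rw [(hJs.isSymmSndFDerivAt two_le_infty) a b]
  have e := hg.symm_apply
  have hq : ∀ u k v l, chr H y u k (chr2 H y v l) =
      chr g (φ y) (J u) (J k) (chr2 g (φ y) (J v) (J l)) + chr g (φ y) (J u) (J k) (S v l) +
      chr g (φ y) (J v) (J l) (S u k) + g (φ y) (S u k) (S v l) := by
    intro u k v l
    rw [chr_pullback hg hH hφs hpull, chr2_pullback hg hH hφs hpull hsurj, map_add, map_add,
      e _ (chr2 g (φ y) (J v) (J l)), hg.apply_chr2]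
    ring
  simp only [curv, key, hq, hg.fderiv_eq]
  rw [hT v u l, hS v u, hg.chr_symm (J v) (S u l) (J k), hg.chr_symm (J u) (S v l) (J k),
    e (S v l) (S u k)]
  rw [hg.chr_symm (S u l) (J v) (J k), hg.chr_symm (S v l) (J u) (J k)]
  rw [e (S u l) (S v k)]
  ring

end Tensoriality

/-! ### The second Bianchi identity -/

theorem MetricAt.contDiffAt_chr (h : MetricAt g y) (v l k : E) :
    ContDiffAt ℝ ∞ (fun z => chr g z v l k) y :=
  ((((koszul E).contDiff.contDiffAt.comp y h.smooth_fderiv).clm_apply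
    contDiffAt_const).clm_apply contDiffAt_const).clm_apply contDiffAt_const

theorem MetricAt.fderiv_chr (h : MetricAt g y) (u v l k : E) :
    fderiv ℝ (fun z => chr g z v l k) y u = dchr g y u v l k := by
  have h1 := ((h.hasFDerivAt_chr.clm_apply (hasFDerivAt_const v y)).clm_apply
    (hasFDerivAt_const l y)).clm_apply (hasFDerivAt_const k y)
  rw [h1.fderiv]
  simp

/-- At a point where the Christoffel symbols vanish, the differential of the curvature is given by
the second derivatives of the Christoffel symbols. -/
theorem MetricAt.hasFDerivAt_curv (h : MetricAt g y) (h0 : chr g y = 0) (u v k l : E) :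
    ∃ D : E →L[ℝ] ℝ, HasFDerivAt (fun z => curv g z u v k l) D y ∧
      ∀ m, D m = fderiv ℝ (fderiv ℝ (fun z => chr g z v l k)) y m u -
        fderiv ℝ (fderiv ℝ (fun z => chr g z u l k)) y m v := by
  have hd : ∀ u v l k, HasFDerivAt (fun z => dchr g z u v l k)
      ((fderiv ℝ (fderiv ℝ (fun z => chr g z v l k)) y).flip u) y := by
    intro u v l k
    have h1 := (((h.contDiffAt_chr v l k).fderiv_right (m := ∞) (by simp)).differentiableAt
      (by simp)).hasFDerivAt.clm_apply (hasFDerivAt_const u y)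
    refine (h1.congr_of_eventuallyEq (h.eventually.mono fun z hz =>
      (hz.fderiv_chr u v l k).symm)).congr_fderiv ?_
    ext; simp
  have hinv : DifferentiableAt ℝ (fun z => (g z).inverse) y := by
    obtain ⟨e, he⟩ := h.inv
    have h1 := contDiffAt_map_inverse (𝕜 := ℝ) (n := 1) e
    rw [he] at h1
    exact (h1.differentiableAt (by simp)).comp y (h.smooth.differentiableAt (by simp))
  have hc : ∀ u k v l, HasFDerivAt (fun z => chr g z u k (chr2 g z v l)) (0 : E →L[ℝ] ℝ) y := by
    intro u k v l
    have hcc := fun a b : E => (h.hasFDerivAt_chr.clm_apply (hasFDerivAt_const a y)).clm_apply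
      (hasFDerivAt_const b y)
    have h1 := (hcc u k).clm_apply (hinv.hasFDerivAt.clm_apply (hcc v l))
    refine h1.congr_fderiv ?_
    ext m
    simp [h0]
  refine ⟨_, (((hd u v l k).sub (hd v u l k)).sub (hc u k v l)).add (hc v k u l), fun m => ?_⟩
  simp

/-- The second Bianchi identity at a point where the Christoffel symbols vanish. -/
theorem MetricAt.bianchi (h : MetricAt g y) (h0 : chr g y = 0) (m u v k l : E) :
    fderiv ℝ (fun z => curv g z u v k l) y m + fderiv ℝ (fun z => curv g z v m k l) y u +
      fderiv ℝ (fun z => curv g z m u k l) y v = 0 := by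
  obtain ⟨D₁, h₁, e₁⟩ := h.hasFDerivAt_curv h0 u v k l
  obtain ⟨D₂, h₂, e₂⟩ := h.hasFDerivAt_curv h0 v m k l
  obtain ⟨D₃, h₃, e₃⟩ := h.hasFDerivAt_curv h0 m u k l
  have s := fun a => (h.contDiffAt_chr a l k).isSymmSndFDerivAt two_le_infty
  rw [h₁.fderiv, h₂.fderiv, h₃.fderiv, e₁, e₂, e₃, s v m u, s u m v, s m u v]
  ring

end LocalGeometry

namespace LocalGeometry

open Filter Topology

section

variable {E : Type*} [NormedAddCommGroup E] [NormedSpace ℝ E] [FiniteDimensional ℝ E]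
  {g : E → E →L[ℝ] E →L[ℝ] ℝ} {y : E}

theorem curv_sum₁ {ι : Type*} (s : Finset ι) (a : ι → ℝ) (w : ι → E) (v k l : E) :
    curv g y (∑ i ∈ s, a i • w i) v k l = ∑ i ∈ s, a i * curv g y (w i) v k l := by
  simp only [curv, chr2, map_sum, map_smul, _root_.sum_apply, _root_.smul_apply,
    smul_eq_mul, mul_add, mul_sub, Finset.sum_add_distrib, Finset.sum_sub_distrib]

theorem curv_sum₂ {ι : Type*} (s : Finset ι) (a : ι → ℝ) (w : ι → E) (u k l : E) :
    curv g y u (∑ i ∈ s, a i • w i) k l = ∑ i ∈ s, a i * curv g y u (w i) k l := by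
  rw [curv_antisymm, curv_sum₁, ← Finset.sum_neg_distrib]
  refine Finset.sum_congr rfl fun i _ => ?_
  rw [curv_antisymm]; ring

theorem curv_sum₃ {ι : Type*} (s : Finset ι) (a : ι → ℝ) (w : ι → E) (u v l : E) :
    curv g y u v (∑ i ∈ s, a i • w i) l = ∑ i ∈ s, a i * curv g y u v (w i) l := by
  simp only [curv, chr2, map_sum, map_smul, _root_.sum_apply, _root_.smul_apply,
    smul_eq_mul, mul_add, mul_sub, Finset.sum_add_distrib, Finset.sum_sub_distrib]

theorem curv_sum₄ {ι : Type*} (s : Finset ι) (a : ι → ℝ) (w : ι → E) (u v k : E) :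
    curv g y u v k (∑ i ∈ s, a i • w i) = ∑ i ∈ s, a i * curv g y u v k (w i) := by
  simp only [curv, chr2, map_sum, map_smul, _root_.sum_apply, _root_.smul_apply,
    smul_eq_mul, mul_add, mul_sub, Finset.sum_add_distrib, Finset.sum_sub_distrib]

theorem MetricAt.differentiableAt_chr2 (h : MetricAt g y) (u v : E) :
    DifferentiableAt ℝ (fun z => chr2 g z u v) y := by
  obtain ⟨e, he⟩ := h.inv
  have h1 := contDiffAt_map_inverse (𝕜 := ℝ) (n := 1) e
  rw [he] at h1
  have hinv : DifferentiableAt ℝ (fun z => (g z).inverse) y :=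
    (h1.differentiableAt (by simp)).comp y (h.smooth.differentiableAt (by simp))
  exact hinv.clm_apply ((h.hasFDerivAt_chr.clm_apply (hasFDerivAt_const u y)).clm_apply
    (hasFDerivAt_const v y)).differentiableAt

/-- A nondegenerate bilinear form on a finite-dimensional space is invertible. -/
theorem isInvertible_of_nondegenerate (b : E →L[ℝ] E →L[ℝ] ℝ)
    (hb : ∀ u, (∀ v, b u v = 0) → u = 0) : b.IsInvertible := by
  have hinj : Function.Injective b.toLinearMap := by
    refine (injective_iff_map_eq_zero b.toLinearMap).mpr fun u hu => hb u fun v => ?_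
    exact DFunLike.congr_fun hu v
  have hdim : Module.finrank ℝ E = Module.finrank ℝ (E →L[ℝ] ℝ) := by
    rw [← (LinearMap.toContinuousLinearMap (𝕜 := ℝ) (E := E) (F' := ℝ)).finrank_eq]
    exact (Subspace.dual_finrank_eq (K := ℝ) (V := E)).symm
  refine ⟨(LinearEquiv.ofInjectiveOfFinrankEq b.toLinearMap hinj hdim).toContinuousLinearEquiv, ?_⟩
  ext u v
  rfl

end

/-! ### Coordinate expressions -/

variable {n : ℕ}

/-- The bilinear form on Euclidean space with a given matrix. -/
def toBil (G : Matrix (Fin n) (Fin n) ℝ) :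
    EuclideanSpace ℝ (Fin n) →L[ℝ] EuclideanSpace ℝ (Fin n) →L[ℝ] ℝ :=
  ∑ i, ∑ j, G i j • (EuclideanSpace.proj i : EuclideanSpace ℝ (Fin n) →L[ℝ] ℝ).smulRight
    (EuclideanSpace.proj j : EuclideanSpace ℝ (Fin n) →L[ℝ] ℝ)

theorem toBil_apply (G : Matrix (Fin n) (Fin n) ℝ) (u v : EuclideanSpace ℝ (Fin n)) :
    toBil G u v = ∑ i, ∑ j, G i j * (u i * v j) := by
  simp [toBil]

/-- The standard basis vectors. -/
abbrev stdVec (i : Fin n) : EuclideanSpace ℝ (Fin n) := EuclideanSpace.single i 1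

theorem toBil_stdVec (G : Matrix (Fin n) (Fin n) ℝ) (i j : Fin n) :
    toBil G (stdVec i) (stdVec j) = G i j := by
  rw [toBil_apply, Finset.sum_eq_single i, Finset.sum_eq_single j]
  · simp
  · intro l _ hl; simp [hl]
  · simp
  · intro l _ hl; simp [hl]
  · simp

theorem eq_sum_stdVec (u : EuclideanSpace ℝ (Fin n)) : u = ∑ i, u i • stdVec i := by
  ext j; simp [Pi.single_apply]

variable {G : EuclideanSpace ℝ (Fin n) → Matrix (Fin n) (Fin n) ℝ}
  {y : EuclideanSpace ℝ (Fin n)}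

local notation "bilOf" G => fun z => toBil (G z)

theorem partialDeriv_eq (h : MetricAt (bilOf G) y) (i j l : Fin n) :
    Curvature.partialDeriv i (fun z => G z j l) y =
      fderiv ℝ (bilOf G) y (stdVec i) (stdVec j) (stdVec l) := by
  have h1 := (h.hasFDerivAt.clm_apply (hasFDerivAt_const (stdVec j) y)).clm_apply
    (hasFDerivAt_const (stdVec l) y)
  simp only [toBil_stdVec] at h1
  rw [Curvature.partialDeriv, h1.fderiv]
  simp

theorem isUnit_det_of_metricAt (h : MetricAt (bilOf G) y) : IsUnit (G y).det := by
  rw [← Matrix.isUnit_iff_isUnit_det, ← Matrix.vecMul_injective_iff_isUnit]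
  refine (injective_iff_map_eq_zero (Matrix.vecMulLinear (G y))).mpr fun c hc => ?_
  have : (WithLp.toLp 2 c : EuclideanSpace ℝ (Fin n)) = 0 := by
    refine h.eq_of_apply_eq fun w => ?_
    have hc' : ∀ j, ∑ i, c i * G y i j = 0 := fun j => congrFun hc j
    simp only [toBil_apply, map_zero, _root_.zero_apply]
    rw [Finset.sum_comm]
    refine Finset.sum_eq_zero fun j _ => ?_
    have : ∀ i, G y i j * (c i * w j) = c i * G y i j * w j := fun i => by ring
    simp only [this, ← Finset.sum_mul, hc', zero_mul]
  ext i
  exact congrArg (fun u : EuclideanSpace ℝ (Fin n) => u i) this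

/-- The matrix inverse and the sum in the coordinate Christoffel symbols amount to the inverse of
the metric as a map to the dual space. -/
theorem christoffel_eq_chr2 (h : MetricAt (bilOf G) y) (m i j : Fin n) :
    Curvature.christoffel G m i j y = chr2 (bilOf G) y (stdVec i) (stdVec j) m := by
  have hG : ∀ a b, G y a b = G y b a := fun a b => by
    rw [← toBil_stdVec (G y), h.symm_apply, toBil_stdVec]
  have h1 : ∀ m, Curvature.christoffel G m i j y =
      ∑ l, (G y)⁻¹ m l * chr (bilOf G) y (stdVec i) (stdVec j) (stdVec l) := by
    intro m
    rw [Curvature.christoffel, Finset.mul_sum]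
    refine Finset.sum_congr rfl fun l _ => ?_
    rw [partialDeriv_eq h, partialDeriv_eq h, partialDeriv_eq h, chr, koszul_apply]
    ring
  have h2 : chr2 (bilOf G) y (stdVec i) (stdVec j) =
      ∑ m, Curvature.christoffel G m i j y • stdVec m := by
    refine h.eq_of_apply_eq fun w => ?_
    rw [h.apply_chr2, eq_sum_stdVec w, map_sum, map_sum]
    refine Finset.sum_congr rfl fun k _ => ?_
    rw [map_smul, map_smul]
    congr 1
    have h3 : ∀ l, ∑ m, G y k m * (G y)⁻¹ m l = if k = l then 1 else 0 := fun l => by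
      rw [← Matrix.mul_apply, Matrix.mul_nonsing_inv _ (isUnit_det_of_metricAt h),
        Matrix.one_apply]
    simp only [map_sum, map_smul, _root_.sum_apply, _root_.smul_apply, toBil_stdVec,
      smul_eq_mul, h1, Finset.sum_mul]
    rw [Finset.sum_comm]
    have h4 : ∀ l, ∑ m, (G y)⁻¹ m l * chr (bilOf G) y (stdVec i) (stdVec j) (stdVec l) * G y m k =
        (if k = l then 1 else 0) * chr (bilOf G) y (stdVec i) (stdVec j) (stdVec l) := by
      intro l
      rw [← h3, Finset.sum_mul]
      refine Finset.sum_congr rfl fun m _ => ?_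
      rw [hG m k]; ring
    simp [h4]
  rw [h2]
  simp [Pi.single_apply]

theorem christoffel_lower (h : MetricAt (bilOf G) y) (i j k : Fin n) :
    ∑ m, G y m k * Curvature.christoffel G m i j y =
      chr (bilOf G) y (stdVec i) (stdVec j) (stdVec k) := by
  rw [← h.apply_chr2, eq_sum_stdVec (chr2 (bilOf G) y (stdVec i) (stdVec j)), map_sum,
    _root_.sum_apply]
  refine Finset.sum_congr rfl fun m _ => ?_
  rw [map_smul, _root_.smul_apply, toBil_stdVec, christoffel_eq_chr2 h, smul_eq_mul, mul_comm]

theorem chr_chr2_eq_sum (h : MetricAt (bilOf G) y) (i k j l : Fin n) :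
    chr (bilOf G) y (stdVec i) (stdVec k) (chr2 (bilOf G) y (stdVec j) (stdVec l)) =
      ∑ m, chr (bilOf G) y (stdVec i) (stdVec k) (stdVec m) *
        Curvature.christoffel G m j l y := by
  rw [eq_sum_stdVec (chr2 (bilOf G) y (stdVec j) (stdVec l)), map_sum]
  refine Finset.sum_congr rfl fun m _ => ?_
  rw [map_smul, christoffel_eq_chr2 h, smul_eq_mul, mul_comm]

/-- The derivative of the Christoffel symbols of the second kind with the upper index lowered, which
follows by differentiating `christoffel_lower`. -/
theorem sum_mul_partialDeriv_christoffel (h : MetricAt (bilOf G) y) (i j k l : Fin n) :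
    ∑ m, G y m k * Curvature.partialDeriv i (Curvature.christoffel G m j l) y =
      dchr (bilOf G) y (stdVec i) (stdVec j) (stdVec l) (stdVec k) -
      ∑ m, (chr (bilOf G) y (stdVec i) (stdVec m) (stdVec k) +
        chr (bilOf G) y (stdVec i) (stdVec k) (stdVec m)) * Curvature.christoffel G m j l y := by
  have hΓ : ∀ m, HasFDerivAt (Curvature.christoffel G m j l)
      (fderiv ℝ (Curvature.christoffel G m j l) y) y := by
    intro m
    refine DifferentiableAt.hasFDerivAt ?_
    have h1 : DifferentiableAt ℝ (fun z => chr2 (bilOf G) z (stdVec j) (stdVec l) m) y :=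
      (EuclideanSpace.proj m : EuclideanSpace ℝ (Fin n) →L[ℝ] ℝ).differentiableAt.comp y
        (h.differentiableAt_chr2 (stdVec j) (stdVec l))
    exact h1.congr_of_eventuallyEq (h.eventually.mono fun z hz => christoffel_eq_chr2 hz m j l)
  have hG : ∀ m, HasFDerivAt (fun z => G z m k)
      (((fderiv ℝ (bilOf G) y).flip (stdVec m)).flip (stdVec k)) y := by
    intro m
    have h1 := (h.hasFDerivAt.clm_apply (hasFDerivAt_const (stdVec m) y)).clm_apply
      (hasFDerivAt_const (stdVec k) y)
    simp only [toBil_stdVec] at h1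
    refine h1.congr_fderiv ?_
    ext; simp
  have h1 := HasFDerivAt.fun_sum (u := Finset.univ) fun m _ => (hG m).mul (hΓ m)
  have h2 : HasFDerivAt (fun z => ∑ m, G z m k * Curvature.christoffel G m j l z)
      (fderiv ℝ (fun z => chr (bilOf G) z (stdVec j) (stdVec l) (stdVec k)) y) y :=
    ((h.contDiffAt_chr _ _ _).differentiableAt (by simp)).hasFDerivAt.congr_of_eventuallyEq
      (h.eventually.mono fun z hz => christoffel_lower hz j l k)
  have h3 := DFunLike.congr_fun (h1.unique h2) (stdVec i)
  rw [h.fderiv_chr] at h3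
  rw [← h3, _root_.sum_apply, ← Finset.sum_sub_distrib]
  refine Finset.sum_congr rfl fun m _ => ?_
  simp only [_root_.add_apply, _root_.smul_apply, smul_eq_mul, ContinuousLinearMap.flip_apply,
    h.fderiv_eq, Curvature.partialDeriv]
  ring

/-- The coordinate expression of the curvature in terms of the Christoffel symbols of the second
kind agrees with the one in terms of the symbols of the first kind. -/
theorem riemannDown_eq_curv (h : MetricAt (bilOf G) y) (i j k l : Fin n) :
    Curvature.riemannDown G i j k l y =
      curv (bilOf G) y (stdVec i) (stdVec j) (stdVec k) (stdVec l) := by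
  have h1 : ∀ i j : Fin n, ∑ m, G y m k *
      ∑ s, Curvature.christoffel G m i s y * Curvature.christoffel G s j l y =
      ∑ s, chr (bilOf G) y (stdVec i) (stdVec s) (stdVec k) *
        Curvature.christoffel G s j l y := by
    intro i j
    simp only [Finset.mul_sum]
    rw [Finset.sum_comm]
    refine Finset.sum_congr rfl fun s _ => ?_
    rw [← christoffel_lower h, Finset.sum_mul]
    exact Finset.sum_congr rfl fun m _ => by ring
  simp only [Curvature.riemannDown, Curvature.riemannUp, mul_add, mul_sub,
    Finset.sum_add_distrib, Finset.sum_sub_distrib, sum_mul_partialDeriv_christoffel h, h1]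
  rw [curv, chr_chr2_eq_sum h, chr_chr2_eq_sum h]
  simp only [add_mul, Finset.sum_add_distrib]
  ring

end LocalGeometry

namespace LocalGeometry

open Filter Topology

/-! ### Normal coordinates and orthonormal frames -/

section

variable {E : Type*} [NormedAddCommGroup E] [InnerProductSpace ℝ E] [FiniteDimensional ℝ E]

/-- Near the identity every endomorphism has a square root which depends differentiably on it; the
root of a self-adjoint endomorphism is self-adjoint. -/
theorem exists_sqrt_near_one : ∃ r : (E →L[ℝ] E) → (E →L[ℝ] E), r 1 = 1 ∧
    DifferentiableAt ℝ r 1 ∧ (∀ᶠ X in 𝓝 1, r X * r X = X) ∧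
    ∀ᶠ X in 𝓝 1, IsSelfAdjoint X → IsSelfAdjoint (r X) := by
  have : CompleteSpace E := FiniteDimensional.complete ℝ E
  let e : (E →L[ℝ] E) ≃L[ℝ] (E →L[ℝ] E) :=
    ContinuousLinearEquiv.smulLeft (Units.mk0 (2 : ℝ) two_ne_zero)
  have hsq : HasStrictFDerivAt (fun S : E →L[ℝ] E => S * S)
      (e : (E →L[ℝ] E) →L[ℝ] (E →L[ℝ] E)) 1 := by
    have h1 := (hasStrictFDerivAt_id (𝕜 := ℝ) (1 : E →L[ℝ] E)).mul'
      (hasStrictFDerivAt_id (𝕜 := ℝ) (1 : E →L[ℝ] E))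
    refine h1.congr_fderiv ?_
    refine ContinuousLinearMap.ext fun X => ?_
    change (1 : E →L[ℝ] E) * X + X * 1 = (2 : ℝ) • X
    rw [one_mul, mul_one, two_smul]
  have h11 : (1 : E →L[ℝ] E) * 1 = 1 := one_mul 1
  have hr := hsq.to_localInverse
  have hr1 := hsq.localInverse_apply_image
  have hright := hsq.eventually_right_inverse
  have hleft := hsq.eventually_left_inverse
  rw [h11] at hr hr1 hright
  -- The root is the local inverse of the squaring map; near `1` it is unique, so it agrees with its
  -- own adjoint at self-adjoint arguments.
  refine ⟨hsq.localInverse _ _ _, hr1, hr.hasFDerivAt.differentiableAt, hright, ?_⟩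
  have hcont : ContinuousAt (fun X => star (hsq.localInverse _ _ _ X)) 1 :=
    hr.hasFDerivAt.continuousAt.star
  have h3 : Tendsto (fun X => star (hsq.localInverse _ _ _ X)) (𝓝 1) (𝓝 1) := by
    have := hcont.tendsto
    rwa [hr1, star_one] at this
  filter_upwards [h3.eventually hleft, hright] with X hX hX2 hsa
  have h4 : star (hsq.localInverse _ _ _ X) * star (hsq.localInverse _ _ _ X) = X := by
    rw [← star_mul, hX2, hsa.star_eq]
  rw [h4] at hX
  exact hX.symm

/-- If a metric osculates to first order the Euclidean one at `0`, then there are orthonormal frames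
which osculate to first order the standard frame. -/
theorem exists_orthonormal_frame {h : E → E →L[ℝ] E →L[ℝ] ℝ} (h0 : ∀ u v, h 0 u v = ⟪u, v⟫_ℝ)
    (hd : HasFDerivAt h (0 : E →L[ℝ] E →L[ℝ] E →L[ℝ] ℝ) 0)
    (hs : ∀ᶠ y in 𝓝 0, ∀ u v, h y u v = h y v u) :
    ∃ A : E → E →L[ℝ] E, A 0 = 1 ∧ HasFDerivAt A (0 : E →L[ℝ] E →L[ℝ] E) 0 ∧
      ∀ᶠ y in 𝓝 0, ∀ u v, h y (A y u) (A y v) = ⟪u, v⟫_ℝ := by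
  have : CompleteSpace E := FiniteDimensional.complete ℝ E
  let D : (E →L[ℝ] ℝ) →L[ℝ] E :=
    LinearMap.toContinuousLinearMap
      { toFun := (InnerProductSpace.toDual ℝ E).symm
        map_add' := fun f f' => map_add _ f f'
        map_smul' := fun c f => by simp }
  have hD : ∀ (f : E →L[ℝ] ℝ) v, ⟪D f, v⟫_ℝ = f v := fun f v =>
    InnerProductSpace.toDual_symm_apply
  -- `P y` represents `h y` with respect to the inner product; the frame is `(P y)⁻¹ᐟ²`.
  set P : E → E →L[ℝ] E := fun y => D ∘L h y with hPdef
  have hP : ∀ y u v, ⟪P y u, v⟫_ℝ = h y u v := fun y u v => hD _ _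
  have hP0 : P 0 = 1 := by
    refine ContinuousLinearMap.ext fun u => ext_inner_right ℝ fun v => ?_
    rw [hP, h0]; rfl
  have hPd : HasFDerivAt P (0 : E →L[ℝ] E →L[ℝ] E) 0 := by
    have := ((ContinuousLinearMap.compL ℝ E (E →L[ℝ] ℝ) E D).hasFDerivAt (x := h 0)).comp 0 hd
    exact this.congr_fderiv (ContinuousLinearMap.comp_zero _)
  have hPsa : ∀ᶠ y in 𝓝 0, IsSelfAdjoint (P y) := by
    filter_upwards [hs] with y hy
    rw [ContinuousLinearMap.isSelfAdjoint_iff_isSymmetric]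
    intro u v
    change ⟪P y u, v⟫_ℝ = ⟪u, P y v⟫_ℝ
    rw [hP, real_inner_comm, hP, hy]
  set Q : E → E →L[ℝ] E := fun y => Ring.inverse (P y) with hQdef
  have hQ0 : Q 0 = 1 := by simp [hQdef, hP0]
  have hQd : HasFDerivAt Q (0 : E →L[ℝ] E →L[ℝ] E) 0 := by
    have h1 : DifferentiableAt ℝ (Ring.inverse : (E →L[ℝ] E) → _) (P 0) := by
      rw [hP0]
      exact differentiableAt_inverse (𝕜 := ℝ) isUnit_one
    have := h1.hasFDerivAt.comp 0 hPd
    exact this.congr_fderiv (ContinuousLinearMap.comp_zero _)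
  have hunit : ∀ᶠ y in 𝓝 0, IsUnit (P y) := by
    have h1 : {X : E →L[ℝ] E | IsUnit X} ∈ 𝓝 (P 0) := by
      rw [hP0]; exact Units.isOpen.mem_nhds isUnit_one
    exact hPd.continuousAt h1
  obtain ⟨r, hr1, hrd, hrsq, hrsa⟩ := exists_sqrt_near_one (E := E)
  have hQt : Tendsto Q (𝓝 0) (𝓝 1) := by
    have := hQd.continuousAt.tendsto
    rwa [hQ0] at this
  refine ⟨fun y => r (Q y), (congrArg r hQ0).trans hr1, ?_, ?_⟩
  · have h1 : HasFDerivAt r (fderiv ℝ r 1) (Q 0) := by rw [hQ0]; exact hrd.hasFDerivAt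
    have := h1.comp 0 hQd
    exact this.congr_fderiv (ContinuousLinearMap.comp_zero _)
  · filter_upwards [hQt.eventually hrsq, hQt.eventually hrsa, hunit, hPsa] with y h1 h2 h3 h4 u v
    have hPQ : P y * Q y = 1 := Ring.mul_inverse_cancel _ h3
    have hQP : Q y * P y = 1 := Ring.inverse_mul_cancel _ h3
    have hQsa : IsSelfAdjoint (Q y) := by
      have h5 : star (Q y) * P y = 1 := by
        rw [← h4.star_eq, ← star_mul, hPQ, star_one]
      calc star (Q y) = star (Q y) * (P y * Q y) := by rw [hPQ, mul_one]
        _ = Q y := by rw [← mul_assoc, h5, one_mul]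
    set A := r (Q y) with hA
    have hAsa : IsSelfAdjoint A := h2 hQsa
    -- The root commutes with `Q = A²`, hence with `P = Q⁻¹`, and so `A P A = A² P = 1`.
    have hAP : P y * A = A * P y := by
      calc P y * A = P y * A * (Q y * P y) := by rw [hQP, mul_one]
        _ = P y * (Q y * A) * P y := by rw [← h1]; simp only [mul_assoc]
        _ = A * P y := by rw [← mul_assoc (P y), hPQ, one_mul]
    have hAPA : A * (P y * A) = 1 := by rw [hAP, ← mul_assoc, h1, hQP]
    have hsym := (ContinuousLinearMap.isSelfAdjoint_iff_isSymmetric.mp hAsa)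
    rw [← hP, real_inner_comm]
    have h6 : ⟪A v, P y (A u)⟫_ℝ = ⟪v, A (P y (A u))⟫_ℝ := hsym _ _
    rw [h6, show A (P y (A u)) = u from DFunLike.congr_fun hAPA u, real_inner_comm]

end

section

variable {E : Type*} [NormedAddCommGroup E] [NormedSpace ℝ E] [FiniteDimensional ℝ E]

/-- The pullback of a metric along a map. -/
def pullMetric (g : E → E →L[ℝ] E →L[ℝ] ℝ) (φ : E → E) (y : E) : E →L[ℝ] E →L[ℝ] ℝ :=
  (g (φ y)).bilinearComp (fderiv ℝ φ y) (fderiv ℝ φ y)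

theorem pullMetric_apply (g : E → E →L[ℝ] E →L[ℝ] ℝ) (φ : E → E) (y u v : E) :
    pullMetric g φ y u v = g (φ y) (fderiv ℝ φ y u) (fderiv ℝ φ y v) := rfl

/-- A map with values in operators on a finite-dimensional space is smooth if it is so on every
vector. -/
theorem contDiffAt_clm_of_apply {F : Type*} [NormedAddCommGroup F] [NormedSpace ℝ F]
    {f : E → E →L[ℝ] F} {y : E} (h : ∀ v, ContDiffAt ℝ ∞ (fun z => f z v) y) :
    ContDiffAt ℝ ∞ f y := by
  let d := Module.finrank ℝ E
  have hd : d = Module.finrank ℝ (Fin d → ℝ) := (Module.finrank_fin_fun ℝ).symm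
  let e₁ := ContinuousLinearEquiv.ofFinrankEq hd
  let e₂ := (e₁.arrowCongr (1 : F ≃L[ℝ] F)).trans
    (ContinuousLinearEquiv.piRing (𝕜 := ℝ) (E := F) (Fin d))
  rw [← Function.id_comp f, ← e₂.symm_comp_self]
  exact e₂.symm.contDiff.contDiffAt.comp y (contDiffAt_pi.mpr fun i => h _)

theorem MetricAt.pullback {g : E → E →L[ℝ] E →L[ℝ] ℝ} {φ : E → E} {y : E}
    (hg : MetricAt g (φ y)) (hφ : ∀ᶠ z in 𝓝 y, ContDiffAt ℝ ∞ φ z)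
    (hbij : Function.Bijective (fderiv ℝ φ y)) : MetricAt (pullMetric g φ) y := by
  have hc := hφ.self_of_nhds.continuousAt
  refine ⟨?_, ?_, ?_⟩
  · filter_upwards [hφ, hc.eventually hg.eventually_smooth] with z h1 h2
    have hJ := h1.fderiv_right (m := ∞) (by simp)
    refine contDiffAt_clm_of_apply fun u => contDiffAt_clm_of_apply fun v => ?_
    exact ((h2.comp z h1).clm_apply (hJ.clm_apply contDiffAt_const)).clm_apply
      (hJ.clm_apply contDiffAt_const)
  · filter_upwards [hc.eventually hg.symm] with z hz u v
    exact hz _ _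
  · refine isInvertible_of_nondegenerate _ fun u hu => hbij.1 ?_
    rw [map_zero]
    refine hg.eq_of_apply_eq fun w => ?_
    obtain ⟨w, rfl⟩ := hbij.2 w
    rw [map_zero]
    exact hu w

/-- Quadratic normal coordinates: a change of coordinates with prescribed differential, in which the
Christoffel symbols vanish at the origin. -/
theorem exists_normal_coordinates {g : E → E →L[ℝ] E →L[ℝ] ℝ} {z : E} (hg : MetricAt g z)
    (L : E →L[ℝ] E) (hL : Function.Bijective L) :
    ∃ φ : E → E, φ 0 = z ∧ ContDiff ℝ ∞ φ ∧ fderiv ℝ φ 0 = L ∧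
      chr (pullMetric g φ) 0 = 0 := by
  set b : E →L[ℝ] E →L[ℝ] E :=
    (ContinuousLinearMap.compL ℝ E (E →L[ℝ] ℝ) E (g z).inverse) ∘L chr g z with hbdef
  have hb : ∀ u v, b u v = chr2 g z u v := fun u v => rfl
  have hbs : ∀ u v, b u v = b v u := fun u v => by
    rw [hb, hb, chr2, chr2]; congr 1; ext w; exact hg.chr_symm _ _ _
  -- The quadratic term cancels the Christoffel symbols in their transformation rule.
  set φ : E → E := fun y => z + L y - (1 / 2 : ℝ) • b (L y) (L y) with hφdef
  have hφd : ∀ y, HasFDerivAt φ (L - (b (L y)) ∘L L) y := by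
    intro y
    have h1 : HasFDerivAt (fun y => b (L y) (L y)) _ y :=
      (b.hasFDerivAt.comp y L.hasFDerivAt).clm_apply L.hasFDerivAt
    have h2 := ((hasFDerivAt_const z y).add L.hasFDerivAt).sub (h1.const_smul (1 / 2 : ℝ))
    refine h2.congr_fderiv ?_
    ext u
    simp [hbs (L u) (L y)]
    module
  have hfd : fderiv ℝ φ = fun y => L - (b (L y)) ∘L L := funext fun y => (hφd y).fderiv
  have hsmooth : ContDiff ℝ ∞ φ := by
    have h1 : ContDiff ℝ ∞ (fun y => b (L y) (L y)) :=
      (b.contDiff.comp L.contDiff).clm_apply L.contDiff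
    exact (contDiff_const.add L.contDiff).sub (h1.const_smul (1 / 2 : ℝ))
  have hφ0 : φ 0 = z := by simp [hφdef]
  have hL0 : fderiv ℝ φ 0 = L := by rw [hfd]; simp
  have hS : ∀ u v, fderiv ℝ (fderiv ℝ φ) 0 u v = -chr2 g z (L u) (L v) := by
    intro u v
    have h1 : HasFDerivAt (fderiv ℝ φ) (-(((ContinuousLinearMap.compL ℝ E E E).flip L) ∘L b ∘L L))
        0 := by
      rw [hfd]
      have h2 := ((((ContinuousLinearMap.compL ℝ E E E).flip L) ∘L b ∘L L).hasFDerivAt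
        (x := (0 : E))).const_sub L
      exact h2
    rw [h1.fderiv]
    simp [hb]
  refine ⟨φ, hφ0, hsmooth, hL0, ?_⟩
  have hev : ∀ᶠ y in 𝓝 (0 : E), ContDiffAt ℝ ∞ φ y :=
    Eventually.of_forall fun y => hsmooth.contDiffAt
  have hg' : MetricAt g (φ 0) := by rwa [hφ0]
  have hH := hg'.pullback hev (by rw [hL0]; exact hL)
  ext u v w
  rw [chr_pullback hg' hH hev (Eventually.of_forall fun y u v => rfl), hS, hL0, hφ0, map_neg,
    _root_.neg_apply, hg.apply_chr2]
  simp

end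

end LocalGeometry

namespace LocalGeometry

open Filter Topology DoubleForms

/-! ### The curvature double form in a frame -/

variable {n : ℕ}

variable (n) in
/-- The standard orthonormal basis of Euclidean space. -/
abbrev stdBasis : OrthonormalBasis (Fin n) ℝ (EuclideanSpace ℝ (Fin n)) :=
  EuclideanSpace.basisFun (Fin n) ℝ

/-- The standard coframe of Euclidean space, in the exterior algebra. -/
def stdForm (i : Fin n) : Forms (EuclideanSpace ℝ (Fin n)) :=
  ExteriorAlgebra.ι ℝ (coframe (stdBasis n) i)

theorem coframe_stdBasis_apply (i : Fin n) (u : EuclideanSpace ℝ (Fin n)) :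
    coframe (stdBasis n) i u = u i := by
  simp [coframe, EuclideanSpace.basisFun_apply, EuclideanSpace.inner_single_left]

theorem pullForm_stdForm (A : EuclideanSpace ℝ (Fin n) →ₗ[ℝ] EuclideanSpace ℝ (Fin n))
    (i : Fin n) : pullForm A (stdForm i) = ∑ a, A (stdVec a) i • stdForm a := by
  rw [stdForm, pullForm_ι, ι_eq_sum_coframe (stdBasis n)]
  refine Finset.sum_congr rfl fun a _ => ?_
  rw [LinearMap.comp_apply, coframe_stdBasis_apply, EuclideanSpace.basisFun_apply]
  rfl

/-- The double form `¼ ∑ R(Aeₐ, Ae_b, Ae_c, Ae_d) (eᵃ ∧ eᵇ) ⊗ (eᶜ ∧ eᵈ)`, i.e. the pullback of the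
curvature double form of the metric `g` along the linear map `A`. -/
def curvForm (g : EuclideanSpace ℝ (Fin n) →
      EuclideanSpace ℝ (Fin n) →L[ℝ] EuclideanSpace ℝ (Fin n) →L[ℝ] ℝ)
    (y : EuclideanSpace ℝ (Fin n)) (A : EuclideanSpace ℝ (Fin n) →L[ℝ] EuclideanSpace ℝ (Fin n)) :
    DoubleForm (EuclideanSpace ℝ (Fin n)) :=
  (1 / 4 : ℝ) • ∑ a, ∑ b, ∑ c, ∑ d,
    curv g y (A (stdVec a)) (A (stdVec b)) (A (stdVec c)) (A (stdVec d)) •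
      ((stdForm a * stdForm b) ⊗ₜ[ℝ] (stdForm c * stdForm d))

theorem sum_rotate₄ {W : Type*} [AddCommMonoid W] (F : Fin n → Fin n → Fin n → Fin n → W) :
    ∑ a, ∑ b, ∑ c, ∑ d, F a b c d = ∑ d, ∑ a, ∑ b, ∑ c, F a b c d := by
  rw [Finset.sum_comm]
  conv_rhs => rw [Finset.sum_comm]
  rw [Finset.sum_comm]
  refine Finset.sum_congr rfl fun a _ => ?_
  conv_rhs => rw [Finset.sum_comm]
  exact Finset.sum_congr rfl fun b _ => Finset.sum_comm

theorem sum_rotate₃ {W : Type*} [AddCommMonoid W] (F : Fin n → Fin n → Fin n → W) :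
    ∑ a, ∑ b, ∑ c, F a b c = ∑ c, ∑ a, ∑ b, F a b c := by
  conv_rhs => rw [Finset.sum_comm]
  exact Finset.sum_congr rfl fun b _ => Finset.sum_comm

/-- A frame may be moved from vectors to covectors in one argument of a tensor. -/
theorem sum_frame_transfer {W : Type*} [AddCommGroup W] [Module ℝ W]
    (A : EuclideanSpace ℝ (Fin n) →L[ℝ] EuclideanSpace ℝ (Fin n))
    (q : EuclideanSpace ℝ (Fin n) → ℝ)
    (hq : ∀ a : Fin n → ℝ, q (∑ i, a i • stdVec i) = ∑ i, a i * q (stdVec i))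
    {T : Forms (EuclideanSpace ℝ (Fin n)) → W} (hT : IsLinearMap ℝ T) :
    ∑ d, q (A (stdVec d)) • T (stdForm d) =
      ∑ l, q (stdVec l) • T (pullForm A.toLinearMap (stdForm l)) := by
  have h1 : ∀ d, q (A (stdVec d)) = ∑ l, A (stdVec d) l * q (stdVec l) := fun d => by
    conv_lhs => rw [eq_sum_stdVec (A (stdVec d)), hq]
  have h2 : ∀ l, T (pullForm A.toLinearMap (stdForm l)) =
      ∑ a, A (stdVec a) l • T (stdForm a) := fun l => by
    rw [pullForm_stdForm]
    exact (map_sum hT.mk' _ _).trans (Finset.sum_congr rfl fun a _ => hT.map_smul _ _)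
  simp only [h1, h2, Finset.sum_smul, Finset.smul_sum]
  rw [Finset.sum_comm]
  refine Finset.sum_congr rfl fun l _ => Finset.sum_congr rfl fun d _ => ?_
  rw [smul_smul, mul_comm]

set_option maxHeartbeats 1000000 in
/-- The frame may be moved from the arguments of the curvature to the forms, so that it enters
through products of 1-forms only. -/
theorem curvForm_eq_sum_pullForm (g : EuclideanSpace ℝ (Fin n) →
      EuclideanSpace ℝ (Fin n) →L[ℝ] EuclideanSpace ℝ (Fin n) →L[ℝ] ℝ)
    (y : EuclideanSpace ℝ (Fin n))
    (A : EuclideanSpace ℝ (Fin n) →L[ℝ] EuclideanSpace ℝ (Fin n)) :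
    curvForm g y A = (1 / 4 : ℝ) • ∑ i, ∑ j, ∑ k, ∑ l,
      curv g y (stdVec i) (stdVec j) (stdVec k) (stdVec l) •
        ((pullForm A.toLinearMap (stdForm i) * pullForm A.toLinearMap (stdForm j)) ⊗ₜ[ℝ]
          (pullForm A.toLinearMap (stdForm k) * pullForm A.toLinearMap (stdForm l))) := by
  rw [curvForm]
  congr 1
  have h4 : ∀ a b c, ∑ d, curv g y (A (stdVec a)) (A (stdVec b)) (A (stdVec c)) (A (stdVec d)) •
      ((stdForm a * stdForm b) ⊗ₜ[ℝ] (stdForm c * stdForm d)) = ∑ l,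
      curv g y (A (stdVec a)) (A (stdVec b)) (A (stdVec c)) (stdVec l) •
      ((stdForm a * stdForm b) ⊗ₜ[ℝ] (stdForm c * pullForm A.toLinearMap (stdForm l))) :=
    fun a b c => sum_frame_transfer A
      (fun v => curv g y (A (stdVec a)) (A (stdVec b)) (A (stdVec c)) v)
      (fun s => curv_sum₄ _ _ _ _ _ _)
      (T := fun α => (stdForm a * stdForm b) ⊗ₜ[ℝ] (stdForm c * α))
      ⟨fun α β => by rw [mul_add, TensorProduct.tmul_add],
        fun r α => by rw [mul_smul_comm, TensorProduct.tmul_smul]⟩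
  simp only [h4]
  rw [sum_rotate₄]
  have h3 : ∀ l a b, ∑ c, curv g y (A (stdVec a)) (A (stdVec b)) (A (stdVec c)) (stdVec l) •
      ((stdForm a * stdForm b) ⊗ₜ[ℝ] (stdForm c * pullForm A.toLinearMap (stdForm l))) = ∑ k,
      curv g y (A (stdVec a)) (A (stdVec b)) (stdVec k) (stdVec l) •
      ((stdForm a * stdForm b) ⊗ₜ[ℝ] (pullForm A.toLinearMap (stdForm k) *
        pullForm A.toLinearMap (stdForm l))) :=
    fun l a b => sum_frame_transfer A
      (fun v => curv g y (A (stdVec a)) (A (stdVec b)) v (stdVec l))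
      (fun s => curv_sum₃ _ _ _ _ _ _)
      (T := fun α => (stdForm a * stdForm b) ⊗ₜ[ℝ] (α * pullForm A.toLinearMap (stdForm l)))
      ⟨fun α β => by rw [add_mul, TensorProduct.tmul_add],
        fun r α => by rw [smul_mul_assoc, TensorProduct.tmul_smul]⟩
  simp only [h3]
  rw [sum_rotate₄]
  have h2 : ∀ k l a, ∑ b, curv g y (A (stdVec a)) (A (stdVec b)) (stdVec k) (stdVec l) •
      ((stdForm a * stdForm b) ⊗ₜ[ℝ] (pullForm A.toLinearMap (stdForm k) *
        pullForm A.toLinearMap (stdForm l))) = ∑ j,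
      curv g y (A (stdVec a)) (stdVec j) (stdVec k) (stdVec l) •
      ((stdForm a * pullForm A.toLinearMap (stdForm j)) ⊗ₜ[ℝ] (pullForm A.toLinearMap (stdForm k) *
        pullForm A.toLinearMap (stdForm l))) :=
    fun k l a => sum_frame_transfer A
      (fun v => curv g y (A (stdVec a)) v (stdVec k) (stdVec l))
      (fun s => curv_sum₂ _ _ _ _ _ _)
      (T := fun α => (stdForm a * α) ⊗ₜ[ℝ] (pullForm A.toLinearMap (stdForm k) *
        pullForm A.toLinearMap (stdForm l)))
      ⟨fun α β => by rw [mul_add, TensorProduct.add_tmul],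
        fun r α => by rw [mul_smul_comm, TensorProduct.smul_tmul']⟩
  simp only [h2]
  rw [sum_rotate₄]
  have h1 : ∀ j k l, ∑ a, curv g y (A (stdVec a)) (stdVec j) (stdVec k) (stdVec l) •
      ((stdForm a * pullForm A.toLinearMap (stdForm j)) ⊗ₜ[ℝ] (pullForm A.toLinearMap (stdForm k) *
        pullForm A.toLinearMap (stdForm l))) = ∑ i,
      curv g y (stdVec i) (stdVec j) (stdVec k) (stdVec l) •
      ((pullForm A.toLinearMap (stdForm i) * pullForm A.toLinearMap (stdForm j)) ⊗ₜ[ℝ]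
        (pullForm A.toLinearMap (stdForm k) * pullForm A.toLinearMap (stdForm l))) :=
    fun j k l => sum_frame_transfer A
      (fun v => curv g y v (stdVec j) (stdVec k) (stdVec l))
      (fun s => curv_sum₁ _ _ _ _ _ _)
      (T := fun α => (α * pullForm A.toLinearMap (stdForm j)) ⊗ₜ[ℝ]
        (pullForm A.toLinearMap (stdForm k) * pullForm A.toLinearMap (stdForm l)))
      ⟨fun α β => by rw [add_mul, TensorProduct.add_tmul],
        fun r α => by rw [smul_mul_assoc, TensorProduct.smul_tmul']⟩
  simp only [h1]
  rw [sum_rotate₄]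

/-! ### Symmetries of the curvature double form -/

theorem curvForm_mem_bidegree (g : EuclideanSpace ℝ (Fin n) →
      EuclideanSpace ℝ (Fin n) →L[ℝ] EuclideanSpace ℝ (Fin n) →L[ℝ] ℝ)
    (y : EuclideanSpace ℝ (Fin n))
    (A : EuclideanSpace ℝ (Fin n) →L[ℝ] EuclideanSpace ℝ (Fin n)) :
    curvForm g y A ∈ bidegree (EuclideanSpace ℝ (Fin n)) 2 2 := by
  have h : ∀ a b : Fin n, stdForm a * stdForm b ∈
      ⋀[ℝ]^2 (Module.Dual ℝ (EuclideanSpace ℝ (Fin n))) := by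
    intro a b
    rw [ExteriorAlgebra.exteriorPower, pow_two]
    exact Submodule.mul_mem_mul (LinearMap.mem_range_self _ _) (LinearMap.mem_range_self _ _)
  exact Submodule.smul_mem _ _ (Submodule.sum_mem _ fun a _ => Submodule.sum_mem _ fun b _ =>
    Submodule.sum_mem _ fun c _ => Submodule.sum_mem _ fun d _ => Submodule.smul_mem _ _
      (tmul_mem_bidegree (h a b) (h c d)))

/-- Products of two 1-forms are central in the exterior algebra. -/
theorem ι_mul_ι_mul_comm {V : Type*} [NormedAddCommGroup V] [InnerProductSpace ℝ V]
    [FiniteDimensional ℝ V] (f h : Module.Dual ℝ V) (x : Forms V) :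
    ExteriorAlgebra.ι ℝ f * ExteriorAlgebra.ι ℝ h * x =
      x * (ExteriorAlgebra.ι ℝ f * ExteriorAlgebra.ι ℝ h) := by
  have sw : ∀ a b : Module.Dual ℝ V, ExteriorAlgebra.ι ℝ a * ExteriorAlgebra.ι ℝ b =
      -(ExteriorAlgebra.ι ℝ b * ExteriorAlgebra.ι ℝ a) := fun a b =>
    eq_neg_of_add_eq_zero_left (ExteriorAlgebra.ι_add_mul_swap (R := ℝ) a b)
  induction x using forms_induction with
  | one => rw [mul_one, one_mul]
  | add x y hx hy => rw [mul_add, add_mul, hx, hy]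
  | smul r x hx => rw [mul_smul_comm, smul_mul_assoc, hx]
  | ι_mul k x hx =>
    rw [mul_assoc (ExteriorAlgebra.ι ℝ k), ← hx, ← mul_assoc, mul_assoc _ _ (ExteriorAlgebra.ι ℝ k),
      sw h k, mul_neg, ← mul_assoc, sw f k]
    simp only [mul_assoc, neg_mul, neg_neg]

/-- The curvature double form is central, since it is built from products of two 1-forms. -/
theorem curvForm_mul_comm (g : EuclideanSpace ℝ (Fin n) →
      EuclideanSpace ℝ (Fin n) →L[ℝ] EuclideanSpace ℝ (Fin n) →L[ℝ] ℝ)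
    (y : EuclideanSpace ℝ (Fin n))
    (A : EuclideanSpace ℝ (Fin n) →L[ℝ] EuclideanSpace ℝ (Fin n))
    (w : DoubleForm (EuclideanSpace ℝ (Fin n))) :
    curvForm g y A * w = w * curvForm g y A := by
  rw [curvForm, smul_mul_assoc, mul_smul_comm]
  congr 1
  simp only [Finset.sum_mul, Finset.mul_sum]
  refine Finset.sum_congr rfl fun a _ => Finset.sum_congr rfl fun b _ =>
    Finset.sum_congr rfl fun c _ => Finset.sum_congr rfl fun d _ => ?_
  rw [smul_mul_assoc, mul_smul_comm]
  congr 1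
  induction w using TensorProduct.induction_on with
  | zero => simp
  | add x y hx hy => rw [mul_add, add_mul, hx, hy]
  | tmul α β =>
    rw [Algebra.TensorProduct.tmul_mul_tmul, Algebra.TensorProduct.tmul_mul_tmul, stdForm, stdForm,
      stdForm, stdForm, ι_mul_ι_mul_comm, ι_mul_ι_mul_comm]

theorem transpose_curvForm {g : EuclideanSpace ℝ (Fin n) →
      EuclideanSpace ℝ (Fin n) →L[ℝ] EuclideanSpace ℝ (Fin n) →L[ℝ] ℝ}
    {y : EuclideanSpace ℝ (Fin n)} (hg : MetricAt g y)
    (A : EuclideanSpace ℝ (Fin n) →L[ℝ] EuclideanSpace ℝ (Fin n)) :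
    transpose _ (curvForm g y A) = curvForm g y A := by
  simp only [curvForm, map_smul, map_sum, transpose_tmul]
  rw [sum_rotate₄, sum_rotate₄]
  refine congrArg _ ?_
  refine Finset.sum_congr rfl fun a _ => Finset.sum_congr rfl fun b _ =>
    Finset.sum_congr rfl fun c _ => Finset.sum_congr rfl fun d _ => ?_
  rw [hg.curv_pair_symm]

/-! ### The derivative of the curvature double form in normal coordinates -/

/-- In normal coordinates, and in a frame osculating the standard frame, the differential of the
curvature double form is the one of its components. -/
theorem hasDer_curvForm {H : EuclideanSpace ℝ (Fin n) →
      EuclideanSpace ℝ (Fin n) →L[ℝ] EuclideanSpace ℝ (Fin n) →L[ℝ] ℝ}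
    (hH : MetricAt H 0) (h0 : chr H 0 = 0)
    {A : EuclideanSpace ℝ (Fin n) → EuclideanSpace ℝ (Fin n) →L[ℝ] EuclideanSpace ℝ (Fin n)}
    (hA0 : A 0 = 1) (hA : HasFDerivAt A
      (0 : EuclideanSpace ℝ (Fin n) →L[ℝ] EuclideanSpace ℝ (Fin n) →L[ℝ] _) 0) :
    HasDer (fun y => curvForm H y (A y)) (fun v => (1 / 4 : ℝ) • ∑ a, ∑ b, ∑ c, ∑ d,
      fderiv ℝ (fun z => curv H z (stdVec a) (stdVec b) (stdVec c) (stdVec d)) 0 v •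
      ((stdForm a * stdForm b) ⊗ₜ[ℝ] (stdForm c * stdForm d))) 0 := by
  have hε : ∀ i, HasDer (fun y => pullForm (A y).toLinearMap (stdForm i))
      (fun _ => (0 : Forms (EuclideanSpace ℝ (Fin n)))) 0 := by
    intro i
    have h1 : ∀ a, HasFDerivAt (fun y => A y (stdVec a) i)
        (0 : EuclideanSpace ℝ (Fin n) →L[ℝ] ℝ) 0 := by
      intro a
      have := (EuclideanSpace.proj i : EuclideanSpace ℝ (Fin n) →L[ℝ] ℝ).hasFDerivAt.comp
        (0 : EuclideanSpace ℝ (Fin n)) (hA.clm_apply (hasFDerivAt_const (stdVec a) 0))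
      refine this.congr_fderiv ?_
      ext; simp
    have h2 := HasDer.sum Finset.univ fun a _ => HasDer.smul_const (h1 a) (stdForm (n := n) a)
    have h3 : (fun y => pullForm (A y).toLinearMap (stdForm i)) =
        fun y => ∑ a, A y (stdVec a) i • stdForm a := funext fun y => pullForm_stdForm _ _
    rw [h3]
    exact h2.congr_deriv fun v => by simp
  have hε0 : ∀ i, pullForm (A 0).toLinearMap (stdForm i) = stdForm i := by
    intro i
    rw [pullForm_stdForm, hA0, Finset.sum_eq_single i]
    · simp
    · intro a _ ha; simp [ha.symm]
    · simp
  have hc : ∀ a b c d, HasFDerivAt (fun z => curv H z (stdVec a) (stdVec b) (stdVec c) (stdVec d))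
      (fderiv ℝ (fun z => curv H z (stdVec a) (stdVec b) (stdVec c) (stdVec d)) 0) 0 := by
    intro a b c d
    obtain ⟨D, hD, -⟩ := hH.hasFDerivAt_curv h0 (stdVec a) (stdVec b) (stdVec c) (stdVec d)
    exact hD.differentiableAt.hasFDerivAt
  have h1 := (HasDer.sum Finset.univ fun a _ => HasDer.sum Finset.univ fun b _ =>
    HasDer.sum Finset.univ fun c _ => HasDer.sum Finset.univ fun d _ =>
      HasDer.smul (hc a b c d) (((hε a).mul (hε b)).bilin (TensorProduct.mk ℝ _ _)
        ((hε c).mul (hε d)))).linear (LinearMap.lsmul ℝ _ (1 / 4 : ℝ))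
  simp only [← curvForm_eq_sum_pullForm, LinearMap.lsmul_apply, TensorProduct.mk_apply] at h1
  refine h1.congr_deriv fun v => ?_
  simp [hε0]

/-- The second Bianchi identity for the curvature double form. -/
theorem sum_lform_mul_eq_zero {H : EuclideanSpace ℝ (Fin n) →
      EuclideanSpace ℝ (Fin n) →L[ℝ] EuclideanSpace ℝ (Fin n) →L[ℝ] ℝ}
    (hH : MetricAt H 0) (h0 : chr H 0 = 0) :
    ∑ m, lform (stdBasis n) m * ((1 / 4 : ℝ) • ∑ a, ∑ b, ∑ c, ∑ d,
      fderiv ℝ (fun z => curv H z (stdVec a) (stdVec b) (stdVec c) (stdVec d)) 0 (stdVec m) •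
      ((stdForm a * stdForm b) ⊗ₜ[ℝ] (stdForm c * stdForm d))) = 0 := by
  have key : ∀ t : Fin n → Fin n → Fin n → ℝ, (∀ m a b, t m a b + t a b m + t b m a = 0) →
      ∀ X : Forms (EuclideanSpace ℝ (Fin n)),
      ∑ m, ∑ a, ∑ b, t m a b • ((stdForm m * (stdForm a * stdForm b)) ⊗ₜ[ℝ] X) = 0 := by
    intro t ht X
    have hcyc : ∀ m a b : Fin n, stdForm a * (stdForm b * stdForm m) =
        stdForm m * (stdForm a * stdForm b) := fun m a b => by
      rw [← mul_assoc]; exact ι_mul_ι_mul_comm _ _ _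
    set S := ∑ m, ∑ a, ∑ b, t m a b • ((stdForm m * (stdForm a * stdForm b)) ⊗ₜ[ℝ] X) with hS
    have e1 : S = ∑ m, ∑ a, ∑ b, t a b m • ((stdForm m * (stdForm a * stdForm b)) ⊗ₜ[ℝ] X) := by
      rw [hS, sum_rotate₃]
      refine Finset.sum_congr rfl fun m _ => Finset.sum_congr rfl fun a _ =>
        Finset.sum_congr rfl fun b _ => ?_
      rw [hcyc]
    have e2 : S = ∑ m, ∑ a, ∑ b, t b m a • ((stdForm m * (stdForm a * stdForm b)) ⊗ₜ[ℝ] X) := by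
      rw [e1, sum_rotate₃]
      refine Finset.sum_congr rfl fun m _ => Finset.sum_congr rfl fun a _ =>
        Finset.sum_congr rfl fun b _ => ?_
      rw [hcyc]
    have e3 : S + S + S = 0 := by
      nth_rewrite 2 [e1]
      nth_rewrite 2 [e2]
      rw [hS]
      simp only [← Finset.sum_add_distrib, ← add_smul, ht, zero_smul, Finset.sum_const_zero]
    have e4 : (3 : ℝ) • S = 0 := by
      rw [← e3]; module
    exact (smul_eq_zero.mp e4).resolve_left (by norm_num)
  simp only [mul_smul_comm, ← Finset.smul_sum]
  refine (smul_eq_zero.mpr (Or.inr ?_))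
  simp only [Finset.mul_sum, mul_smul_comm, lform_mul_tmul]
  have hr : ∀ F : Fin n → Fin n → Fin n → Fin n → Fin n →
      DoubleForm (EuclideanSpace ℝ (Fin n)), ∑ m, ∑ a, ∑ b, ∑ c, ∑ d, F m a b c d =
      ∑ c, ∑ d, ∑ m, ∑ a, ∑ b, F m a b c d := by
    intro F
    have e1 : ∀ m, ∑ a, ∑ b, ∑ c, ∑ d, F m a b c d = ∑ c, ∑ d, ∑ a, ∑ b, F m a b c d :=
      fun m => by rw [sum_rotate₄, sum_rotate₄]
    simp only [e1]
    rw [Finset.sum_comm]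
    exact Finset.sum_congr rfl fun c _ => Finset.sum_comm
  rw [hr]
  refine Finset.sum_eq_zero fun c _ => Finset.sum_eq_zero fun d _ => ?_
  exact key (fun m a b => fderiv ℝ (fun z => curv H z (stdVec a) (stdVec b) (stdVec c) (stdVec d)) 0
    (stdVec m)) (fun m a b => hH.bianchi h0 _ _ _ _ _) _

end LocalGeometry

namespace LocalGeometry

open Filter Topology DoubleForms

variable {n : ℕ}

/-! ### Stationarity of the norm in a chart -/

variable (n) in
/-- The composition product as a bilinear map. -/
def compBilin : DoubleForm (EuclideanSpace ℝ (Fin n)) →ₗ[ℝ]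
    DoubleForm (EuclideanSpace ℝ (Fin n)) →ₗ[ℝ] DoubleForm (EuclideanSpace ℝ (Fin n)) :=
  LinearMap.lTensorHom (Forms (EuclideanSpace ℝ (Fin n))) ∘ₗ toEnd _

/-- The hyper and the weak `(2k)`-Einstein condition on a double form `T`, standing for `R^k`; the
number `s` stands for `‖R^k‖²`. -/
def EinsteinAt (k : ℕ) (T : DoubleForm (EuclideanSpace ℝ (Fin n))) (s : ℝ) : Prop :=
  (∃ lam : ℝ, contraction _ T = lam • metricD _ ^ (2 * k - 1)) ∧
    (1 / ((2 * k - 1).factorial : ℝ)) • (contraction _ ^ (2 * k - 1)) (comp _ T T) =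
      ((2 * k : ℝ) / n * s) • metricD _

/-- The infinitesimal form of the theorem along a family `T` of double forms with the symmetries of
`R^k` which satisfies the second Bianchi identity at the origin. -/
theorem hasFDerivAt_zero_of_einsteinAt {k : ℕ} (hk : 1 ≤ k) (hn : 2 * k < n) (hn' : n ≠ 4 * k)
    {T : EuclideanSpace ℝ (Fin n) → DoubleForm (EuclideanSpace ℝ (Fin n))}
    {T' : EuclideanSpace ℝ (Fin n) → DoubleForm (EuclideanSpace ℝ (Fin n))}
    (hT : HasDer T T' 0) (hdeg : ∀ y, T y ∈ bidegree _ (2 * k) (2 * k))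
    (hσ : ∀ᶠ y in 𝓝 0, transpose _ (T y) = T y)
    (bianchi : ∑ i, lform (stdBasis n) i * T' (stdVec i) = 0)
    {F : EuclideanSpace ℝ (Fin n) → ℝ} (hE : ∀ᶠ y in 𝓝 0, EinsteinAt k (T y) (F y)) :
    HasFDerivAt F (0 : EuclideanSpace ℝ (Fin n) →L[ℝ] ℝ) 0 := by
  obtain ⟨k, rfl⟩ : ∃ k', k = k' + 1 := ⟨k - 1, by omega⟩
  have e1 : 2 * (k + 1) - 1 = 2 * k + 1 := by omega
  have e2 : (2 * ((k + 1 : ℕ) : ℝ)) = ((2 * k + 2 : ℕ) : ℝ) := by push_cast; ring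
  simp only [EinsteinAt, e1, e2] at hE
  have hdeg' : ∀ y, T y ∈ bidegree _ (2 * k + 2) (2 * k + 2) := hdeg
  have hN := hT.bilin (innerD (EuclideanSpace ℝ (Fin n))) hT
  obtain ⟨ψ, hψ, hψ'⟩ := hN.hasFDerivAt
  have hψ2 : ∀ v, ψ v = 2 * innerD _ (T 0) (T' v) := fun v => by
    rw [hψ', innerD_comm (T' v)]; ring
  have hFN : ∀ᶠ y in 𝓝 0, F y = innerD _ (T y) (T y) := by
    filter_upwards [hE, hσ] with y h1 h2
    exact eq_innerD_of_contraction_pow_comp (stdBasis n) (by omega) (hdeg' y) h2 h1.2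
  have hd' : ∀ v, T' v ∈ bidegree _ (2 * k + 2) (2 * k + 2) :=
    hT.mem_of_eventually_mem _ (Eventually.of_forall hdeg')
  have hσ' : ∀ v, transpose _ (T' v) = T' v := fun v =>
    (hT.linear (transpose _).toLinearMap).eq_of_eventuallyEq hT hσ v
  have hc' : ∀ v, ∃ a : ℝ, contraction _ (T' v) = a • metricD _ ^ (2 * k + 1) := by
    intro v
    have h1 := (hT.linear (contraction _)).mem_of_eventually_mem
      (Submodule.span ℝ {metricD (EuclideanSpace ℝ (Fin n)) ^ (2 * k + 1)}) (by
        filter_upwards [hE] with y hy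
        obtain ⟨a, ha⟩ := hy.1
        exact Submodule.mem_span_singleton.mpr ⟨a, ha.symm⟩) v
    obtain ⟨a, ha⟩ := Submodule.mem_span_singleton.mp h1
    exact ⟨a, ha.symm⟩
  choose a ha using hc'
  have hw : ∀ v, (1 / ((2 * k + 1).factorial : ℝ)) • (contraction _ ^ (2 * k + 1))
      (comp _ (T 0) (T' v) + comp _ (T' v) (T 0)) =
      (((2 * k + 2 : ℕ) : ℝ) / n * (2 * innerD _ (T 0) (T' v))) • metricD _ := by
    intro v
    have h1 := (hT.bilin (compBilin n) hT).linear
      ((1 / ((2 * k + 1).factorial : ℝ)) • contraction (EuclideanSpace ℝ (Fin n)) ^ (2 * k + 1))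
    have h2 := HasDer.smul_const (hψ.const_mul (((2 * k + 2 : ℕ) : ℝ) / n))
      (metricD (EuclideanSpace ℝ (Fin n)))
    have h3 := h1.eq_of_eventuallyEq h2 (by
      filter_upwards [hE, hFN] with y hy hy'
      rw [← hy']
      exact hy.2) v
    rw [add_comm (comp _ (T 0) (T' v))]
    refine h3.trans ?_
    rw [_root_.smul_apply, smul_eq_mul, hψ2]
  have key : ∀ j, innerD _ (T 0) (T' (stdVec j)) = 0 :=
    innerD_derivative_eq_zero (stdBasis n) (by omega) (by omega) (hdeg' 0)
      (fun i => hd' (stdVec i)) hσ.self_of_nhds (fun i => hσ' _) bianchi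
      (fun i => ha (stdVec i)) (fun i => hw (stdVec i))
  have hψ0 : ψ = 0 := by
    ext v
    rw [eq_sum_stdVec v, map_sum, map_sum]
    refine Finset.sum_congr rfl fun i _ => ?_
    rw [map_smul, hψ2, key]
    simp
  rw [← hψ0]
  exact hψ.congr_of_eventuallyEq hFN

/-- A map along which a metric pulls back to a nondegenerate form has an injective, hence surjective
differential. -/
theorem surjective_of_metricAt_pullMetric {E : Type*} [NormedAddCommGroup E] [NormedSpace ℝ E]
    [FiniteDimensional ℝ E] {g : E → E →L[ℝ] E →L[ℝ] ℝ} {φ : E → E} {y : E}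
    (h : MetricAt (pullMetric g φ) y) : Function.Surjective (fderiv ℝ φ y) := by
  have hinj : Function.Injective (fderiv ℝ φ y).toLinearMap := by
    refine (injective_iff_map_eq_zero (fderiv ℝ φ y).toLinearMap).mpr fun u hu => ?_
    refine h.eq_of_apply_eq fun w => ?_
    have hu' : fderiv ℝ φ y u = 0 := hu
    rw [pullMetric_apply, hu', map_zero, map_zero]
    rfl
  exact LinearMap.injective_iff_surjective.mp hinj

/-- If the curvature of a metric satisfies both Einstein conditions in all orthonormal frames at all
points near `z`, then the square norm of `R^k` is stationary at `z`. -/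
theorem hasFDerivAt_zero_of_curvForm {k : ℕ} (hk : 1 ≤ k) (hn : 2 * k < n) (hn' : n ≠ 4 * k)
    {g : EuclideanSpace ℝ (Fin n) →
      EuclideanSpace ℝ (Fin n) →L[ℝ] EuclideanSpace ℝ (Fin n) →L[ℝ] ℝ}
    {z : EuclideanSpace ℝ (Fin n)} (hg : MetricAt g z)
    (L : EuclideanSpace ℝ (Fin n) ≃L[ℝ] EuclideanSpace ℝ (Fin n))
    (hL : ∀ u v, g z (L u) (L v) = ⟪u, v⟫_ℝ)
    {F : EuclideanSpace ℝ (Fin n) → ℝ}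
    (hE : ∀ᶠ w in 𝓝 z, ∀ A : EuclideanSpace ℝ (Fin n) →L[ℝ] EuclideanSpace ℝ (Fin n),
      (∀ u v, g w (A u) (A v) = ⟪u, v⟫_ℝ) → EinsteinAt k (curvForm g w A ^ k) (F w)) :
    HasFDerivAt F (0 : EuclideanSpace ℝ (Fin n) →L[ℝ] ℝ) z := by
  obtain ⟨φ, hφ0, hφs, hφL, hch⟩ := exists_normal_coordinates hg
    (L : EuclideanSpace ℝ (Fin n) →L[ℝ] EuclideanSpace ℝ (Fin n)) L.bijective
  have hev : ∀ᶠ y in 𝓝 (0 : EuclideanSpace ℝ (Fin n)), ContDiffAt ℝ ∞ φ y :=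
    Eventually.of_forall fun y => hφs.contDiffAt
  have hg' : MetricAt g (φ 0) := by rwa [hφ0]
  have hH : MetricAt (pullMetric g φ) 0 := hg'.pullback hev (by rw [hφL]; exact L.bijective)
  have hHd : HasFDerivAt (pullMetric g φ) (0 : EuclideanSpace ℝ (Fin n) →L[ℝ]
      EuclideanSpace ℝ (Fin n) →L[ℝ] EuclideanSpace ℝ (Fin n) →L[ℝ] ℝ) 0 := by
    have h1 : fderiv ℝ (pullMetric g φ) 0 = 0 := by
      ext w u v
      rw [hH.fderiv_eq, hch]
      simp
    rw [← h1]
    exact hH.hasFDerivAt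
  obtain ⟨A, hA0, hAd, hAo⟩ := exists_orthonormal_frame
    (fun u v => by rw [pullMetric_apply, hφ0, hφL]; exact hL u v) hHd hH.symm
  have hR := hasDer_curvForm hH hch hA0 hAd
  have hφc : Tendsto φ (𝓝 0) (𝓝 z) := by
    have := hφs.continuous.tendsto 0
    rwa [hφ0] at this
  obtain ⟨k', rfl⟩ : ∃ k', k = k' + 1 := ⟨k - 1, by omega⟩
  have hFφ : HasFDerivAt (fun y => F (φ y)) (0 : EuclideanSpace ℝ (Fin n) →L[ℝ] ℝ) 0 := by
    refine hasFDerivAt_zero_of_einsteinAt hk hn hn'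
      (hR.pow (fun w => curvForm_mul_comm _ _ _ w) k')
      (fun y => pow_mem_bidegree (curvForm_mem_bidegree _ _ _) _) ?_ ?_ ?_
    · filter_upwards [hH.eventually] with y hy
      rw [map_pow, transpose_curvForm hy]
    · have hcomm : ∀ i, lform (stdBasis n) i * curvForm (pullMetric g φ) 0 (A 0) ^ k' =
          curvForm (pullMetric g φ) 0 (A 0) ^ k' * lform (stdBasis n) i := fun i =>
        ((show Commute (curvForm (pullMetric g φ) 0 (A 0)) (lform (stdBasis n) i) from
          curvForm_mul_comm _ _ _ _).pow_left k').eq.symm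
      simp only [mul_smul_comm (_ : ℝ) (lform _ _) (_ ^ k' * _), ← mul_assoc, hcomm]
      simp only [mul_assoc, ← Finset.smul_sum (r := ((k' : ℝ) + 1)), ← Finset.mul_sum]
      rw [sum_lform_mul_eq_zero hH hch, mul_zero, smul_zero]
    · filter_upwards [hφc.eventually hE, hφc.eventually hg.eventually, hH.eventually, hAo]
        with y h1 h2 h3 h4
      have hsurj := surjective_of_metricAt_pullMetric h3
      have hc : curvForm (pullMetric g φ) y (A y) = curvForm g (φ y) (fderiv ℝ φ y ∘L A y) := by
        have : ∀ u v k l, curv (pullMetric g φ) y u v k l = curv g (φ y) (fderiv ℝ φ y u)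
            (fderiv ℝ φ y v) (fderiv ℝ φ y k) (fderiv ℝ φ y l) :=
          curv_pullback h2 h3 (Eventually.of_forall fun _ => hφs.contDiffAt)
            (Eventually.of_forall fun _ _ _ => rfl) hsurj
        simp only [curvForm, this]
        rfl
      rw [hc]
      exact h1 _ fun u v => h4 u v
  -- The statement is transported back by the local inverse of `φ`.
  have hstrict : HasStrictFDerivAt φ (L : EuclideanSpace ℝ (Fin n) →L[ℝ] _) 0 := by
    rw [← hφL]
    exact hφs.contDiffAt.hasStrictFDerivAt (by simp)
  have h1 := hstrict.to_localInverse.hasFDerivAt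
  have h2 := hstrict.eventually_right_inverse
  have h3 := hstrict.localInverse_apply_image
  rw [hφ0] at h1 h2 h3
  have h4 : HasFDerivAt (fun y => F (φ y)) (0 : EuclideanSpace ℝ (Fin n) →L[ℝ] ℝ)
      (hstrict.localInverse _ _ _ z) := by rw [h3]; exact hFφ
  have h5 := h4.comp z h1
  rw [ContinuousLinearMap.zero_comp] at h5
  refine h5.congr_of_eventuallyEq ?_
  filter_upwards [h2] with w hw
  simp only [Function.comp_apply, hw]

end LocalGeometry

namespace LocalGeometry

open Filter Topology DoubleForms

/-! ### The curvature tensor in an arbitrary chart -/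

variable {n : ℕ}

theorem sum_eq_two_smul_sum_Ioi {W : Type*} [AddCommGroup W] [Module ℝ W]
    (F : Fin n → Fin n → W) (hs : ∀ i j, F i j = F j i) (hd : ∀ i, F i i = 0) :
    ∑ i, ∑ j, F i j = (2 : ℝ) • ∑ i, ∑ j ∈ Finset.Ioi i, F i j := by
  have h1 := Finset.sum_sum_Ioi_add_eq_sum_sum_off_diag F
  have h2 : ∀ i, ∑ j ∈ ({i} : Finset (Fin n))ᶜ, F j i = ∑ j, F i j := fun i => by
    rw [← Finset.sum_compl_add_sum {i}]
    simp only [Finset.sum_singleton, hd, add_zero]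
    exact Finset.sum_congr rfl fun j _ => hs _ _
  simp only [h2] at h1
  rw [← h1, Finset.smul_sum]
  refine Finset.sum_congr rfl fun i _ => ?_
  rw [Finset.smul_sum]
  refine Finset.sum_congr rfl fun j _ => ?_
  rw [hs j i, two_smul]

/-- A sum over ordered pairs of indices is a quarter of the sum over all indices. -/
theorem sum_Ioi_eq_sum {V : Type*} [NormedAddCommGroup V] [InnerProductSpace ℝ V]
    (c : Fin n → Fin n → Fin n → Fin n → ℝ) (h₁ : ∀ i j k l, c i j k l = -c j i k l)
    (h₂ : ∀ i j k l, c i j k l = -c i j l k) (f : Fin n → Module.Dual ℝ V) :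
    ∑ i, ∑ j ∈ Finset.Ioi i, ∑ k, ∑ l ∈ Finset.Ioi k, c i j k l •
      ((ExteriorAlgebra.ι ℝ (f i) * ExteriorAlgebra.ι ℝ (f j)) ⊗ₜ[ℝ]
        (ExteriorAlgebra.ι ℝ (f k) * ExteriorAlgebra.ι ℝ (f l)) : DoubleForm V) =
    (1 / 4 : ℝ) • ∑ i, ∑ j, ∑ k, ∑ l, c i j k l •
      ((ExteriorAlgebra.ι ℝ (f i) * ExteriorAlgebra.ι ℝ (f j)) ⊗ₜ[ℝ]
        (ExteriorAlgebra.ι ℝ (f k) * ExteriorAlgebra.ι ℝ (f l)) : DoubleForm V) := by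
  have sw : ∀ i j, ExteriorAlgebra.ι ℝ (f i) * ExteriorAlgebra.ι ℝ (f j) =
      -(ExteriorAlgebra.ι ℝ (f j) * ExteriorAlgebra.ι ℝ (f i)) := fun i j =>
    eq_neg_of_add_eq_zero_left (ExteriorAlgebra.ι_add_mul_swap _ _)
  have h4 : ∀ i j, ∑ k, ∑ l, c i j k l •
      ((ExteriorAlgebra.ι ℝ (f i) * ExteriorAlgebra.ι ℝ (f j)) ⊗ₜ[ℝ]
        (ExteriorAlgebra.ι ℝ (f k) * ExteriorAlgebra.ι ℝ (f l)) : DoubleForm V) = _ :=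
    fun i j => sum_eq_two_smul_sum_Ioi _
      (fun k l => by rw [h₂, sw k l, TensorProduct.tmul_neg, neg_smul, smul_neg, neg_neg])
      (fun k => by rw [ExteriorAlgebra.ι_sq_zero, TensorProduct.tmul_zero, smul_zero])
  simp only [h4]
  rw [sum_eq_two_smul_sum_Ioi (fun i j => (2 : ℝ) • ∑ k, ∑ l ∈ Finset.Ioi k, c i j k l •
      ((ExteriorAlgebra.ι ℝ (f i) * ExteriorAlgebra.ι ℝ (f j)) ⊗ₜ[ℝ]
        (ExteriorAlgebra.ι ℝ (f k) * ExteriorAlgebra.ι ℝ (f l)) : DoubleForm V))]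
  · simp only [← Finset.smul_sum (r := (2 : ℝ)), smul_smul]
    norm_num
  · intro i j
    congr 1
    refine Finset.sum_congr rfl fun k _ => Finset.sum_congr rfl fun l _ => ?_
    rw [h₁, sw i j, TensorProduct.neg_tmul, neg_smul, smul_neg, neg_neg]
  · intro i
    simp only [ExteriorAlgebra.ι_sq_zero, TensorProduct.zero_tmul, smul_zero,
      Finset.sum_const_zero]

variable {M : Type*} [TopologicalSpace M] [ChartedSpace (EuclideanSpace ℝ (Fin n)) M]

/-- The differential of the inverse of the preferred chart at `x`. The tangent spaces of `M` are
identified with Euclidean space, as they are by definition. -/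
def chartDiff (x : M) (w : EuclideanSpace ℝ (Fin n)) :
    EuclideanSpace ℝ (Fin n) →L[ℝ] EuclideanSpace ℝ (Fin n) :=
  mfderiv 𝓘(ℝ, EuclideanSpace ℝ (Fin n)) (𝓡 n) (extChartAt (𝓡 n) x).symm w

section

variable [Bundle.RiemannianBundle (fun x : M => TangentSpace (𝓡 n) x)]

/-- The Riemannian metric at `p`, on the Euclidean space underlying the tangent space. -/
def metricInner (p : M) (a b : EuclideanSpace ℝ (Fin n)) : ℝ :=
  inner ℝ (show TangentSpace (𝓡 n) p from a) (show TangentSpace (𝓡 n) p from b)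

/-- The Riemannian metric in the preferred chart at `x`. -/
def chartMetric (x : M) (w : EuclideanSpace ℝ (Fin n)) :
    EuclideanSpace ℝ (Fin n) →L[ℝ] EuclideanSpace ℝ (Fin n) →L[ℝ] ℝ :=
  toBil (Curvature.metricCoeff n x w)

theorem metricInner_comm (p : M) (a b : EuclideanSpace ℝ (Fin n)) :
    metricInner p a b = metricInner p b a :=
  real_inner_comm _ _

theorem metricInner_sum_left (p : M) (c : Fin n → ℝ) (a : Fin n → EuclideanSpace ℝ (Fin n))
    (b : EuclideanSpace ℝ (Fin n)) :
    metricInner p (∑ i, c i • a i) b = ∑ i, c i * metricInner p (a i) b := by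
  refine (sum_inner (𝕜 := ℝ) (E := TangentSpace (𝓡 n) p) _ _ _).trans ?_
  exact Finset.sum_congr rfl fun i _ =>
    real_inner_smul_left (F := TangentSpace (𝓡 n) p) _ _ _

theorem metricInner_sum_right (p : M) (c : Fin n → ℝ) (a : EuclideanSpace ℝ (Fin n))
    (b : Fin n → EuclideanSpace ℝ (Fin n)) :
    metricInner p a (∑ i, c i • b i) = ∑ i, c i * metricInner p a (b i) := by
  rw [metricInner_comm, metricInner_sum_left]
  exact Finset.sum_congr rfl fun i _ => by rw [metricInner_comm]

theorem chartMetric_apply (x : M) (w u v : EuclideanSpace ℝ (Fin n)) :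
    chartMetric x w u v =
      metricInner ((extChartAt (𝓡 n) x).symm w) (chartDiff x w u) (chartDiff x w v) := by
  conv_rhs => rw [eq_sum_stdVec u, eq_sum_stdVec v, map_sum, map_sum]
  simp only [map_smul]
  rw [metricInner_sum_left, chartMetric, toBil_apply]
  refine Finset.sum_congr rfl fun i _ => ?_
  rw [metricInner_sum_right, Finset.mul_sum]
  refine Finset.sum_congr rfl fun j _ => ?_
  change metricInner ((extChartAt (𝓡 n) x).symm w) (chartDiff x w (stdVec i))
    (chartDiff x w (stdVec j)) * _ = _
  ring

end

variable [IsManifold (𝓡 n) ∞ M]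

theorem bijective_chartDiff {x : M} {w : EuclideanSpace ℝ (Fin n)}
    (hw : w ∈ (extChartAt (𝓡 n) x).target) : Function.Bijective (chartDiff x w) := by
  have : IsManifold (𝓡 n) 1 M := IsManifold.of_le (n := ∞) (by simp)
  have h := isInvertible_mfderivWithin_extChartAt_symm (I := 𝓡 n) hw
  rw [ModelWithCorners.range_eq_univ, mfderivWithin_univ] at h
  exact h.bijective

theorem contMDiffAt_symm {x : M} {w : EuclideanSpace ℝ (Fin n)}
    (hw : w ∈ (extChartAt (𝓡 n) x).target) :
    ContMDiffAt 𝓘(ℝ, EuclideanSpace ℝ (Fin n)) (𝓡 n) ∞ (extChartAt (𝓡 n) x).symm w :=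
  (contMDiffOn_extChartAt_symm x).contMDiffAt ((isOpen_extChartAt_target (I := 𝓡 n) x).mem_nhds hw)

variable [Bundle.RiemannianBundle (fun x : M => TangentSpace (𝓡 n) x)]
    [IsContMDiffRiemannianBundle (𝓡 n) ∞ (EuclideanSpace ℝ (Fin n))
      (fun x : M => TangentSpace (𝓡 n) x)]

/-- The coordinate vector fields are smooth sections of the tangent bundle, being values of the
tangent map of the inverse chart, so their inner products are smooth. -/
theorem contDiffAt_chartMetric {x : M} {w : EuclideanSpace ℝ (Fin n)}
    (hw : w ∈ (extChartAt (𝓡 n) x).target) : ContDiffAt ℝ ∞ (chartMetric x) w := by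
  have hsec : ∀ i, ContMDiffAt 𝓘(ℝ, EuclideanSpace ℝ (Fin n)) (𝓡 n).tangent ∞
      (fun z => (⟨(extChartAt (𝓡 n) x).symm z, Curvature.coordVector n x z i⟩ :
        TangentBundle (𝓡 n) M)) w := by
    intro i
    have : IsManifold (𝓡 n) 1 M := IsManifold.of_le (n := ∞) (by simp)
    have h1 := (contMDiffOn_extChartAt_symm (I := 𝓡 n) (n := ∞) x).contMDiffOn_tangentMapWithin
      (m := ∞) (by simp) (isOpen_extChartAt_target (I := 𝓡 n) x).uniqueMDiffOn
    have h2 : ContMDiffAt 𝓘(ℝ, EuclideanSpace ℝ (Fin n))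
        𝓘(ℝ, EuclideanSpace ℝ (Fin n)).tangent ∞
        (fun z => (⟨z, stdVec i⟩ : TangentBundle 𝓘(ℝ, EuclideanSpace ℝ (Fin n))
          (EuclideanSpace ℝ (Fin n)))) w :=
      contMDiffAt_vectorSpace_iff_contDiffAt.mpr contDiffAt_const
    have h3 := (h1.contMDiffAt (x := ⟨w, stdVec i⟩) ?_).comp w h2
    · refine h3.congr_of_eventuallyEq ?_
      filter_upwards [(isOpen_extChartAt_target (I := 𝓡 n) x).mem_nhds hw] with z hz
      simp only [Function.comp_apply, tangentMapWithin]
      rw [mfderivWithin_of_mem_nhds ((isOpen_extChartAt_target (I := 𝓡 n) x).mem_nhds hz)]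
      rfl
    · exact (FiberBundle.continuous_proj _ _).continuousAt.preimage_mem_nhds
        ((isOpen_extChartAt_target (I := 𝓡 n) x).mem_nhds hw)
  have hco : ∀ i j, ContDiffAt ℝ ∞ (fun z => Curvature.metricCoeff n x z i j) w := fun i j =>
    (ContMDiffAt.inner_bundle (hsec i) (hsec j)).contDiffAt
  unfold chartMetric toBil
  exact ContDiffAt.sum fun i _ => ContDiffAt.sum fun j _ => (hco i j).smul contDiffAt_const

theorem metricAt_chartMetric {x : M} {w : EuclideanSpace ℝ (Fin n)}
    (hw : w ∈ (extChartAt (𝓡 n) x).target) : MetricAt (chartMetric x) w := by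
  refine ⟨?_, Eventually.of_forall fun z u v => ?_, ?_⟩
  · filter_upwards [(isOpen_extChartAt_target (I := 𝓡 n) x).mem_nhds hw] with z hz
    exact contDiffAt_chartMetric hz
  · rw [chartMetric_apply, chartMetric_apply, metricInner_comm]
  · refine isInvertible_of_nondegenerate _ fun u hu => ?_
    have h := hu u
    rw [chartMetric_apply] at h
    have h0 : chartDiff x w u = 0 := inner_self_eq_zero (𝕜 := ℝ)
      (E := TangentSpace (𝓡 n) ((extChartAt (𝓡 n) x).symm w)).mp h
    exact (bijective_chartDiff hw).1 (h0.trans (map_zero _).symm)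

end LocalGeometry

namespace LocalGeometry

open Filter Topology DoubleForms

/-! ### Changes of coordinates -/

variable {n : ℕ} {M : Type*} [TopologicalSpace M] [ChartedSpace (EuclideanSpace ℝ (Fin n)) M]

/-- The change of coordinates from the preferred chart at `x` to the one at `p`. -/
def transition (x p : M) (w : EuclideanSpace ℝ (Fin n)) : EuclideanSpace ℝ (Fin n) :=
  extChartAt (𝓡 n) p ((extChartAt (𝓡 n) x).symm w)

variable [IsManifold (𝓡 n) ∞ M]

section

variable {x p : M} {w : EuclideanSpace ℝ (Fin n)}

theorem transition_mem_target (hp : (extChartAt (𝓡 n) x).symm w ∈ (extChartAt (𝓡 n) p).source) :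
    transition x p w ∈ (extChartAt (𝓡 n) p).target :=
  (extChartAt (𝓡 n) p).map_source hp

theorem contDiffAt_transition (hw : w ∈ (extChartAt (𝓡 n) x).target)
    (hp : (extChartAt (𝓡 n) x).symm w ∈ (extChartAt (𝓡 n) p).source) :
    ContDiffAt ℝ ∞ (transition x p) w := by
  rw [extChartAt_source] at hp
  exact ((contMDiffAt_extChartAt' (I := 𝓡 n) (n := ∞) hp).comp w
    (contMDiffAt_symm hw)).contDiffAt

theorem eventually_mem_source (hw : w ∈ (extChartAt (𝓡 n) x).target)
    (hp : (extChartAt (𝓡 n) x).symm w ∈ (extChartAt (𝓡 n) p).source) :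
    ∀ᶠ z in 𝓝 w, z ∈ (extChartAt (𝓡 n) x).target ∧
      (extChartAt (𝓡 n) x).symm z ∈ (extChartAt (𝓡 n) p).source :=
  Filter.Eventually.and ((isOpen_extChartAt_target (I := 𝓡 n) x).mem_nhds hw)
    ((contMDiffAt_symm hw).continuousAt.preimage_mem_nhds
      ((isOpen_extChartAt_source p).mem_nhds hp))

theorem chartDiff_eq_comp (hw : w ∈ (extChartAt (𝓡 n) x).target)
    (hp : (extChartAt (𝓡 n) x).symm w ∈ (extChartAt (𝓡 n) p).source)
    (u : EuclideanSpace ℝ (Fin n)) :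
    chartDiff x w u = chartDiff p (transition x p w) (fderiv ℝ (transition x p) w u) := by
  -- Near `w` the inverse chart at `x` factors through the chart at `p`.
  have h1 : (extChartAt (𝓡 n) x).symm =ᶠ[𝓝 w] (extChartAt (𝓡 n) p).symm ∘ transition x p := by
    filter_upwards [eventually_mem_source hw hp] with z hz
    exact ((extChartAt (𝓡 n) p).left_inv hz.2).symm
  have h2 := mfderiv_comp (I := 𝓘(ℝ, EuclideanSpace ℝ (Fin n)))
    (I' := 𝓘(ℝ, EuclideanSpace ℝ (Fin n))) (I'' := 𝓡 n) w
    ((contMDiffAt_symm (transition_mem_target hp)).mdifferentiableAt (by simp))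
    ((contDiffAt_transition hw hp).contMDiffAt.mdifferentiableAt (by simp))
  rw [mfderiv_eq_fderiv] at h2
  have h3 := h1.mfderiv_eq (I := 𝓘(ℝ, EuclideanSpace ℝ (Fin n))) (I' := 𝓡 n)
  exact DFunLike.congr_fun (h3.trans h2) u

theorem coordCovector_chartDiff (hw : w ∈ (extChartAt (𝓡 n) x).target) (i : Fin n)
    (u : EuclideanSpace ℝ (Fin n)) :
    Curvature.coordCovector n ((extChartAt (𝓡 n) x).symm w) i (chartDiff x w u) =
      fderiv ℝ (transition x ((extChartAt (𝓡 n) x).symm w)) w u i := by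
  have h2 := mfderiv_comp (I := 𝓘(ℝ, EuclideanSpace ℝ (Fin n)))
    (I' := 𝓡 n) (I'' := 𝓘(ℝ, EuclideanSpace ℝ (Fin n))) w
    ((contMDiffAt_extChartAt (I := 𝓡 n) (n := ∞)
      (x := (extChartAt (𝓡 n) x).symm w)).mdifferentiableAt (by simp))
    ((contMDiffAt_symm hw).mdifferentiableAt (by simp))
  have h3 : fderiv ℝ (transition x ((extChartAt (𝓡 n) x).symm w)) w = _ :=
    mfderiv_eq_fderiv.symm.trans h2
  rw [h3]
  rfl

theorem bijective_fderiv_transition (hw : w ∈ (extChartAt (𝓡 n) x).target)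
    (hp : (extChartAt (𝓡 n) x).symm w ∈ (extChartAt (𝓡 n) p).source) :
    Function.Bijective (fderiv ℝ (transition x p) w) := by
  have h1 := bijective_chartDiff hw
  have h2 := bijective_chartDiff (transition_mem_target hp)
  refine (Function.Bijective.of_comp_iff' h2 _).mp ?_
  convert h1 using 1
  funext u
  exact (chartDiff_eq_comp hw hp u).symm

end

variable [Bundle.RiemannianBundle (fun x : M => TangentSpace (𝓡 n) x)]
    [IsContMDiffRiemannianBundle (𝓡 n) ∞ (EuclideanSpace ℝ (Fin n))
      (fun x : M => TangentSpace (𝓡 n) x)]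

variable {x : M} {w : EuclideanSpace ℝ (Fin n)}

theorem chartMetric_transition {p : M} (hw : w ∈ (extChartAt (𝓡 n) x).target)
    (hp : (extChartAt (𝓡 n) x).symm w ∈ (extChartAt (𝓡 n) p).source)
    (u v : EuclideanSpace ℝ (Fin n)) :
    chartMetric x w u v = chartMetric p (transition x p w)
      (fderiv ℝ (transition x p) w u) (fderiv ℝ (transition x p) w v) := by
  rw [chartMetric_apply, chartMetric_apply, chartDiff_eq_comp hw hp, chartDiff_eq_comp hw hp,
    transition, (extChartAt (𝓡 n) p).left_inv hp]

theorem curv_transition {p : M} (hw : w ∈ (extChartAt (𝓡 n) x).target)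
    (hp : (extChartAt (𝓡 n) x).symm w ∈ (extChartAt (𝓡 n) p).source)
    (u v k l : EuclideanSpace ℝ (Fin n)) :
    curv (chartMetric x) w u v k l = curv (chartMetric p) (transition x p w)
      (fderiv ℝ (transition x p) w u) (fderiv ℝ (transition x p) w v)
      (fderiv ℝ (transition x p) w k) (fderiv ℝ (transition x p) w l) := by
  refine curv_pullback (metricAt_chartMetric (transition_mem_target hp)) (metricAt_chartMetric hw)
    ?_ ?_ (bijective_fderiv_transition hw hp).2 _ _ _ _
  · filter_upwards [eventually_mem_source hw hp] with z hz
      using contDiffAt_transition hz.1 hz.2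
  · filter_upwards [eventually_mem_source hw hp] with z hz
      using chartMetric_transition hz.1 hz.2

/-! ### Curvature and isometric frames -/

/-- The curvature double form at a point, pulled back to Euclidean space along an isometry `Λ`, is
the curvature double form in the frame which `Λ` defines in any chart around the point. -/
theorem isoPull_riemann (hw : w ∈ (extChartAt (𝓡 n) x).target) {p : M}
    (hp : (extChartAt (𝓡 n) x).symm w = p)
    (A : EuclideanSpace ℝ (Fin n) →L[ℝ] EuclideanSpace ℝ (Fin n))
    (Λ : EuclideanSpace ℝ (Fin n) ≃ₗᵢ[ℝ] TangentSpace (𝓡 n) p)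
    (hΛ : ∀ u, Λ u = chartDiff x w (A u)) :
    isoPull Λ (Curvature.riemann n p) = curvForm (chartMetric x) w A := by
  have hps : (extChartAt (𝓡 n) x).symm w ∈ (extChartAt (𝓡 n) p).source := by
    rw [hp]; exact mem_extChartAt_source p
  have hmet : MetricAt (chartMetric p) (extChartAt (𝓡 n) p p) :=
    metricAt_chartMetric (mem_extChartAt_target p)
  have h1 : curvForm (chartMetric x) w A =
      curvForm (chartMetric p) (extChartAt (𝓡 n) p p) (fderiv ℝ (transition x p) w ∘L A) := by
    simp only [curvForm, curv_transition hw hps, transition, hp]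
    rfl
  have h2 : Curvature.riemann n p = (1 / 4 : ℝ) • ∑ i, ∑ j, ∑ k, ∑ l,
      curv (chartMetric p) (extChartAt (𝓡 n) p p) (stdVec i) (stdVec j) (stdVec k) (stdVec l) •
      ((ExteriorAlgebra.ι ℝ (Curvature.coordCovector n p i).toLinearMap *
        ExteriorAlgebra.ι ℝ (Curvature.coordCovector n p j).toLinearMap) ⊗ₜ[ℝ]
        (ExteriorAlgebra.ι ℝ (Curvature.coordCovector n p k).toLinearMap *
        ExteriorAlgebra.ι ℝ (Curvature.coordCovector n p l).toLinearMap)) := by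
    rw [← sum_Ioi_eq_sum (fun i j k l => curv (chartMetric p) (extChartAt (𝓡 n) p p)
      (stdVec i) (stdVec j) (stdVec k) (stdVec l)) (fun i j k l => curv_antisymm _ _ _ _ _ _)
      (fun i j k l => hmet.curv_antisymm' _ _ _ _)]
    simp only [Curvature.riemann]
    refine Finset.sum_congr rfl fun i _ => Finset.sum_congr rfl fun j _ =>
      Finset.sum_congr rfl fun k _ => Finset.sum_congr rfl fun l _ => ?_
    congr 1
    exact riemannDown_eq_curv (G := Curvature.metricCoeff n p) hmet i j k l
  have h3 : ∀ i, pullForm Λ.toLinearEquiv.toLinearMap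
      (ExteriorAlgebra.ι ℝ (Curvature.coordCovector n p i).toLinearMap) =
      pullForm (fderiv ℝ (transition x p) w ∘L A).toLinearMap (stdForm i) := by
    intro i
    rw [stdForm, pullForm_ι, pullForm_ι]
    congr 1
    refine LinearMap.ext fun u => ?_
    rw [LinearMap.comp_apply, LinearMap.comp_apply, coframe_stdBasis_apply]
    change Curvature.coordCovector n p i (Λ u) = _
    rw [hΛ]
    subst hp
    exact coordCovector_chartDiff hw i (A u)
  rw [h1, curvForm_eq_sum_pullForm, h2]
  simp only [map_smul, map_sum, pullD_tmul, map_mul (pullForm _), h3]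

/-- An orthonormal frame in a chart is an isometry onto the tangent space. -/
theorem exists_isometry_of_frame
    (A : EuclideanSpace ℝ (Fin n) →L[ℝ] EuclideanSpace ℝ (Fin n))
    (hA : ∀ u v, chartMetric x w (A u) (A v) = ⟪u, v⟫_ℝ) :
    ∃ Λ : EuclideanSpace ℝ (Fin n) ≃ₗᵢ[ℝ] TangentSpace (𝓡 n) ((extChartAt (𝓡 n) x).symm w),
      ∀ u, Λ u = chartDiff x w (A u) := by
  let T := TangentSpace (𝓡 n) ((extChartAt (𝓡 n) x).symm w)
  let f : EuclideanSpace ℝ (Fin n) →ₗ[ℝ] T :=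
    { toFun := fun u => chartDiff x w (A u)
      map_add' := fun u v => by rw [map_add, map_add]; rfl
      map_smul' := fun r u => by rw [map_smul, map_smul]; rfl }
  have hf : ∀ u v, ⟪f u, f v⟫_ℝ = ⟪u, v⟫_ℝ := fun u v => by
    rw [← hA, chartMetric_apply]; rfl
  have hdim : Module.finrank ℝ (EuclideanSpace ℝ (Fin n)) = Module.finrank ℝ T := rfl
  exact ⟨(f.isometryOfInner hf).toLinearIsometryEquiv hdim, fun u => rfl⟩

theorem exists_frame (hw : w ∈ (extChartAt (𝓡 n) x).target) :
    ∃ L : EuclideanSpace ℝ (Fin n) ≃L[ℝ] EuclideanSpace ℝ (Fin n),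
      ∀ u v, chartMetric x w (L u) (L v) = ⟪u, v⟫_ℝ := by
  let T := TangentSpace (𝓡 n) ((extChartAt (𝓡 n) x).symm w)
  have hdim : Module.finrank ℝ T = n := finrank_euclideanSpace_fin (𝕜 := ℝ) (n := n)
  let b : OrthonormalBasis (Fin n) ℝ T := (stdOrthonormalBasis ℝ T).reindex (finCongr hdim)
  let B := LinearEquiv.ofBijective (chartDiff x w).toLinearMap (bijective_chartDiff hw)
  let f : EuclideanSpace ℝ (Fin n) →ₗ[ℝ] EuclideanSpace ℝ (Fin n) :=
    { toFun := fun u => b.repr.symm u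
      map_add' := fun u v => map_add b.repr.symm u v
      map_smul' := fun r u => map_smul b.repr.symm r u }
  have hf : Function.Bijective f := b.repr.symm.bijective
  refine ⟨((LinearEquiv.ofBijective f hf).trans B.symm).toContinuousLinearEquiv, fun u v => ?_⟩
  have hB : ∀ u, chartDiff x w (B.symm (f u)) = f u := fun u => B.apply_symm_apply (f u)
  rw [chartMetric_apply]
  change metricInner _ (chartDiff x w (B.symm (f u))) (chartDiff x w (B.symm (f v))) = _
  rw [hB, hB]
  exact b.repr.symm.inner_map_map u v

/-- In every chart the differential of `‖R^k‖²` vanishes. -/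
theorem hasFDerivAt_normD_sq {k : ℕ} (hk : 1 ≤ k) (hn : 2 * k < n) (hn' : n ≠ 4 * k)
    (hyper : Curvature.IsHyperEinstein n M k) (weak : Curvature.IsWeaklyEinstein n M k)
    (hw : w ∈ (extChartAt (𝓡 n) x).target) :
    HasFDerivAt (fun z => normD (TangentSpace (𝓡 n) ((extChartAt (𝓡 n) x).symm z))
      (Curvature.riemann n ((extChartAt (𝓡 n) x).symm z) ^ k) ^ 2)
      (0 : EuclideanSpace ℝ (Fin n) →L[ℝ] ℝ) w := by
  obtain ⟨L, hL⟩ := exists_frame hw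
  refine hasFDerivAt_zero_of_curvForm hk hn hn' (metricAt_chartMetric hw) L hL ?_
  filter_upwards [(isOpen_extChartAt_target (I := 𝓡 n) x).mem_nhds hw] with z hz A hA
  obtain ⟨Λ, hΛ⟩ := exists_isometry_of_frame A hA
  obtain ⟨lam, hlam⟩ := hyper
  rw [← isoPull_riemann hz rfl A Λ hΛ, ← map_pow]
  constructor
  · refine ⟨lam ((extChartAt (𝓡 n) x).symm z), ?_⟩
    rw [← isoPull_contraction, hlam, map_smul, map_pow, isoPull_metricD]
  · rw [← isoPull_comp, ← isoPull_contraction_pow, ← map_smul, weak, map_smul, isoPull_metricD]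

theorem normD_sq_eventually_eq {k : ℕ} (hk : 1 ≤ k) (hn : 2 * k < n) (hn' : n ≠ 4 * k)
    (hyper : Curvature.IsHyperEinstein n M k) (weak : Curvature.IsWeaklyEinstein n M k) (x : M) :
    ∀ᶠ p in 𝓝 x, normD (TangentSpace (𝓡 n) p) (Curvature.riemann n p ^ k) ^ 2 =
      normD (TangentSpace (𝓡 n) x) (Curvature.riemann n x ^ k) ^ 2 := by
  set F : EuclideanSpace ℝ (Fin n) → ℝ := fun z =>
    normD (TangentSpace (𝓡 n) ((extChartAt (𝓡 n) x).symm z))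
      (Curvature.riemann n ((extChartAt (𝓡 n) x).symm z) ^ k) ^ 2 with hF
  obtain ⟨r, hr, hball⟩ := Metric.isOpen_iff.mp (isOpen_extChartAt_target (I := 𝓡 n) x) _
    (mem_extChartAt_target x)
  have hconst : ∀ z ∈ Metric.ball (extChartAt (𝓡 n) x x) r, F z = F (extChartAt (𝓡 n) x x) := by
    intro z hz
    have hd : ∀ w ∈ Metric.ball (extChartAt (𝓡 n) x x) r,
        HasFDerivAt F (0 : EuclideanSpace ℝ (Fin n) →L[ℝ] ℝ) w := fun w hw =>
      hasFDerivAt_normD_sq hk hn hn' (x := x) hyper weak (hball hw)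
    exact Metric.isOpen_ball.is_const_of_fderiv_eq_zero
      (convex_ball _ _).isPreconnected
      (fun w hw => (hd w hw).differentiableAt.differentiableWithinAt)
      (fun w hw => (hd w hw).fderiv) hz (Metric.mem_ball_self hr)
  filter_upwards [(continuousAt_extChartAt (I := 𝓡 n) x).preimage_mem_nhds
    (Metric.ball_mem_nhds _ hr), (isOpen_extChartAt_source x).mem_nhds
    (mem_extChartAt_source (I := 𝓡 n) x)] with p hp hps
  have h := hconst _ hp
  simp only [hF] at h
  rwa [(extChartAt (𝓡 n) x).left_inv hps,
    (extChartAt (𝓡 n) x).left_inv (mem_extChartAt_source x)] at h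

end LocalGeometry

end

theorem mainTheorem11 (n k : ℕ) (hk : 1 ≤ k) (hn : 2 * k < n) (hn' : n ≠ 4 * k)
    (M : Type*) [TopologicalSpace M] [ConnectedSpace M]
    [ChartedSpace (EuclideanSpace ℝ (Fin n)) M] [IsManifold (𝓡 n) ∞ M]
    [Bundle.RiemannianBundle (fun x : M => TangentSpace (𝓡 n) x)]
    [IsContMDiffRiemannianBundle (𝓡 n) ∞ (EuclideanSpace ℝ (Fin n))
      (fun x : M => TangentSpace (𝓡 n) x)]
    (hyper : Curvature.IsHyperEinstein n M k)
    (weak : Curvature.IsWeaklyEinstein n M k) :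
    ∃ C : ℝ, ∀ x : M,
      DoubleForms.normD (TangentSpace (𝓡 n) x) (Curvature.riemann n x ^ k) = C := by
  let N : M → ℝ := fun x => DoubleForms.normD (TangentSpace (𝓡 n) x) (Curvature.riemann n x ^ k)
  have hN : IsLocallyConstant N := by
    refine (IsLocallyConstant.iff_eventually_eq N).mpr fun x => ?_
    filter_upwards [LocalGeometry.normD_sq_eventually_eq hk hn hn' hyper weak x] with p hp
    exact (sq_eq_sq₀ (Real.sqrt_nonneg _) (Real.sqrt_nonneg _)).mp hp
  obtain ⟨x₀⟩ := (inferInstance : Nonempty M)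
  exact ⟨N x₀, fun x => hN.apply_eq_of_isPreconnected isPreconnected_univ trivial trivial⟩
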